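/- Let $\mathcal A$ be a (small) abelian category that is finitary, i.e. $\operatorname{Hom}_{\mathcal A}(X,Y)$ and $\operatorname{Ext}^1_{\mathcal A}(X,Y)$ are finite for all objects $X,Y$, and hereditary, i.e. $\operatorname{Ext}^n_{\mathcal A}=0$ for all $n\ge 2$. Let $t=0$ or let $t$ be an odd positive integer, and put $\mathbb Z_0=\mathbb Z$ and $\mathbb Z_t=\mathbb Z/t$ for $t\ge1$. For $t\ge 1$ let $\mathcal D_t(\mathcal A)$ be the relative derived category of $t$-periodic complexes $(M^i,d^i:M^i\to M^{i+1})_{i\in\mathbb Z_t}$, that is, the localization of the category of $t$-periodic complexes and homotopy classes of morphisms at the quasi-isomorphisms; let $\mathcal D_0(\mathcal A)=\mathcal D^b(\mathcal A)$ be the bounded derived category. Write $a_X=|\operatorname{Aut}(X)|$; let $g_{XY}^L$ be the number of subobjects $L'\subseteq L$ with $L'\cong Y$ and $L/L'\cong X$; and put $\langle X,Y\rangle=|\operatorname{Hom}_{\mathcal A}(X,Y)|/|\operatorname{Ext}^1_{\mathcal A}(X,Y)|$. These depend only on the isomorphism classes of the objects of $\mathcal A$; let $\operatorname{Iso}(\mathcal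 A)$ be the set of isomorphism classes. Let $\mathcal L_t(\mathcal A)$ be the $\mathbb C$-vector space whose basis is the set of isomorphism classes $[A^\bullet]$ in $\mathcal D_t(\mathcal A)$ of complexes $A^\bullet=(A^i,0)_{i\in\mathbb Z_t}$ with zero differential (bounded if $t=0$). Define a bilinear multiplication on $\mathcal L_t(\mathcal A)$ as follows, where $X^\bullet=(X^i,0)$ runs through this basis. If $t=0$, put $$[A_1^\bullet][A_2^\bullet]=\sum_{[X^\bullet]}\ \sum_{I^i,M^i,N^i}\left(\prod_{i\in\mathbb Z}g^{A_1^i}_{I^iM^i}\,g^{X^i}_{M^iN^i}\,g^{A_2^i}_{N^iI^{i-1}}\,\frac{a_{N^i}a_{M^i}a_{I^i}}{a_{A_1^i}a_{A_2^i}}\cdot\frac{\prod_{k\ge2}\langle A_2^{i+k},A_1^i\rangle^{(-1)^k}}{\langle N^{i+1},M^i\rangle}\right)[X^\bullet],$$ where the inner sum is over all families $(I^i,M^i,N^i)_{i\in\mathbb Z}$ in $\operatorname{Iso}(\mathcal A)$ with only finitely many nonzero members (all other families would contribute $0$). If $t$ is odd, put $$[A_1^\bullet][A_2^\bullet]=\sum_{[X^\bullet]}h_{A_1^\bullet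 A_2^\bullet}^{X^\bullet}\,\frac{a'_{X^\bullet}}{a'_{A_1^\bullet}a'_{A_2^\bullet}}\,[X^\bullet],$$ $$h_{A_1^\bullet A_2^\bullet}^{X^\bullet}=\sum_{M^i,N^i,S^i}\ \prod_{i\in\mathbb Z_t}\left(\frac{g_{N^iS^i}^{A_2^i}\,g_{M^iN^i}^{X^i}\,g_{S^{i+1}M^i}^{A_1^i}\,a_{M^i}a_{N^i}a_{S^i}}{a_{X^i}\langle A_1^i,S^i\rangle\langle S^{i+1},N^i\rangle}\sqrt{\langle A_1^i,A_2^i\rangle\prod_{k=1}^{t-1}\langle A_1^{i+k},A_2^i\rangle^{(-1)^{k+1}}}\right),$$ where the sum is over all families $(M^i,N^i,S^i)_{i\in\mathbb Z_t}$ in $\operatorname{Iso}(\mathcal A)$, and $$a'_{Y^\bullet}=|\operatorname{Aut}_{\mathcal D_t(\mathcal A)}(Y^\bullet)|\sqrt{\prod_{i=1}^{t}|\operatorname{Hom}_{\mathcal D_t(\mathcal A)}(Y^\bullet[i],Y^\bullet)|^{(-1)^i}}.$$ Then all these sums have only finitely many nonzero terms, and $\mathcal L_t(\mathcal A)$ is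 an associative $\mathbb C$-algebra with two-sided unit $[0]$. -/

import Mathlib

open CategoryTheory CategoryTheory.Limits

universe w v u

namespace HallPeriodic

noncomputable section

/-! ### Finitary hereditary abelian categories -/

/-- An abelian category is finitary if all its `Hom` and `Ext¹` groups are finite. -/
structure IsFinitary (A : Type u) [Category.{v} A] [Abelian A] [HasExt.{w} A] : Prop where
  finite_hom : ∀ X Y : A, Finite (X ⟶ Y)
  finite_ext : ∀ X Y : A, Finite (Abelian.Ext.{w} X Y 1)

/-- An abelian category is hereditary if all its `Extⁿ` groups with `n ≥ 2` vanish. -/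
def IsHereditary (A : Type u) [Category.{v} A] [Abelian A] [HasExt.{w} A] : Prop :=
  ∀ (X Y : A) (n : ℕ), 2 ≤ n → Subsingleton (Abelian.Ext.{w} X Y n)

/-! ### Isomorphism classes, automorphisms, Hall numbers, Euler form -/

section Abelian

variable (A : Type u) [Category.{v} A] [Abelian A]

/-- The isomorphism classes of objects of `A`. -/
abbrev IsoCls : Type u := Quotient (isIsomorphicSetoid A)

variable {A}

/-- The isomorphism class `[X]`. -/
abbrev isoCls (X : A) : IsoCls A := Quotient.mk (isIsomorphicSetoid A) X

open ZeroObject in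
instance : Zero (IsoCls A) := ⟨isoCls (0 : A)⟩

/-- The order `a_X` of the automorphism group of `X`. -/
def autCard : IsoCls A → ℕ :=
  Quotient.lift (fun X : A => Nat.card (Aut X)) (by
    rintro X Y ⟨e⟩
    exact Nat.card_congr (Aut.autMulEquivOfIso e).toEquiv)

/-- The Hall number `g_{XY}^L`: the number of subobjects `L'` of `L` with `L' ≅ Y` and
`L / L' ≅ X`. The isomorphism classes are given in the order `x`, `y`, `l`. -/
def hallNumber (x y : IsoCls A) : IsoCls A → ℕ :=
  Quotient.lift
    (fun L : A => Nat.card {S : Subobject L //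
      isoCls (S : A) = y ∧ isoCls (cokernel S.arrow) = x}) (by
    rintro L M ⟨e⟩
    refine Nat.card_congr ((Subobject.mapIsoToOrderIso e).toEquiv.subtypeEquiv fun S => ?_)
    induction S using Quotient.inductionOn' with | _ S =>
    have h₁ : isoCls ((Subobject.mk (S.arrow ≫ e.hom) : Subobject M) : A) =
        isoCls ((Subobject.mk S.arrow : Subobject L) : A) :=
      Quotient.sound ⟨Subobject.underlyingIso _ ≪≫ (Subobject.underlyingIso _).symm⟩
    have h₂ : isoCls (cokernel (Subobject.mk (S.arrow ≫ e.hom)).arrow) =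
        isoCls (cokernel (Subobject.mk S.arrow).arrow) :=
      Quotient.sound ⟨cokernel.mapIso _ _
        (Subobject.underlyingIso _ ≪≫ (Subobject.underlyingIso _).symm) e.symm (by
          rw [← cancel_epi (Subobject.underlyingIso (S.arrow ≫ e.hom)).inv]
          simp)⟩
    change isoCls ((Subobject.mk S.arrow : Subobject L) : A) = y ∧
        isoCls (cokernel (Subobject.mk S.arrow).arrow) = x ↔
      isoCls ((Subobject.mk (S.arrow ≫ e.hom) : Subobject M) : A) = y ∧
        isoCls (cokernel (Subobject.mk (S.arrow ≫ e.hom)).arrow) = x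
    rw [h₁, h₂])

/-- The multiplicative Euler form `⟨X, Y⟩ = |Hom(X, Y)| / |Ext¹(X, Y)|`. -/
def eulerForm [HasExt.{w} A] : IsoCls A → IsoCls A → ℝ :=
  Quotient.lift₂
    (fun X Y : A => (Nat.card (X ⟶ Y) : ℝ) / (Nat.card (Abelian.Ext.{w} X Y 1) : ℝ)) (by
    rintro X Y X' Y' ⟨e⟩ ⟨f⟩
    have h₁ : Nat.card (X ⟶ Y) = Nat.card (X' ⟶ Y') := Nat.card_congr (e.homCongr f)
    have h₂ : Nat.card (Abelian.Ext.{w} X Y 1) = Nat.card (Abelian.Ext.{w} X' Y' 1) :=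
      Nat.card_congr
        ((((Abelian.extFunctor.{w} 1).mapIso e.symm.op).app Y ≪≫
          ((Abelian.extFunctor.{w} 1).obj (Opposite.op X')).mapIso f).addCommGroupIsoToAddEquiv.toEquiv)
    simp only [h₁, h₂])

end Abelian

/-! ### The categories of `t`-periodic (for `t = 0`: bounded) complexes

The index set is `ZMod t`, which is `ℤ` for `t = 0`. -/

section Complexes

variable (A : Type u) [Category.{v} A] [Abelian A] (t : ℕ)

/-- Complexes `(Mⁱ, dⁱ : Mⁱ ⟶ Mⁱ⁺¹)` indexed by `i ∈ ZMod t`. -/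
abbrev Cx := HomologicalComplex A (ComplexShape.up (ZMod t))

/-- Complexes with only finitely many nonzero terms: a condition for `t = 0` only, where it
says that the complex is bounded. -/
def isBounded : ObjectProperty (HomotopyCategory A (ComplexShape.up (ZMod t))) :=
  fun K => {i | ¬ IsZero (K.as.X i)}.Finite

/-- The relative homotopy category of `t`-periodic complexes, and `K^b(A)` for `t = 0`. -/
abbrev RelHomotopyCat := (isBounded A t).FullSubcategory

/-- The quasi-isomorphisms of the relative homotopy category. -/
abbrev relQuasiIso : MorphismProperty (RelHomotopyCat A t) :=
  (HomotopyCategory.quasiIso A (ComplexShape.up (ZMod t))).inverseImage (isBounded A t).ι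

/-- The relative derived category `D_t(A)`, and `D^b(A)` for `t = 0`: the localization of the
relative homotopy category with respect to the quasi-isomorphisms. -/
abbrev RelDerivedCat := (relQuasiIso A t).Localization

/-- Families `(Aⁱ)` of objects, `i ∈ ZMod t`, with finitely many nonzero members: these are
the complexes with zero differential. -/
structure GradedObj where
  obj : ZMod t → A
  finite : {i | ¬ IsZero (obj i)}.Finite

variable {A t}

namespace GradedObj

/-- The complex `(Aⁱ, 0)`. -/
def toCx (M : GradedObj A t) : Cx A t where
  X := M.obj
  d _ _ := 0

/-- The complex `(Aⁱ, 0)` as an object of the relative homotopy category. -/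
def toK (M : GradedObj A t) : RelHomotopyCat A t :=
  ⟨(HomotopyCategory.quotient A _).obj M.toCx, M.finite⟩

/-- The complex `(Aⁱ, 0)` as an object of the relative derived category. -/
def toD (M : GradedObj A t) : RelDerivedCat A t :=
  (relQuasiIso A t).Q.obj M.toK

/-- The shift `[n]`, with `M[n]ⁱ = Mⁱ⁺ⁿ`; on complexes with zero differential the sign
`(-1)ⁿ` of the shifted differential plays no role. -/
def shift (M : GradedObj A t) (n : ℕ) : GradedObj A t where
  obj i := M.obj (i + n)
  finite := M.finite.preimage (add_left_injective (n : ZMod t)).injOn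

open ZeroObject in
instance : Zero (GradedObj A t) :=
  ⟨{ obj := fun _ => 0
     finite := by
      convert Set.finite_empty using 1
      ext i
      simpa using isZero_zero A }⟩

/-- Graded objects with isomorphic components are isomorphic in the derived category. -/
def isoD {M N : GradedObj A t} (e : ∀ i, M.obj i ≅ N.obj i) : M.toD ≅ N.toD :=
  (relQuasiIso A t).Q.mapIso ((isBounded A t).isoMk
    ((HomotopyCategory.quotient A _).mapIso
      (HomologicalComplex.Hom.isoOfComponents (C₁ := M.toCx) (C₂ := N.toCx) e (by
        intro i j _
        simp [toCx]))))

/-- The components of a complex with zero differential are its homology objects. -/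
def homologyIso (M : GradedObj A t) (i : ZMod t) : M.toCx.homology i ≅ M.obj i :=
  (M.toCx.isoHomologyπ _ i rfl rfl).symm ≪≫ M.toCx.iCyclesIso i _ rfl rfl

lemma homology_inverts (i : ZMod t) : (relQuasiIso A t).IsInvertedBy
    ((isBounded A t).ι ⋙ HomotopyCategory.homologyFunctor A _ i) :=
  fun _ _ _ hf => HomotopyCategory.homologyFunctor_inverts_quasiIso A _ i _ hf

/-- The homology functors on the relative derived category. -/
def homologyD (i : ZMod t) : RelDerivedCat A t ⥤ A :=
  Localization.lift _ (homology_inverts i) (relQuasiIso A t).Q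

/-- The homology of the complex `(Aⁱ, 0)` in the relative derived category. -/
def homologyDIso (M : GradedObj A t) (i : ZMod t) : (homologyD i).obj M.toD ≅ M.obj i :=
  (Localization.fac _ (homology_inverts i) (relQuasiIso A t).Q).app M.toK ≪≫
  (HomotopyCategory.homologyFunctorFactors A _ i).app M.toCx ≪≫ M.homologyIso i

/-- Complexes with zero differential that are isomorphic in the relative derived category have
isomorphic components. -/
def isoObj {M N : GradedObj A t} (e : M.toD ≅ N.toD) (i : ZMod t) : M.obj i ≅ N.obj i :=
  (M.homologyDIso i).symm ≪≫ (homologyD i).mapIso e ≪≫ N.homologyDIso i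

end GradedObj

/-! ### The algebra `L_t(A)` -/

variable (A t) in
/-- The set of classes `[A•]` of complexes `A• = (Aⁱ, 0)` up to isomorphism in `D_t(A)`. -/
def BasisCls : Type u :=
  Quotient ((isIsomorphicSetoid (RelDerivedCat A t)).comap GradedObj.toD)

namespace BasisCls

/-- The class `[A•]`. -/
def mk (M : GradedObj A t) : BasisCls A t := Quotient.mk _ M

/-- The class `[0]`. -/
instance : Zero (BasisCls A t) := ⟨mk 0⟩

/-- The isomorphism class of the component `Aⁱ` of `[A•]`. -/
def comp (a : BasisCls A t) (i : ZMod t) : IsoCls A :=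
  Quotient.lift (fun M : GradedObj A t => isoCls (M.obj i)) (by
    rintro M N ⟨e⟩
    exact Quotient.sound ⟨GradedObj.isoObj e i⟩) a

/-- `a'_{Y•} = a_{Y•} √(∏_{i=1}^t |Hom(Y•[i], Y•)|^{(-1)^i})`, where `a_{Y•}` is the order of
the automorphism group, both taken in the relative derived category. -/
def modAut : BasisCls A t → ℝ :=
  Quotient.lift
    (fun M : GradedObj A t => (Nat.card (Aut M.toD) : ℝ) *
      √(∏ i ∈ Finset.Icc 1 t, (Nat.card ((M.shift i).toD ⟶ M.toD) : ℝ) ^ ((-1 : ℤ) ^ i))) (by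
    rintro M N ⟨e⟩
    have h₁ : Nat.card (Aut M.toD) = Nat.card (Aut N.toD) :=
      Nat.card_congr (Aut.autMulEquivOfIso e).toEquiv
    have h₂ (n : ℕ) : Nat.card ((M.shift n).toD ⟶ M.toD) =
        Nat.card ((N.shift n).toD ⟶ N.toD) :=
      Nat.card_congr (Iso.homCongr (GradedObj.isoD fun i => GradedObj.isoObj e (i + n)) e)
    simp only [h₁, h₂])

end BasisCls

section Multiplication

variable [HasExt.{w} A]

/-- The summand, indexed by families `(Iⁱ, Mⁱ, Nⁱ)`, of the structure constant of `[X•]` in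
`[A₁•][A₂•]` for bounded complexes (`t = 0`). Only families with finitely many nonzero members
occur, as the product of the Hall numbers is zero for all others. -/
def boundedTerm (a₁ a₂ x : BasisCls A t)
    (p : (ZMod t →₀ IsoCls A) × (ZMod t →₀ IsoCls A) × (ZMod t →₀ IsoCls A)) : ℝ :=
  let I := p.1
  let M := p.2.1
  let N := p.2.2
  ∏ᶠ i : ZMod t,
    ((hallNumber (I i) (M i) (a₁.comp i) * hallNumber (M i) (N i) (x.comp i) *
        hallNumber (N i) (I (i - 1)) (a₂.comp i) : ℝ) *
      ((autCard (N i) * autCard (M i) * autCard (I i) : ℝ) /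
        (autCard (a₁.comp i) * autCard (a₂.comp i) : ℝ)) *
      ((∏ᶠ (k : ℕ) (_ : 2 ≤ k),
          eulerForm.{w} (a₂.comp (i + k)) (a₁.comp i) ^ ((-1 : ℤ) ^ k)) /
        eulerForm.{w} (N (i + 1)) (M i)))

/-- The summand, indexed by families `(Mⁱ, Nⁱ, Sⁱ)`, of the number `h_{A₁• A₂•}^{X•}` for
`t`-periodic complexes (`t` odd). -/
def periodicTerm (a₁ a₂ x : BasisCls A t)
    (p : (ZMod t → IsoCls A) × (ZMod t → IsoCls A) × (ZMod t → IsoCls A)) : ℝ :=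
  let M := p.1
  let N := p.2.1
  let S := p.2.2
  ∏ᶠ i : ZMod t,
    ((hallNumber (N i) (S i) (a₂.comp i) * hallNumber (M i) (N i) (x.comp i) *
        hallNumber (S (i + 1)) (M i) (a₁.comp i) *
        autCard (M i) * autCard (N i) * autCard (S i) : ℝ) /
      (autCard (x.comp i) * eulerForm.{w} (a₁.comp i) (S i) *
        eulerForm.{w} (S (i + 1)) (N i)) *
      √(eulerForm.{w} (a₁.comp i) (a₂.comp i) *
        ∏ k ∈ Finset.Icc 1 (t - 1),
          eulerForm.{w} (a₁.comp (i + k)) (a₂.comp i) ^ ((-1 : ℤ) ^ (k + 1))))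

/-- The coefficient of `[X•]` in the product `[A₁•][A₂•]`. -/
def structConst (a₁ a₂ x : BasisCls A t) : ℝ :=
  if t = 0 then ∑ᶠ p, boundedTerm.{w} a₁ a₂ x p
  else (∑ᶠ p, periodicTerm.{w} a₁ a₂ x p) * (x.modAut / (a₁.modAut * a₂.modAut))

end Multiplication

variable (A t) in
/-- The complex vector space `L_t(A)` with basis the classes `[A•]`. -/
abbrev HallSpace : Type u := BasisCls A t →₀ ℂ

/-- The basis vector `[A•]` of `L_t(A)`. -/
def basisVec (a : BasisCls A t) : HallSpace A t := Finsupp.single a 1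

variable (A t) in
/-- The multiplication of `L_t(A)`: the bilinear map that sends a pair of basis vectors
`[A₁•]`, `[A₂•]` to the linear combination of all `[X•]` with the structure constants as
coefficients. -/
def hallMul [HasExt.{w} A] : HallSpace A t →ₗ[ℂ] HallSpace A t →ₗ[ℂ] HallSpace A t :=
  Finsupp.linearCombination ℂ fun a₁ : BasisCls A t =>
    Finsupp.linearCombination ℂ fun a₂ : BasisCls A t =>
      ∑ᶠ x : BasisCls A t, ((structConst.{w} a₁ a₂ x : ℝ) : ℂ) • basisVec x

end Complexes

end

end HallPeriodic

/-! Up to rescaling the basis, the structure constants count pieces of long exact sequences. Work in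
the category `Gr` of finitely supported graded objects with its shift `[1]`. A triangle `A₂ → X → A₁
→ A₂[1]` with connecting morphism `f : A₁[-1] → A₂` makes `X` an extension of `(ker f)[1]` by `coker
f`. Accordingly `coeff` sums over all `f` a weight `w` in the classes of `A₁`, `A₂` and `im f`,
times the number of short exact sequences `coker f → X → (ker f)[1]`, and divides by `|Aut X|`.

In `∑_X coeff(A₁, A₂, X) coeff(X, A₃, Y)` the object `X` is such an extension and, after
transposing, also the source of a morphism to `A₃[1]`. This morphism is encoded by its restriction
`g` to `coker f` and the map `γ : (ker f)[1] → coker g` it induces. `GreenData.sum_corner` counts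
the pairs of an extension `X` and a morphism with prescribed `g`, `γ` and kernel, so that `X`
disappears. The count is a form of Green's formula and rests on the single axiom `GreenData.green`:
the fillings of a morphism `θ` by middle terms, weighted by `1/|Aut X|`, number `1/⟨coker θ, ker
θ⟩`. In a finitary hereditary category (`greenData`) this follows from Riedtmann's formula, from the
surjectivity of `Ext¹(I, D) → Ext¹(I, T)` for an epimorphism `D → T`, and from the multiplicativity
of the Euler form.

The axiom is self-dual, so the other bracketing is treated in the opposite category, with
associativity of Hall numbers (`GreenData.ses_assoc`) restoring the shape of the inner sum. Both
sides become sums over complexes `A₁[-1] → A₂ → A₃[1]` and morphisms `γ`;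
`coeff_assoc_of_comp_eq_zero` matches the summands, provided that `w` satisfies a cocycle identity.

The weights are exponentials of bilinear forms on the graded Grothendieck group, and the identity
reduces to a relation for the twist `T`, with `b` the logarithm of the Euler form: `T(x[1], y) +
T(x, y)` equals `b(x[2], y)` for `t = 0` and `b(x[1], y)` for odd `t`. The alternating sum over
shifts at least 2 solves the former, half the alternating sum around the cycle the latter; it closes
up because `t` is odd.

Sorting the morphisms `f` by kernel, image and cokernel turns `coeff` into the stated sums of Hall
numbers, up to a factor `μ(X) / (μ(A₁) μ(A₂))` with `μ = |Aut|` for `t = 0` and `μ = a'` for odd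
`t`. Such a factor does not affect associativity as long as `μ` never vanishes, and the unit needs
only `μ(0) = 1`. For `a'` the nonvanishing requires finite `Hom` sets in the relative derived
category (`finite_hom_toD`), which is proved by representing all morphisms by a finite family of
roofs. -/

set_option linter.unusedSectionVars false

namespace HallPeriodic

noncomputable section

/-! ### Kernels, cokernels and short exact sequences in terms of generalized elements -/

section Exactness

variable {C : Type u} [Category.{v} C]

/-- The morphism `k` is a kernel of `g`. -/
structure IsKer [HasZeroMorphisms C] {K X B : C} (k : K ⟶ X) (g : X ⟶ B) : Prop where
  mono : Mono k
  zero : k ≫ g = 0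
  lift : ∀ {Z : C} (x : Z ⟶ X), x ≫ g = 0 → ∃ y : Z ⟶ K, y ≫ k = x

/-- The morphism `q` is a cokernel of `f`. -/
structure IsCoker [HasZeroMorphisms C] {A X Q : C} (f : A ⟶ X) (q : X ⟶ Q) : Prop where
  epi : Epi q
  zero : f ≫ q = 0
  desc : ∀ {Z : C} (x : X ⟶ Z), f ≫ x = 0 → ∃ y : Q ⟶ Z, q ≫ y = x

/-- The sequence `0 ⟶ N ⟶ X ⟶ M ⟶ 0` is short exact. -/
structure IsSES [HasZeroMorphisms C] {N X M : C} (i : N ⟶ X) (p : X ⟶ M) : Prop where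
  isKer : IsKer i p
  isCoker : IsCoker i p

section Zero

variable [HasZeroMorphisms C]

lemma IsKer.op {K X B : C} {k : K ⟶ X} {g : X ⟶ B} (h : IsKer k g) : IsCoker g.op k.op where
  epi := by have := h.mono; infer_instance
  zero := by rw [← op_comp, h.zero, op_zero]
  desc x hx := by
    obtain ⟨y, hy⟩ := h.lift x.unop (Quiver.Hom.op_inj (by simpa using hx))
    exact ⟨y.op, Quiver.Hom.unop_inj (by simpa using hy)⟩

lemma IsCoker.op {A X Q : C} {f : A ⟶ X} {q : X ⟶ Q} (h : IsCoker f q) : IsKer q.op f.op where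
  mono := by have := h.epi; infer_instance
  zero := by rw [← op_comp, h.zero, op_zero]
  lift x hx := by
    obtain ⟨y, hy⟩ := h.desc x.unop (Quiver.Hom.op_inj (by simpa using hx))
    exact ⟨y.op, Quiver.Hom.unop_inj (by simpa using hy)⟩

lemma IsKer.unop {K X B : Cᵒᵖ} {k : K ⟶ X} {g : X ⟶ B} (h : IsKer k g) :
    IsCoker g.unop k.unop where
  epi := by have := h.mono; infer_instance
  zero := by rw [← unop_comp, h.zero, unop_zero]
  desc x hx := by
    obtain ⟨y, hy⟩ := h.lift x.op (Quiver.Hom.unop_inj (by simpa using hx))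
    exact ⟨y.unop, Quiver.Hom.op_inj (by simpa using hy)⟩

lemma IsCoker.unop {A X Q : Cᵒᵖ} {f : A ⟶ X} {q : X ⟶ Q} (h : IsCoker f q) :
    IsKer q.unop f.unop where
  mono := by have := h.epi; infer_instance
  zero := by rw [← unop_comp, h.zero, unop_zero]
  lift x hx := by
    obtain ⟨y, hy⟩ := h.desc x.op (Quiver.Hom.unop_inj (by simpa using hx))
    exact ⟨y.unop, Quiver.Hom.op_inj (by simpa using hy)⟩

lemma IsSES.op {N X M : C} {i : N ⟶ X} {p : X ⟶ M} (h : IsSES i p) : IsSES p.op i.op :=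
  ⟨h.isCoker.op, h.isKer.op⟩

lemma IsSES.unop {N X M : Cᵒᵖ} {i : N ⟶ X} {p : X ⟶ M} (h : IsSES i p) :
    IsSES p.unop i.unop :=
  ⟨h.isCoker.unop, h.isKer.unop⟩

/-- Two kernels of the same morphism are isomorphic. -/
lemma IsKer.exists_iso {K K' X B : C} {k : K ⟶ X} {k' : K' ⟶ X} {g : X ⟶ B}
    (h : IsKer k g) (h' : IsKer k' g) : ∃ e : K ≅ K', e.hom ≫ k' = k := by
  obtain ⟨a, ha⟩ := h'.lift k h.zero
  obtain ⟨b, hb⟩ := h.lift k' h'.zero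
  have := h.mono
  have := h'.mono
  exact ⟨⟨a, b, by simp [← cancel_mono k, ha, hb], by simp [← cancel_mono k', ha, hb]⟩, ha⟩

lemma IsCoker.exists_iso {A X Q Q' : C} {f : A ⟶ X} {q : X ⟶ Q} {q' : X ⟶ Q'}
    (h : IsCoker f q) (h' : IsCoker f q') : ∃ e : Q ≅ Q', q ≫ e.hom = q' := by
  obtain ⟨a, ha⟩ := h.desc q' h'.zero
  obtain ⟨b, hb⟩ := h'.desc q h.zero
  have := h.epi
  have := h'.epi
  exact ⟨⟨a, b, by simp [← cancel_epi q, reassoc_of% ha, hb],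
    by simp [← cancel_epi q', reassoc_of% hb, ha]⟩, ha⟩

lemma IsKer.iso_comp {K K' X B : C} {k : K ⟶ X} {g : X ⟶ B} (h : IsKer k g) (e : K' ≅ K) :
    IsKer (e.hom ≫ k) g where
  mono := by have := h.mono; infer_instance
  zero := by rw [Category.assoc, h.zero, comp_zero]
  lift x hx := by
    obtain ⟨y, rfl⟩ := h.lift x hx
    exact ⟨y ≫ e.inv, by simp⟩

lemma IsCoker.comp_iso {A X Q Q' : C} {f : A ⟶ X} {q : X ⟶ Q} (h : IsCoker f q) (e : Q ≅ Q') :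
    IsCoker f (q ≫ e.hom) where
  epi := by have := h.epi; infer_instance
  zero := by rw [← Category.assoc, h.zero, zero_comp]
  desc x hx := by
    obtain ⟨y, rfl⟩ := h.desc x hx
    exact ⟨e.inv ≫ y, by simp⟩

lemma IsKer.comp_mono {K X B B' : C} {k : K ⟶ X} {g : X ⟶ B} (h : IsKer k g) (m : B ⟶ B')
    [Mono m] : IsKer k (g ≫ m) where
  mono := h.mono
  zero := by rw [← Category.assoc, h.zero, zero_comp]
  lift x hx := h.lift x (by rw [← cancel_mono m, Category.assoc, hx, zero_comp])

lemma IsCoker.epi_comp {A A' X Q : C} {f : A ⟶ X} {q : X ⟶ Q} (h : IsCoker f q) (m : A' ⟶ A)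
    [Epi m] : IsCoker (m ≫ f) q where
  epi := h.epi
  zero := by rw [Category.assoc, h.zero, comp_zero]
  desc x hx := h.desc x (by rw [← cancel_epi m, ← Category.assoc, hx, comp_zero])

lemma IsKer.of_comp_mono {K X B B' : C} {k : K ⟶ X} {g : X ⟶ B} (m : B ⟶ B')
    [Mono m] (h : IsKer k (g ≫ m)) : IsKer k g where
  mono := h.mono
  zero := by rw [← cancel_mono m, Category.assoc, h.zero, zero_comp]
  lift x hx := h.lift x (by rw [← Category.assoc, hx, zero_comp])

lemma IsCoker.of_epi_comp {A A' X Q : C} {f : A ⟶ X} {q : X ⟶ Q} (m : A' ⟶ A)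
    [Epi m] (h : IsCoker (m ≫ f) q) : IsCoker f q where
  epi := h.epi
  zero := by rw [← cancel_epi m, ← Category.assoc, h.zero, comp_zero]
  desc x hx := h.desc x (by rw [Category.assoc, hx, comp_zero])

lemma IsKer.iso_mid {K X X' B : C} {k : K ⟶ X} {g : X ⟶ B} (h : IsKer k g) (e : X ≅ X') :
    IsKer (k ≫ e.hom) (e.inv ≫ g) where
  mono := by have := h.mono; infer_instance
  zero := by simp [h.zero]
  lift x hx := by
    obtain ⟨y, hy⟩ := h.lift (x ≫ e.inv) (by simpa using hx)
    exact ⟨y, by rw [← Category.assoc, hy]; simp⟩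

lemma IsCoker.iso_mid {K X X' B : C} {k : K ⟶ X} {g : X ⟶ B} (h : IsCoker k g) (e : X ≅ X') :
    IsCoker (k ≫ e.hom) (e.inv ≫ g) where
  epi := by have := h.epi; infer_instance
  zero := by simp [h.zero]
  desc x hx := by
    obtain ⟨y, hy⟩ := h.desc (e.hom ≫ x) (by simpa using hx)
    exact ⟨y, by rw [Category.assoc, hy]; simp⟩

lemma IsSES.iso_conj {N N' X X' M M' : C} {i : N ⟶ X} {p : X ⟶ M} (h : IsSES i p)
    (a : N' ≅ N) (e : X ≅ X') (c : M ≅ M') :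
    IsSES (a.hom ≫ i ≫ e.hom) (e.inv ≫ p ≫ c.hom) := by
  refine ⟨?_, ?_⟩
  · have := (h.isKer.iso_mid e).iso_comp a
    simpa using this.comp_mono c.hom
  · have := (h.isCoker.iso_mid e).comp_iso c
    simpa using this.epi_comp a.hom

end Zero

section Abelian

variable [Abelian C]

lemma isKer_kernel {X B : C} (g : X ⟶ B) : IsKer (kernel.ι g) g :=
  ⟨inferInstance, kernel.condition g, fun x hx => ⟨kernel.lift g x hx, by simp⟩⟩

lemma isCoker_cokernel {A X : C} (f : A ⟶ X) : IsCoker f (cokernel.π f) :=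
  ⟨inferInstance, cokernel.condition f, fun x hx => ⟨cokernel.desc f x hx, by simp⟩⟩

/-- A cokernel sequence is exact up to refinements. -/
lemma IsCoker.exists_refinement {A X Q : C} {f : A ⟶ X} {q : X ⟶ Q} (h : IsCoker f q) {Z : C}
    (x : Z ⟶ X) (hx : x ≫ q = 0) :
    ∃ (Z' : C) (π : Z' ⟶ Z) (_ : Epi π) (y : Z' ⟶ A), π ≫ x = y ≫ f := by
  obtain ⟨e, he⟩ := h.exists_iso (isCoker_cokernel f)
  have hex : (ShortComplex.mk f (cokernel.π f) (cokernel.condition f)).Exact :=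
    ShortComplex.exact_of_g_is_cokernel _ (cokernelIsCokernel f)
  have hx' : x ≫ cokernel.π f = 0 := by rw [← he, ← Category.assoc, hx, zero_comp]
  exact hex.exact_up_to_refinements x hx'

/-- A monomorphism through which all elements killed by `g` factor up to refinements is a
kernel. -/
lemma IsKer.of_refinement {K X B : C} {k : K ⟶ X} {g : X ⟶ B} (hm : Mono k) (h0 : k ≫ g = 0)
    (h : ∀ {Z : C} (x : Z ⟶ X), x ≫ g = 0 →
      ∃ (Z' : C) (π : Z' ⟶ Z) (_ : Epi π) (y : Z' ⟶ K), π ≫ x = y ≫ k) : IsKer k g := by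
  have hex : (ShortComplex.mk k g h0).Exact := by
    rw [ShortComplex.exact_iff_exact_up_to_refinements]
    intro Z x hx
    exact h x hx
  exact ⟨hm, h0, fun x hx => ⟨hex.lift x hx, hex.lift_f x hx⟩⟩

lemma IsCoker.of_refinement {A X Q : C} {f : A ⟶ X} {q : X ⟶ Q} (hm : Epi q) (h0 : f ≫ q = 0)
    (h : ∀ {Z : C} (x : Z ⟶ X), x ≫ q = 0 →
      ∃ (Z' : C) (π : Z' ⟶ Z) (_ : Epi π) (y : Z' ⟶ A), π ≫ x = y ≫ f) : IsCoker f q := by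
  have hex : (ShortComplex.mk f q h0).Exact := by
    rw [ShortComplex.exact_iff_exact_up_to_refinements]
    intro Z x hx
    exact h x hx
  exact ⟨hm, h0, fun x hx => ⟨hex.desc x hx, hex.g_desc x hx⟩⟩

lemma IsKer.isSES {N X M : C} {i : N ⟶ X} {p : X ⟶ M} (h : IsKer i p) (hp : Epi p) :
    IsSES i p := by
  refine ⟨h, IsCoker.of_refinement hp h.zero fun x hx => ?_⟩
  obtain ⟨y, hy⟩ := h.lift x hx
  exact ⟨_, 𝟙 _, inferInstance, y, by simp [hy]⟩

lemma IsCoker.isSES {N X M : C} {i : N ⟶ X} {p : X ⟶ M} (h : IsCoker i p) (hi : Mono i) :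
    IsSES i p :=
  ⟨IsKer.of_refinement hi h.zero fun x hx => h.exists_refinement x hx, h⟩

lemma isSES_iff_shortExact {N X M : C} {i : N ⟶ X} {p : X ⟶ M} (w : i ≫ p = 0) :
    IsSES i p ↔ (ShortComplex.mk i p w).ShortExact := by
  constructor
  · intro h
    have := h.isKer.mono
    have := h.isCoker.epi
    refine ⟨?_⟩
    rw [ShortComplex.exact_iff_exact_up_to_refinements]
    intro Z x hx
    exact h.isCoker.exists_refinement x hx
  · intro h
    have := h.mono_f
    have := h.epi_g
    exact ⟨⟨h.mono_f, w, fun x hx => ⟨h.exact.lift x hx, h.exact.lift_f x hx⟩⟩,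
      ⟨h.epi_g, w, fun x hx => ⟨h.exact.desc x hx, h.exact.g_desc x hx⟩⟩⟩

lemma IsSES.shortExact {N X M : C} {i : N ⟶ X} {p : X ⟶ M} (h : IsSES i p) :
    (ShortComplex.mk i p h.isKer.zero).ShortExact :=
  (isSES_iff_shortExact _).1 h

/-- A middle term filling the morphism `θ : D ⟶ F`: if `D ⟶ X ⟶ coker θ` is short exact, then so
is `ker θ ⟶ X ⟶ F`. -/
lemma IsSES.of_factorization {H D X F I : C} {k : H ⟶ D} {θ : D ⟶ F} {q : F ⟶ I} {u : D ⟶ X}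
    {v : X ⟶ F} (hk : IsKer k θ) (hq : IsCoker θ q) (huv : u ≫ v = θ)
    (h : IsSES u (v ≫ q)) : IsSES (k ≫ u) v := by
  have := hk.mono
  have := h.isKer.mono
  refine IsKer.isSES ⟨inferInstance, by rw [Category.assoc, huv, hk.zero], fun x hx => ?_⟩ ?_
  · obtain ⟨d, rfl⟩ := h.isKer.lift x (by rw [← Category.assoc, hx, zero_comp])
    obtain ⟨y, rfl⟩ := hk.lift d (by rw [← huv, ← Category.assoc, hx])
    exact ⟨y, by simp⟩
  · rw [epi_iff_surjective_up_to_refinements]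
    intro Z y
    have := h.isCoker.epi
    obtain ⟨Z₁, π₁, _, x, hx⟩ := surjective_up_to_refinements_of_epi (v ≫ q) (y ≫ q)
    obtain ⟨Z₂, π₂, _, d, hd⟩ := hq.exists_refinement (π₁ ≫ y - x ≫ v) (by
      rw [Preadditive.sub_comp, sub_eq_zero]
      simpa using hx)
    refine ⟨Z₂, π₂ ≫ π₁, inferInstance, d ≫ u + π₂ ≫ x, ?_⟩
    rw [Preadditive.comp_sub, sub_eq_iff_eq_add] at hd
    simp [hd, huv]

/-- The converse is the forward implication in the opposite category, where the kernel and the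
cokernel of `θ` change places. This is the symmetry that makes the count of fillings self-dual. -/
lemma isSES_factorization_iff {H D X F I : C} {k : H ⟶ D} {θ : D ⟶ F} {q : F ⟶ I} {u : D ⟶ X}
    {v : X ⟶ F} (hk : IsKer k θ) (hq : IsCoker θ q) (huv : u ≫ v = θ) :
    IsSES u (v ≫ q) ↔ IsSES (k ≫ u) v := by
  refine ⟨fun h => h.of_factorization hk hq huv, fun h => ?_⟩
  have h' := IsSES.of_factorization (k := q.op) (θ := θ.op) (q := k.op) (u := v.op) (v := u.op)
    hq.op hk.op (by rw [← op_comp, huv]) (by rw [← op_comp]; exact h.op)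
  rw [← op_comp] at h'
  exact h'.unop

end Abelian

end Exactness

/-! ### Counting short exact sequences -/

section Counting

variable {C : Type u} [Category.{v} C]

/-- A category with finite `Hom` sets. -/
class FiniteHom (C : Type u) [Category.{v} C] : Prop where
  finite (X Y : C) : Finite (X ⟶ Y)

attribute [instance] FiniteHom.finite

instance [FiniteHom C] : FiniteHom Cᵒᵖ :=
  ⟨fun X Y => Finite.of_equiv (Y.unop ⟶ X.unop) (opEquiv X Y).symm⟩

instance [FiniteHom C] (X Y : C) : Finite (X ≅ Y) :=
  Finite.of_injective (fun e : X ≅ Y => e.hom) fun _ _ h => Iso.ext h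

/-- The order of the automorphism group of `X`, as a real number. -/
def aut (X : C) : ℝ := Nat.card (X ≅ X)

lemma aut_congr {X Y : C} (e : X ≅ Y) : aut X = aut Y := by
  unfold aut
  congr 1
  exact Nat.card_congr (e.isoCongr e)

lemma aut_ne_zero [FiniteHom C] (X : C) : aut X ≠ 0 := by
  have : Nonempty (X ≅ X) := ⟨Iso.refl X⟩
  unfold aut
  exact_mod_cast Nat.card_pos.ne'

lemma card_iso_of_iso {X Y : C} (e : X ≅ Y) : (Nat.card (X ≅ Y) : ℝ) = aut X := by
  unfold aut
  congr 1
  exact Nat.card_congr ((Iso.refl X).isoCongr e.symm)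

lemma aut_op (X : C) : aut (Opposite.op X) = aut X := by
  unfold aut
  congr 1
  exact Nat.card_congr ((isoOpEquiv _ _))

/-- The number of short exact sequences `0 ⟶ N ⟶ X ⟶ M ⟶ 0`. -/
def ses [HasZeroMorphisms C] (N X M : C) : ℝ :=
  Nat.card {s : (N ⟶ X) × (X ⟶ M) // IsSES s.1 s.2}

lemma ses_congr [HasZeroMorphisms C] {N X M N' X' M' : C} (a : N ≅ N') (e : X ≅ X')
    (c : M ≅ M') : ses N X M = ses N' X' M' := by
  unfold ses
  congr 1
  refine Nat.card_congr (Equiv.subtypeEquiv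
    (Equiv.prodCongr (a.homCongr e) (e.homCongr c)) fun s => ⟨fun h => ?_, fun h => ?_⟩)
  · simpa using h.iso_conj a.symm e c
  · simpa using h.iso_conj a e.symm c.symm

lemma ses_op [HasZeroMorphisms C] (N X M : C) :
    ses (Opposite.op M) (Opposite.op X) (Opposite.op N) = ses N X M := by
  unfold ses
  congr 1
  exact Nat.card_congr
    { toFun := fun s => ⟨(s.1.2.unop, s.1.1.unop), s.2.unop⟩
      invFun := fun s => ⟨(s.1.2.op, s.1.1.op), s.2.op⟩
      left_inv := fun s => rfl
      right_inv := fun s => rfl }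

lemma exists_isSES_of_ses_ne_zero [HasZeroMorphisms C] {N X M : C} (h : ses N X M ≠ 0) :
    ∃ (i : N ⟶ X) (p : X ⟶ M), IsSES i p := by
  unfold ses at h
  by_contra hcon
  push Not at hcon
  have : IsEmpty {s : (N ⟶ X) × (X ⟶ M) // IsSES s.1 s.2} := ⟨fun s => hcon _ _ s.2⟩
  simp at h

lemma ses_ne_zero_of_isSES [HasZeroMorphisms C] [FiniteHom C] {N X M : C} {i : N ⟶ X} {p : X ⟶ M}
    (h : IsSES i p) : ses N X M ≠ 0 := by
  have : Nonempty {s : (N ⟶ X) × (X ⟶ M) // IsSES s.1 s.2} := ⟨⟨(i, p), h⟩⟩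
  unfold ses
  exact_mod_cast Nat.card_pos.ne'

/-- The kernels `K ⟶ X` of a morphism form a torsor under `Aut K`. -/
lemma card_isKer [HasZeroMorphisms C] {K K' X B : C} {k : K ⟶ X} {g : X ⟶ B} (h : IsKer k g)
    (e : K' ≅ K) : (Nat.card {k' : K' ⟶ X // IsKer k' g} : ℝ) = aut K' := by
  rw [← card_iso_of_iso e]
  congr 1
  have := h.mono
  exact (Nat.card_eq_of_bijective
    (fun a : K' ≅ K => (⟨a.hom ≫ k, h.iso_comp a⟩ : {k' : K' ⟶ X // IsKer k' g}))
    ⟨fun a b hab => Iso.ext ((cancel_mono k).1 (congrArg Subtype.val hab)),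
      fun k' => by
        obtain ⟨a, ha⟩ := k'.2.exists_iso h
        exact ⟨a, Subtype.ext ha⟩⟩).symm

end Counting

/-! ### Finite sums -/

section Finsum

/-- A `finsum` with infinite support is 0 by convention, so joint finiteness of the support is what
permits the interchange. -/
lemma finsum_finsum_comm {α β : Type*} (f : α → β → ℝ)
    (h : {p : α × β | f p.1 p.2 ≠ 0}.Finite) :
    ∑ᶠ a, ∑ᶠ b, f a b = ∑ᶠ b, ∑ᶠ a, f a b := by
  rw [← finsum_curry (fun p : α × β => f p.1 p.2) h,
    ← finsum_comp_equiv (Equiv.prodComm β α) (f := fun p : α × β => f p.1 p.2)]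
  refine finsum_curry (fun p : β × α => f p.2 p.1) ?_
  exact (h.preimage (Equiv.prodComm β α).injective.injOn)

lemma finsum_finsum_comm_left {α β : Type*} [Finite α] (f : α → β → ℝ)
    (h : ∀ a, {b | f a b ≠ 0}.Finite) :
    ∑ᶠ a, ∑ᶠ b, f a b = ∑ᶠ b, ∑ᶠ a, f a b := by
  refine finsum_finsum_comm f (((Set.toFinite (Set.univ : Set α)).prod
    (Set.finite_iUnion h)).subset fun p hp => ⟨trivial, ?_⟩)
  exact Set.mem_iUnion.2 ⟨p.1, hp⟩

lemma finsum_div_const {α : Type*} (f : α → ℝ) (c : ℝ) :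
    (∑ᶠ a, f a) / c = ∑ᶠ a, f a / c := by
  simp only [div_eq_mul_inv, finsum_mul]

lemma card_sigma_real {α : Type*} {β : α → Type*} [Finite α] [∀ a, Finite (β a)] :
    (Nat.card (Σ a, β a) : ℝ) = ∑ᶠ a, (Nat.card (β a) : ℝ) := by
  have := Fintype.ofFinite α
  rw [Nat.card_sigma, finsum_eq_sum_of_fintype]
  push_cast
  rfl

lemma finsum_const_card {α : Type*} [Finite α] (c : ℝ) :
    ∑ᶠ _ : α, c = Nat.card α * c := by
  have := Fintype.ofFinite α
  rw [finsum_eq_sum_of_fintype]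
  simp

lemma finsum_sigma_real {α : Type*} {β : α → Type*} [Finite α] [∀ a, Finite (β a)]
    (f : (Σ a, β a) → ℝ) : ∑ᶠ p, f p = ∑ᶠ a, ∑ᶠ b, f ⟨a, b⟩ := by
  have := Fintype.ofFinite α
  have := fun a => Fintype.ofFinite (β a)
  simp only [finsum_eq_sum_of_fintype]
  exact Fintype.sum_sigma f

/-- Summation over the fibres of a map. -/
lemma finsum_fiberwise {α β : Type*} [Finite α] (g : α → β) (f : α → ℝ) :
    ∑ᶠ b, ∑ᶠ a : {a // g a = b}, f a = ∑ᶠ a, f a := by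
  classical
  have := Fintype.ofFinite α
  have h1 : ∀ b, ∑ᶠ a : {a // g a = b}, f a = ∑ᶠ a, if g a = b then f a else 0 := by
    intro b
    rw [finsum_subtype_eq_finsum_cond (f := f) (p := fun a => g a = b)]
    refine finsum_congr fun a => ?_
    rw [finsum_eq_if]
  simp only [h1]
  rw [← finsum_finsum_comm_left]
  · refine finsum_congr fun a => ?_
    rw [finsum_eq_single _ (g a)]
    · simp
    · intro b hb
      simp [hb.symm]
  · intro a
    refine (Set.finite_singleton (g a)).subset fun b hb => ?_
    by_contra hne
    exact hb (if_neg fun h => hne h.symm)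

end Finsum

/-! ### The counting hypothesis on extensions -/

section Green

variable {C : Type u} [Category.{v} C] [Abelian C]

/-- The number of factorizations of `θ : D ⟶ F` with cokernel `q : F ⟶ I` through `X`, such that
`0 ⟶ D ⟶ X ⟶ I ⟶ 0` is short exact. -/
def fill {D F I : C} (θ : D ⟶ F) (q : F ⟶ I) (X : C) : ℝ :=
  Nat.card {s : (D ⟶ X) × (X ⟶ F) // s.1 ≫ s.2 = θ ∧ IsSES s.1 (s.2 ≫ q)}

/-- Dualizing a filling exchanges the conditions on `D → X → coker θ` and on `ker θ → X → F`, which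
are equivalent by `isSES_factorization_iff`. -/
lemma fill_op {H D F I : C} {k : H ⟶ D} {θ : D ⟶ F} {q : F ⟶ I} (hk : IsKer k θ)
    (hq : IsCoker θ q) (X : C) : fill θ.op k.op (Opposite.op X) = fill θ q X := by
  unfold fill
  congr 1
  refine Nat.card_congr
    { toFun := fun s => ⟨(s.1.2.unop, s.1.1.unop), ?_, ?_⟩
      invFun := fun s => ⟨(s.1.2.op, s.1.1.op), ?_, ?_⟩
      left_inv := fun s => rfl
      right_inv := fun s => rfl }
  · exact Quiver.Hom.op_inj s.2.1
  · have h : s.1.2.unop ≫ s.1.1.unop = θ := Quiver.Hom.op_inj s.2.1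
    exact (isSES_factorization_iff hk hq h).2 s.2.2.unop
  · exact Quiver.Hom.unop_inj s.2.1
  · exact ((isSES_factorization_iff hk hq s.2.1).1 s.2.2).op

lemma ses_ne_zero_of_fill_ne_zero [FiniteHom C] {D F I : C} {θ : D ⟶ F} {q : F ⟶ I} {X : C}
    (h : fill θ q X ≠ 0) : ses D X I ≠ 0 := by
  unfold fill at h
  have h' : Nat.card {s : (D ⟶ X) × (X ⟶ F) // s.1 ≫ s.2 = θ ∧ IsSES s.1 (s.2 ≫ q)} ≠ 0 :=
    fun h0 => h (by rw [h0, Nat.cast_zero])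
  obtain ⟨⟨s, hs⟩⟩ := (Nat.card_ne_zero.1 h').1
  exact ses_ne_zero_of_isSES hs.2

/-- A system of representatives `r` of the isomorphism classes, such that the middle terms of
extensions are finite in number up to isomorphism and the fillings of a morphism `θ` are counted
by a function `ε` of the cokernel and the kernel of `θ`. -/
structure GreenData (C : Type u) [Category.{v} C] [Abelian C] {J : Type*} (r : J → C)
    (ε : C → C → ℝ) : Prop where
  exists_iso (X : C) : ∃ j, Nonempty (X ≅ r j)
  eq_of_iso {i j : J} : Nonempty (r i ≅ r j) → i = j
  finite_ext (N M : C) : {j | ses N (r j) M ≠ 0}.Finite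
  green {H D F I : C} {k : H ⟶ D} {θ : D ⟶ F} {q : F ⟶ I} : IsKer k θ → IsCoker θ q →
    ∑ᶠ j, fill θ q (r j) / aut (r j) = ε I H

variable {J : Type*} {r : J → C} {ε : C → C → ℝ}

/-- The axioms are self-dual once the arguments of `ε` are swapped, since kernel and cokernel of `θ`
change roles. Every consequence can therefore be used in the opposite category. -/
lemma GreenData.op (G : GreenData C r ε) :
    GreenData Cᵒᵖ (fun j => Opposite.op (r j)) (fun X Y => ε Y.unop X.unop) where
  exists_iso X := by
    obtain ⟨j, ⟨e⟩⟩ := G.exists_iso X.unop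
    exact ⟨j, ⟨e.symm.op⟩⟩
  eq_of_iso := by
    rintro i j ⟨e⟩
    exact G.eq_of_iso ⟨e.symm.unop⟩
  finite_ext N M := by
    refine (G.finite_ext M.unop N.unop).subset fun j hj => ?_
    have hj' : ses N (Opposite.op (r j)) M ≠ 0 := hj
    change ses M.unop (r j) N.unop ≠ 0
    rwa [← ses_op]
  green {H D F I k θ q} hk hq := by
    rw [← G.green hq.unop hk.unop]
    refine finsum_congr fun j => ?_
    rw [aut_op, ← fill_op hq.unop hk.unop]
    rfl

/-- Only the representative of `kernel g` contributes, and its embeddings as a kernel form a torsor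
under its automorphism group. -/
lemma GreenData.sum_isKer [FiniteHom C] (G : GreenData C r ε) {X B : C} (g : X ⟶ B) :
    ∑ᶠ j, (Nat.card {k : r j ⟶ X // IsKer k g} : ℝ) / aut (r j) = 1 := by
  obtain ⟨j, ⟨e⟩⟩ := G.exists_iso (kernel g)
  rw [finsum_eq_single _ j]
  · rw [card_isKer (isKer_kernel g) e.symm, div_self (aut_ne_zero _)]
  · intro i hi
    have : IsEmpty {k : r i ⟶ X // IsKer k g} := ⟨fun k => hi (by
      obtain ⟨e', -⟩ := k.2.exists_iso (isKer_kernel g)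
      exact G.eq_of_iso ⟨e' ≪≫ e⟩)⟩
    simp

/-! ### Associativity of the Hall numbers -/

/-- Filtrations of `Y` with subquotients `P`, `Q`, `R`, together with identifications of the
kernel of `Y ⟶ R` with `K'` and of the cokernel of `P ⟶ Y` with `K`. -/
structure Tower (P Q R Y K K' : C) where
  q : Q ⟶ K
  ρ : K ⟶ R
  m : P ⟶ Y
  e : Y ⟶ K
  m' : P ⟶ K'
  q' : K' ⟶ Q
  k' : K' ⟶ Y
  ρ' : Y ⟶ R
  isSES_q : IsSES q ρ
  isSES_m : IsSES m e
  isSES_m' : IsSES m' q'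
  isSES_k' : IsSES k' ρ'
  m_eq : m' ≫ k' = m
  ρ_eq : e ≫ ρ = ρ'
  comm : k' ≫ e = q' ≫ q

namespace Tower

variable {P Q R Y K K' : C}

/-- Towers in the opposite category. -/
def opEquiv : Tower P Q R Y K K' ≃ Tower (Opposite.op R) (Opposite.op Q) (Opposite.op P)
    (Opposite.op Y) (Opposite.op K') (Opposite.op K) where
  toFun t := ⟨t.q'.op, t.m'.op, t.ρ'.op, t.k'.op, t.ρ.op, t.q.op, t.e.op, t.m.op, t.isSES_m'.op,
    t.isSES_k'.op, t.isSES_q.op, t.isSES_m.op, by rw [← op_comp, t.ρ_eq],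
    by rw [← op_comp, t.m_eq], by rw [← op_comp, t.comm, op_comp]⟩
  invFun t := ⟨t.q'.unop, t.m'.unop, t.ρ'.unop, t.k'.unop, t.ρ.unop, t.q.unop, t.e.unop, t.m.unop,
    t.isSES_m'.unop, t.isSES_k'.unop, t.isSES_q.unop, t.isSES_m.unop, by
      rw [← unop_comp, t.ρ_eq], by rw [← unop_comp, t.m_eq], by
      rw [← unop_comp, t.comm, unop_comp]⟩
  left_inv _ := rfl
  right_inv _ := rfl

/-- A tower is determined by the two lower exact sequences and the kernel `K' ⟶ Y`. -/
def toSigma (t : Tower P Q R Y K K') :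
    Σ s : {s : (Q ⟶ K) × (K ⟶ R) // IsSES s.1 s.2} × {s : (P ⟶ Y) × (Y ⟶ K) // IsSES s.1 s.2},
      {k : K' ⟶ Y // IsKer k (s.2.1.2 ≫ s.1.1.2)} :=
  ⟨⟨⟨(t.q, t.ρ), t.isSES_q⟩, ⟨(t.m, t.e), t.isSES_m⟩⟩, ⟨t.k', by
    dsimp only
    rw [t.ρ_eq]
    exact t.isSES_k'.isKer⟩⟩

/-- With `K'` embedded as the kernel of `Y → K → R`, the maps `P → K'` and `K' → Q` are forced by
the universal properties of kernels; their exactness is the third isomorphism theorem. -/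
lemma toSigma_bijective : Function.Bijective (toSigma : Tower P Q R Y K K' → _) := by
  constructor
  · intro s t h
    have hq : s.q = t.q := congrArg (fun x => x.1.1.1.1) h
    have hρ : s.ρ = t.ρ := congrArg (fun x => x.1.1.1.2) h
    have hm : s.m = t.m := congrArg (fun x => x.1.2.1.1) h
    have he : s.e = t.e := congrArg (fun x => x.1.2.1.2) h
    have hk : s.k' = t.k' := congrArg (fun x => x.2.1) h
    have hm' : s.m' = t.m' := by
      have := t.isSES_k'.isKer.mono
      rw [← cancel_mono t.k', t.m_eq, ← hk, s.m_eq, hm]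
    have hρ' : s.ρ' = t.ρ' := by rw [← s.ρ_eq, ← t.ρ_eq, he, hρ]
    have hq' : s.q' = t.q' := by
      have := t.isSES_q.isKer.mono
      rw [← cancel_mono t.q, ← t.comm, ← hk, ← he, s.comm, hq]
    cases s
    cases t
    simp only at hq hρ hm he hk hm' hρ' hq'
    subst hq hρ hm he hk hm' hρ' hq'
    rfl
  · rintro ⟨⟨⟨⟨q, ρ⟩, h₁⟩, ⟨⟨m, e⟩, h₂⟩⟩, ⟨k', hk⟩⟩
    dsimp only at h₁ h₂ hk
    obtain ⟨m', hm'⟩ := hk.lift m (by rw [← Category.assoc, h₂.isKer.zero, zero_comp])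
    obtain ⟨q', hq'⟩ := h₁.isKer.lift (k' ≫ e) (by rw [Category.assoc, hk.zero])
    have := hk.mono
    have := h₁.isCoker.epi
    have := h₁.isKer.mono
    have := h₂.isCoker.epi
    have := h₂.isKer.mono
    -- A preimage in `Y` of an element of `Q` is killed by `Y → R`, so it already lies in `K'`.
    have hepi : Epi q' := by
      rw [epi_iff_surjective_up_to_refinements]
      intro Z y
      obtain ⟨Z₁, π₁, _, x, hx⟩ := surjective_up_to_refinements_of_epi e (y ≫ q)
      obtain ⟨z, hz⟩ := hk.lift x (by
        rw [← Category.assoc, ← hx]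
        simp [h₁.isKer.zero])
      refine ⟨Z₁, π₁, inferInstance, z, ?_⟩
      rw [← cancel_mono q, Category.assoc, hx, Category.assoc, hq', ← hz, Category.assoc]
    have hmono : Mono m' := by
      have : Mono (m' ≫ k') := by rw [hm']; infer_instance
      exact mono_of_mono m' k'
    have hker : IsKer m' q' := by
      refine ⟨hmono, ?_, fun x hx => ?_⟩
      · rw [← cancel_mono q, Category.assoc, hq', ← Category.assoc, hm', h₂.isKer.zero, zero_comp]
      · obtain ⟨y, hy⟩ := h₂.isKer.lift (x ≫ k') (by
          rw [Category.assoc, ← hq', ← Category.assoc, hx, zero_comp])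
        exact ⟨y, by rw [← cancel_mono k', Category.assoc, hm', hy]⟩
    exact ⟨⟨q, ρ, m, e, m', q', k', e ≫ ρ, h₁, h₂, hker.isSES hepi, hk.isSES inferInstance, hm',
      rfl, hq'.symm⟩, rfl⟩

variable [FiniteHom C]

/-- For fixed sequences through `K`, the weighted choice of a kernel `K'` of `Y → K → R` contributes
exactly 1, by `GreenData.sum_isKer`. -/
lemma sum_card (G : GreenData C r ε) (P Q R Y K : C) :
    ∑ᶠ j, (Nat.card (Tower P Q R Y K (r j)) : ℝ) / aut (r j) = ses Q K R * ses P Y K := by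
  simp only [Nat.card_eq_of_bijective _ toSigma_bijective, card_sigma_real, finsum_div_const]
  rw [← finsum_finsum_comm_left]
  · simp only [G.sum_isKer, finsum_const_card, Nat.card_prod, ses]
    push_cast
    ring
  · intro s
    refine (Set.finite_of_encard_le_coe (k := 1) ?_)
    rw [Nat.cast_one, Set.encard_le_one_iff]
    intro i j hi hj
    have key : ∀ i, (Nat.card {k : r i ⟶ Y // IsKer k (s.2.1.2 ≫ s.1.1.2)} : ℝ) / aut (r i) ≠ 0 →
        Nonempty {k : r i ⟶ Y // IsKer k (s.2.1.2 ≫ s.1.1.2)} := by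
      intro i hi
      by_contra hcon
      rw [not_nonempty_iff] at hcon
      simp at hi
    obtain ⟨k⟩ := key i hi
    obtain ⟨k'⟩ := key j hj
    obtain ⟨e, -⟩ := k.2.exists_iso k'.2
    exact G.eq_of_iso ⟨e⟩

end Tower

variable [FiniteHom C]

/-- Associativity of the Hall numbers: both sides count filtrations with subquotients `P`, `Q`
and `R`. -/
theorem GreenData.ses_assoc (G : GreenData C r ε) (P Q R Y : C) :
    ∑ᶠ j, ses Q (r j) R * ses P Y (r j) / aut (r j) =
      ∑ᶠ j, ses P (r j) Q * ses (r j) Y R / aut (r j) := by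
  have h₁ : ∀ j, ses Q (r j) R * ses P Y (r j) / aut (r j) =
      ∑ᶠ j', (Nat.card (Tower P Q R Y (r j) (r j')) : ℝ) / aut (r j') / aut (r j) := by
    intro j
    rw [← finsum_div_const, Tower.sum_card G]
  -- The opposite category exchanges `K` and `K'`, so the same towers summed in the other order give
  -- this side.
  have h₂ : ∀ j, ses P (r j) Q * ses (r j) Y R / aut (r j) =
      ∑ᶠ j', (Nat.card (Tower P Q R Y (r j') (r j)) : ℝ) / aut (r j) / aut (r j') := by
    intro j
    rw [← ses_op P, ← ses_op (r j), ← Tower.sum_card G.op, finsum_div_const]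
    refine finsum_congr fun j' => ?_
    rw [aut_op, div_right_comm, Nat.card_congr (Tower.opEquiv (P := P) (Q := Q) (R := R) (Y := Y)
      (K := r j') (K' := r j))]
  simp only [h₁, h₂]
  refine finsum_finsum_comm _ (((G.finite_ext Q R).prod (G.finite_ext P Q)).subset ?_)
  rintro ⟨j, j'⟩ hj
  have : Nat.card (Tower P Q R Y (r j) (r j')) ≠ 0 := by
    intro h0
    simp [h0] at hj
  obtain ⟨t⟩ := (Nat.card_ne_zero.1 this).1
  exact ⟨ses_ne_zero_of_isSES t.isSES_q, ses_ne_zero_of_isSES t.isSES_m'⟩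

end Green

/-! ### Extensions with a morphism on the middle term -/

section Corner

attribute [local simp] pullback.lift_fst pullback.lift_snd pushout.inl_desc pushout.inr_desc
  pullback.lift_fst_assoc pullback.lift_snd_assoc pushout.inl_desc_assoc pushout.inr_desc_assoc

variable {C : Type u} [Category.{v} C] [Abelian C]

/-- Extensions `X` of `M` by `N` together with a morphism `G : X ⟶ B` which extends a given
`g : N ⟶ B` and induces a given `γ : M ⟶ Q` on the cokernel `π : B ⟶ Q` of `g`. -/
structure Corner {N M B Q : C} (g : N ⟶ B) (π : B ⟶ Q) (γ : M ⟶ Q) (X : C) where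
  i : N ⟶ X
  p : X ⟶ M
  G : X ⟶ B
  isSES : IsSES i p
  i_comp : i ≫ G = g
  comm : p ≫ γ = G ≫ π

/-- A `Corner` together with a kernel `κ : K ⟶ X` of the morphism `G : X ⟶ B`. -/
structure CornerKer {N M B Q : C} (g : N ⟶ B) (π : B ⟶ Q) (γ : M ⟶ Q) (X K : C)
    extends Corner g π γ X where
  κ : K ⟶ X
  isKer : IsKer κ G

section

variable {N M B Q : C} {g : N ⟶ B} {π : B ⟶ Q} {γ : M ⟶ Q} {X K : C}

lemma Corner.ext' {s t : Corner g π γ X} (hi : s.i = t.i) (hp : s.p = t.p) (hG : s.G = t.G) :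
    s = t := by
  cases s
  cases t
  simp only at hi hp hG
  subst hi hp hG
  rfl

lemma CornerKer.ext' {s t : CornerKer g π γ X K} (hi : s.i = t.i) (hp : s.p = t.p)
    (hG : s.G = t.G) (hκ : s.κ = t.κ) : s = t := by
  rcases s with ⟨s, κ, h⟩
  rcases t with ⟨t, κ', h'⟩
  obtain rfl : s = t := Corner.ext' hi hp hG
  simp only at hκ
  subst hκ
  rfl

instance [FiniteHom C] : Finite (Corner g π γ X) :=
  Finite.of_injective (fun s => (s.i, s.p, s.G)) fun _ _ h =>
    Corner.ext' (congrArg (fun x => x.1) h) (congrArg (fun x => x.2.1) h)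
      (congrArg (fun x => x.2.2) h)

/-- A `CornerKer` is a `Corner` with a choice of kernel. -/
def CornerKer.equivSigma : CornerKer g π γ X K ≃
    Σ s : {s : Corner g π γ X // ∃ κ : K ⟶ X, IsKer κ s.G}, {κ : K ⟶ X // IsKer κ s.1.G} where
  toFun s := ⟨⟨s.toCorner, s.κ, s.isKer⟩, ⟨s.κ, s.isKer⟩⟩
  invFun s := ⟨s.1.1, s.2.1, s.2.2⟩
  left_inv _ := rfl
  right_inv _ := rfl

lemma card_cornerKer [FiniteHom C] : (Nat.card (CornerKer g π γ X K) : ℝ) =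
    Nat.card {s : Corner g π γ X // ∃ κ : K ⟶ X, IsKer κ s.G} * aut K := by
  rw [Nat.card_congr CornerKer.equivSigma, card_sigma_real, ← finsum_const_card]
  refine finsum_congr fun s => ?_
  obtain ⟨κ, hκ⟩ := s.2
  exact card_isKer hκ (Iso.refl K)

end

variable {H N B Q M M' I : C} {ι : H ⟶ N} {g : N ⟶ B} {π : B ⟶ Q} {γ : M ⟶ Q}
  {ι' : M' ⟶ M} {ρ : M ⟶ I}

section Fill

variable {K : C} {h : H ⟶ K} {k : K ⟶ M'}

/-- The morphism whose fillings are the corners with kernel `H ⟶ K ⟶ M'`. -/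
def cornerHom (hι : IsKer ι g) (hπ : IsCoker g π) (hι' : IsKer ι' γ) (hhk : IsSES h k) :
    pushout ι h ⟶ pullback γ π :=
  pushout.desc (pullback.lift 0 g (by rw [zero_comp, hπ.zero]))
    (pullback.lift (k ≫ ι') 0 (by rw [Category.assoc, hι'.zero, comp_zero, zero_comp])) (by
      apply pullback.hom_ext
      · simp [reassoc_of% hhk.isKer.zero]
      · simp [hι.zero])

variable (hι : IsKer ι g) (hπ : IsCoker g π) (hι' : IsKer ι' γ) (hhk : IsSES h k)

@[simp]
lemma inl_cornerHom_fst : pushout.inl ι h ≫ cornerHom hι hπ hι' hhk ≫ pullback.fst γ π = 0 := by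
  simp [cornerHom]

@[simp]
lemma inl_cornerHom_snd : pushout.inl ι h ≫ cornerHom hι hπ hι' hhk ≫ pullback.snd γ π = g := by
  simp [cornerHom]

@[simp]
lemma inr_cornerHom_fst :
    pushout.inr ι h ≫ cornerHom hι hπ hι' hhk ≫ pullback.fst γ π = k ≫ ι' := by
  simp [cornerHom]

@[simp]
lemma inr_cornerHom_snd : pushout.inr ι h ≫ cornerHom hι hπ hι' hhk ≫ pullback.snd γ π = 0 := by
  simp [cornerHom]

lemma exists_pushout_refinement {Z : C} (x : Z ⟶ pushout ι h) :
    ∃ (Z' : C) (σ : Z' ⟶ Z) (_ : Epi σ) (n : Z' ⟶ N) (z : Z' ⟶ K),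
      σ ≫ x = n ≫ pushout.inl ι h + z ≫ pushout.inr ι h :=
  (IsPushout.of_hasPushout ι h).hom_eq_add_up_to_refinements x

-- Up to refinement an element of the pushout is a sum of `n` from `N` and `z` from `K`. If both
-- components in the pullback vanish, `z` and `n` come from `H`, and the two copies of `H` are
-- identified in the pushout.
include hι hπ hι' hhk in
lemma isKer_cornerHom : IsKer (ι ≫ pushout.inl ι h) (cornerHom hι hπ hι' hhk) := by
  have := hι.mono
  have := hhk.isKer.mono
  have := hι'.mono
  refine IsKer.of_refinement inferInstance ?_ fun x hx => ?_
  · apply pullback.hom_ext <;> simp [hι.zero]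
  · obtain ⟨Z', σ, _, n, z, hnz⟩ := exists_pushout_refinement x
    have h0 : (n ≫ pushout.inl ι h + z ≫ pushout.inr ι h) ≫ cornerHom hι hπ hι' hhk = 0 := by
      rw [← hnz, Category.assoc, hx, comp_zero]
    have h1 : z ≫ k = 0 := by
      have := congrArg (· ≫ pullback.fst γ π) h0
      rw [← cancel_mono ι']
      simpa using this
    have h2 : n ≫ g = 0 := by
      have := congrArg (· ≫ pullback.snd γ π) h0
      simpa using this
    obtain ⟨h₀, rfl⟩ := hhk.isKer.lift z h1
    obtain ⟨h₁, rfl⟩ := hι.lift n h2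
    refine ⟨Z', σ, inferInstance, h₁ + h₀, ?_⟩
    rw [hnz]
    simp [pushout.condition]

-- An element of the pullback with first component in `M'` has that component hit from `K`; its
-- second component dies in `Q` and hence comes from `N`. So only `I = M / M'` survives. Kernel and
-- cokernel thus do not depend on the chosen extension `K`, which is why the fillings can be counted
-- uniformly.
include hι hπ hι' hhk in
lemma isCoker_cornerHom (hρ : IsCoker ι' ρ) :
    IsCoker (cornerHom hι hπ hι' hhk) (pullback.fst γ π ≫ ρ) := by
  have := hρ.epi
  have := hπ.epi
  have := hhk.isCoker.epi
  have := hι'.mono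
  refine IsCoker.of_refinement (epi_comp _ _) ?_ fun x hx => ?_
  · apply pushout.hom_ext
    · simp [reassoc_of% inl_cornerHom_fst hι hπ hι' hhk]
    · simp [reassoc_of% inr_cornerHom_fst hι hπ hι' hhk, hρ.zero]
  · obtain ⟨m, hm⟩ := (hρ.isSES hι'.mono).isKer.lift (x ≫ pullback.fst γ π) (by simpa using hx)
    obtain ⟨Z₁, σ₁, _, z, hz⟩ := surjective_up_to_refinements_of_epi k m
    obtain ⟨Z₂, σ₂, _, n, hn⟩ := hπ.exists_refinement (σ₁ ≫ x ≫ pullback.snd γ π) (by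
      rw [Category.assoc, Category.assoc, ← pullback.condition, ← Category.assoc x, ← hm,
        Category.assoc, hι'.zero, comp_zero, comp_zero])
    refine ⟨Z₂, σ₂ ≫ σ₁, inferInstance, n ≫ pushout.inl ι h + (σ₂ ≫ z) ≫ pushout.inr ι h, ?_⟩
    apply pullback.hom_ext
    · simp only [Category.assoc, Preadditive.add_comp, inl_cornerHom_fst, comp_zero, zero_add,
        inr_cornerHom_fst, ← hm]
      rw [reassoc_of% hz]
    · simpa using hn

end Fill

/-- The fillings attached to all choices of the kernel `H ⟶ K ⟶ M'`. -/
abbrev CornerFill (hι : IsKer ι g) (hπ : IsCoker g π) (hι' : IsKer ι' γ) (ρ : M ⟶ I)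
    (X K : C) : Type v :=
  Σ s : {s : (H ⟶ K) × (K ⟶ M') // IsSES s.1 s.2},
    {t : (pushout ι s.1.1 ⟶ X) × (X ⟶ pullback γ π) //
      t.1 ≫ t.2 = cornerHom hι hπ hι' s.2 ∧ IsSES t.1 (t.2 ≫ pullback.fst γ π ≫ ρ)}

variable (hι : IsKer ι g) (hπ : IsCoker g π) (hι' : IsKer ι' γ) (hρ : IsCoker ι' ρ) {X K : C}

-- For exactness, an element of the pushout dying in `M` has its `K`-part in `H`, so it comes from
-- `N`. For surjectivity, lift the class in `I` and correct the error, which lies in `M'`, by an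
-- element of `K`.
include hρ in
lemma cornerFill_isSES {h : H ⟶ K} {k : K ⟶ M'} (hhk : IsSES h k) {u : pushout ι h ⟶ X}
    {v : X ⟶ pullback γ π} (huv : u ≫ v = cornerHom hι hπ hι' hhk)
    (huvp : IsSES u (v ≫ pullback.fst γ π ≫ ρ)) :
    IsSES (pushout.inl ι h ≫ u) (v ≫ pullback.fst γ π) := by
  have := hι.mono
  have := hhk.isKer.mono
  have := hι'.mono
  have := hhk.isCoker.epi
  have := huvp.isKer.mono
  have := huvp.isCoker.epi
  have hρ' := (hρ.isSES hι'.mono).isKer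
  refine (IsKer.of_refinement inferInstance ?_ fun x hx => ?_).isSES ?_
  · rw [Category.assoc, reassoc_of% huv, inl_cornerHom_fst]
  · obtain ⟨d, rfl⟩ := huvp.isKer.lift x (by
      rw [← Category.assoc v, ← Category.assoc, hx, zero_comp])
    obtain ⟨Z', σ, _, n, z, hnz⟩ := exists_pushout_refinement d
    have h1 : z ≫ k = 0 := by
      have h0 : (σ ≫ d) ≫ u ≫ v ≫ pullback.fst γ π = 0 := by
        rw [Category.assoc, ← Category.assoc d, hx, comp_zero]
      rw [hnz, reassoc_of% huv] at h0
      rw [← cancel_mono ι']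
      simpa using h0
    obtain ⟨h₀, rfl⟩ := hhk.isKer.lift z h1
    refine ⟨Z', σ, inferInstance, n + h₀ ≫ ι, ?_⟩
    rw [← Category.assoc σ, hnz]
    simp [pushout.condition_assoc]
  · rw [epi_iff_surjective_up_to_refinements]
    intro Z y
    obtain ⟨Z₁, σ₁, _, x, hx⟩ :=
      surjective_up_to_refinements_of_epi (v ≫ pullback.fst γ π ≫ ρ) (y ≫ ρ)
    obtain ⟨m, hm⟩ := hρ'.lift (σ₁ ≫ y - x ≫ v ≫ pullback.fst γ π) (by
      rw [Preadditive.sub_comp, sub_eq_zero]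
      simpa using hx)
    obtain ⟨Z₂, σ₂, _, z, hz⟩ := surjective_up_to_refinements_of_epi k m
    refine ⟨Z₂, σ₂ ≫ σ₁, inferInstance, σ₂ ≫ x + z ≫ pushout.inr ι h ≫ u, ?_⟩
    rw [eq_sub_iff_add_eq] at hm
    have h1 : z ≫ pushout.inr ι h ≫ u ≫ v ≫ pullback.fst γ π = σ₂ ≫ m ≫ ι' := by
      rw [reassoc_of% huv, inr_cornerHom_fst, ← reassoc_of% hz]
    rw [Category.assoc, ← hm]
    simp only [Preadditive.comp_add, Preadditive.add_comp, Category.assoc, h1]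
    abel

-- An element of `X` killed by the map to `B` has image in `M'`, so it lies in the pushout; its
-- `N`-part is killed by `g` and is absorbed into `K` through `H`.
include hρ in
lemma cornerFill_isKer {h : H ⟶ K} {k : K ⟶ M'} (hhk : IsSES h k) {u : pushout ι h ⟶ X}
    {v : X ⟶ pullback γ π} (huv : u ≫ v = cornerHom hι hπ hι' hhk)
    (huvp : IsSES u (v ≫ pullback.fst γ π ≫ ρ)) :
    IsKer (pushout.inr ι h ≫ u) (v ≫ pullback.snd γ π) := by
  have := hι.mono
  have := hhk.isKer.mono
  have := hι'.mono
  have := huvp.isKer.mono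
  refine IsKer.of_refinement inferInstance ?_ fun x hx => ?_
  · rw [Category.assoc, reassoc_of% huv, inr_cornerHom_snd]
  · obtain ⟨m, hm⟩ := hι'.lift (x ≫ v ≫ pullback.fst γ π) (by
      rw [Category.assoc, Category.assoc, pullback.condition, ← Category.assoc v,
        ← Category.assoc, hx, zero_comp])
    obtain ⟨d, rfl⟩ := huvp.isKer.lift x (by
      rw [← Category.assoc v, ← Category.assoc x, ← hm, Category.assoc, hρ.zero, comp_zero])
    obtain ⟨Z', σ, _, n, z, hnz⟩ := exists_pushout_refinement d
    have h1 : n ≫ g = 0 := by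
      have h0 : (σ ≫ d) ≫ u ≫ v ≫ pullback.snd γ π = 0 := by
        rw [Category.assoc, ← Category.assoc d, hx, comp_zero]
      rw [hnz, reassoc_of% huv] at h0
      simpa using h0
    obtain ⟨h₀, rfl⟩ := hι.lift n h1
    refine ⟨Z', σ, inferInstance, z + h₀ ≫ h, ?_⟩
    rw [← Category.assoc σ, hnz]
    simp [pushout.condition_assoc]
    abel

/-- A filling determines a corner. -/
def cornerOfFill (s : CornerFill hι hπ hι' ρ X K) : CornerKer g π γ X K where
  i := pushout.inl ι s.1.1.1 ≫ s.2.1.1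
  p := s.2.1.2 ≫ pullback.fst γ π
  G := s.2.1.2 ≫ pullback.snd γ π
  isSES := cornerFill_isSES hι hπ hι' hρ s.1.2 s.2.2.1 s.2.2.2
  i_comp := by rw [Category.assoc, reassoc_of% s.2.2.1, inl_cornerHom_snd]
  comm := by rw [Category.assoc, Category.assoc, pullback.condition]
  κ := pushout.inr ι s.1.1.1 ≫ s.2.1.1
  isKer := cornerFill_isKer hι hπ hι' hρ s.1.2 s.2.2.1 s.2.2.2

include hι hπ hι' in
/-- The kernel of the morphism on the middle term is an extension of the kernels. -/
lemma CornerKer.exists_isSES (s : CornerKer g π γ X K) :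
    ∃ (h : H ⟶ K) (k : K ⟶ M'), IsSES h k ∧ ι ≫ s.i = h ≫ s.κ ∧ s.κ ≫ s.p = k ≫ ι' := by
  obtain ⟨⟨i, p, G, hip, hiG, hpG⟩, κ, hκ⟩ := s
  dsimp only at hκ ⊢
  obtain ⟨h, hh⟩ := hκ.lift (ι ≫ i) (by rw [Category.assoc, hiG, hι.zero])
  obtain ⟨k, hk⟩ := hι'.lift (κ ≫ p) (by
    rw [Category.assoc, hpG, ← Category.assoc, hκ.zero, zero_comp])
  have := hι.mono
  have := hι'.mono
  have := hip.isKer.mono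
  have := hip.isCoker.epi
  have := hκ.mono
  refine ⟨h, k, IsKer.isSES ⟨?_, ?_, fun y hy => ?_⟩ ?_, hh.symm, hk.symm⟩
  · have : Mono (h ≫ κ) := by rw [hh]; infer_instance
    exact mono_of_mono h κ
  · rw [← cancel_mono ι', Category.assoc, hk, ← Category.assoc, hh, Category.assoc,
      hip.isKer.zero, comp_zero, zero_comp]
  · obtain ⟨n, hn⟩ := hip.isKer.lift (y ≫ κ) (by
      rw [Category.assoc, ← hk, ← Category.assoc, hy, zero_comp])
    obtain ⟨h₀, rfl⟩ := hι.lift n (by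
      rw [← hiG, ← Category.assoc, hn, Category.assoc, hκ.zero, comp_zero])
    exact ⟨h₀, by rw [← cancel_mono κ, Category.assoc, hh, ← hn, Category.assoc]⟩
  · rw [epi_iff_surjective_up_to_refinements]
    intro Z y
    -- A lift `x` of an element of `M'` has `G x` in the image of `g`; subtracting the corresponding
    -- element of `N` gives a lift in the kernel of `G`. Here the vanishing of `M' → Q` is
    -- essential.
    obtain ⟨Z₁, σ₁, _, x, hx⟩ := surjective_up_to_refinements_of_epi p (y ≫ ι')
    obtain ⟨Z₂, σ₂, _, n, hn⟩ := hπ.exists_refinement (x ≫ G) (by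
      rw [Category.assoc, ← hpG, ← Category.assoc, ← hx, Category.assoc, Category.assoc,
        hι'.zero, comp_zero, comp_zero])
    obtain ⟨z, hz⟩ := hκ.lift (σ₂ ≫ x - n ≫ i) (by
      rw [Preadditive.sub_comp, Category.assoc, Category.assoc, hiG, hn, sub_self])
    refine ⟨Z₂, σ₂ ≫ σ₁, inferInstance, z, ?_⟩
    rw [← cancel_mono ι', Category.assoc, Category.assoc, Category.assoc, hx, hk,
      ← Category.assoc z, hz, Preadditive.sub_comp, Category.assoc, Category.assoc,
      hip.isKer.zero, comp_zero, sub_zero]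

-- Inside `X` the subobjects `N` and `K = ker G` meet in `H`, so their pushout over `H` is the
-- subobject `N + K` with quotient `I`, and the maps to `M` and `B` glue to a map to the pullback.
include hρ in
lemma cornerOfFill_bijective : Function.Bijective (cornerOfFill hι hπ hι' hρ (X := X) (K := K)) := by
  have := hι'.mono
  constructor
  · rintro ⟨⟨⟨h, k⟩, hhk⟩, ⟨⟨u, v⟩, huv, huvp⟩⟩ ⟨⟨⟨h', k'⟩, hhk'⟩, ⟨⟨u', v'⟩, huv', huvp'⟩⟩ heq
    have e₁ : pushout.inl ι h ≫ u = pushout.inl ι h' ≫ u' := congrArg (fun s => s.i) heq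
    have e₂ : pushout.inr ι h ≫ u = pushout.inr ι h' ≫ u' := congrArg CornerKer.κ heq
    have e₃ : v ≫ pullback.fst γ π = v' ≫ pullback.fst γ π := congrArg (fun s => s.p) heq
    have e₄ : v ≫ pullback.snd γ π = v' ≫ pullback.snd γ π := congrArg (fun s => s.G) heq
    have hv : v = v' := pullback.hom_ext e₃ e₄
    have hmono := (cornerFill_isKer hι hπ hι' hρ hhk huv huvp).mono
    have hh : h = h' := by
      rw [← cancel_mono (pushout.inr ι h ≫ u), ← pushout.condition_assoc, e₁,
        pushout.condition_assoc, e₂]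
    subst hh hv
    have hu : u = u' := pushout.hom_ext e₁ e₂
    subst hu
    have hk : k = k' := by
      rw [← cancel_mono ι', ← inr_cornerHom_fst hι hπ hι' hhk, ← inr_cornerHom_fst hι hπ hι' hhk']
      dsimp only at huv huv'
      rw [← huv, ← huv']
    subst hk
    rfl
  · intro s
    obtain ⟨h, k, hhk, hh, hk⟩ := s.exists_isSES hι hπ hι'
    obtain ⟨⟨i, p, G, hip, hiG, hpG⟩, κ, hκ⟩ := s
    dsimp only at hκ hh hk
    have := hip.isKer.mono
    have := hip.isCoker.epi
    have := hρ.epi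
    have := hκ.mono
    have := hhk.isCoker.epi
    have huv : pushout.desc i κ hh ≫ pullback.lift p G hpG = cornerHom hι hπ hι' hhk := by
      apply pushout.hom_ext <;> apply pullback.hom_ext <;>
        simp [hip.isKer.zero, hiG, hk, hκ.zero]
    -- The intersection of `N` with the kernel of `G` is the kernel of `g`; this makes the map from
    -- the pushout to `X` a monomorphism.
    have hpb : IsPullback ι h i κ := by
      have hc : ∀ c : PullbackCone i κ, c.fst ≫ g = 0 := fun c => by
        rw [← hiG, ← Category.assoc, c.condition, Category.assoc, hκ.zero, comp_zero]
      refine ⟨⟨hh⟩, ⟨PullbackCone.IsLimit.mk _ (fun c => ?_) (fun c => ?_) (fun c => ?_)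
        fun c m h₁ h₂ => ?_⟩⟩
      · exact (hι.lift c.fst (hc c)).choose
      · exact (hι.lift c.fst (hc c)).choose_spec
      · rw [← cancel_mono κ, Category.assoc, ← hh, ← Category.assoc,
          (hι.lift c.fst (hc c)).choose_spec, c.condition]
      · have := hι.mono
        rw [← cancel_mono ι, h₁]
        exact ((hι.lift c.fst (hc c)).choose_spec).symm
    have hmono : Mono (pushout.desc i κ hh) :=
      (IsPushout.of_hasPushout ι h).mono_of_isPullback_of_mono hpb _ (by simp) (by simp)
    have huvp : IsSES (pushout.desc i κ hh) (pullback.lift p G hpG ≫ pullback.fst γ π ≫ ρ) := by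
      rw [pullback.lift_fst_assoc]
      refine (IsKer.of_refinement hmono ?_ fun x hx => ?_).isSES inferInstance
      · apply pushout.hom_ext
        · simp [reassoc_of% hip.isKer.zero]
        · simp [reassoc_of% hk, hρ.zero]
      · obtain ⟨m, hm⟩ := (hρ.isSES hι'.mono).isKer.lift (x ≫ p) (by simpa using hx)
        obtain ⟨Z₁, σ₁, _, z, hz⟩ := surjective_up_to_refinements_of_epi k m
        obtain ⟨n, hn⟩ := hip.isKer.lift (σ₁ ≫ x - z ≫ κ) (by
          rw [Preadditive.sub_comp, Category.assoc, Category.assoc, ← hm, hk, reassoc_of% hz,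
            sub_self])
        refine ⟨Z₁, σ₁, inferInstance, n ≫ pushout.inl ι h + z ≫ pushout.inr ι h, ?_⟩
        simp [hn]
    refine ⟨⟨⟨(h, k), hhk⟩, ⟨(pushout.desc i κ hh, pullback.lift p G hpG), huv, huvp⟩⟩, ?_⟩
    apply CornerKer.ext' <;> simp [cornerOfFill]

variable {J : Type*} {r : J → C} {ε : C → C → ℝ} [FiniteHom C]

include hι hπ hι' hρ in
/-- The weighted number of corners whose morphism has kernel isomorphic to `K`. -/
theorem GreenData.sum_corner (G : GreenData C r ε) (K : C) :
    ∑ᶠ j, (Nat.card {s : Corner g π γ (r j) // ∃ κ : K ⟶ r j, IsKer κ s.G} : ℝ) / aut (r j) =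
      ε I H * ses H K M' / aut K := by
  have h₁ : ∀ j, (Nat.card {s : Corner g π γ (r j) // ∃ κ : K ⟶ r j, IsKer κ s.G} : ℝ) /
      aut (r j) = (∑ᶠ s : {s : (H ⟶ K) × (K ⟶ M') // IsSES s.1 s.2},
        fill (cornerHom hι hπ hι' s.2) (pullback.fst γ π ≫ ρ) (r j) / aut (r j)) / aut K := by
    intro j
    rw [eq_div_iff (aut_ne_zero K), div_mul_eq_mul_div, ← card_cornerKer,
      ← Nat.card_eq_of_bijective _ (cornerOfFill_bijective hι hπ hι' hρ), card_sigma_real,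
      finsum_div_const]
    rfl
  simp only [h₁]
  rw [← finsum_div_const, ← finsum_finsum_comm_left]
  · congr 1
    -- The Green count depends only on `I` and `H`, so each choice of an extension `H → K → M'`
    -- contributes the same amount.
    simp only [fun s : {s : (H ⟶ K) × (K ⟶ M') // IsSES s.1 s.2} =>
      G.green (isKer_cornerHom hι hπ hι' s.2) (isCoker_cornerHom hι hπ hι' s.2 hρ),
      finsum_const_card]
    rw [mul_comm]
    rfl
  · intro s
    refine (G.finite_ext (pushout ι s.1.1) I).subset fun j hj => ?_
    refine ses_ne_zero_of_fill_ne_zero (θ := cornerHom hι hπ hι' s.2)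
      (q := pullback.fst γ π ≫ ρ) fun h0 => hj ?_
    simp only [h0, zero_div]

end Corner

/-! ### Summation over morphisms on the middle term of an extension -/

section CornerSum

variable {C : Type u} [Category.{v} C] [Abelian C]

/-- A choice of a kernel and a cokernel of `f`. -/
structure KerCoker {X Y : C} (f : X ⟶ Y) where
  K : C
  ι : K ⟶ X
  Q : C
  π : Y ⟶ Q
  isKer : IsKer ι f
  isCoker : IsCoker f π

/-- The standard kernel and cokernel. -/
abbrev kerCoker {X Y : C} (f : X ⟶ Y) : KerCoker f :=
  ⟨kernel f, kernel.ι f, cokernel f, cokernel.π f, isKer_kernel f, isCoker_cokernel f⟩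

/-- The kernel and the cokernel in the opposite category. -/
abbrev KerCoker.op {X Y : Cᵒᵖ} {f : X ⟶ Y} (δ : KerCoker f.unop) : KerCoker f :=
  ⟨Opposite.op δ.Q, δ.π.op, Opposite.op δ.K, δ.ι.op, δ.isCoker.op, δ.isKer.op⟩

/-- Dividing `B` by the image of `N` leaves `Q`, on which the rest of `X` acts through `γ`; hence
the cokernel of `G` is that of `γ`. -/
lemma Corner.isCoker {N M B Q Q' X : C} {g : N ⟶ B} {π : B ⟶ Q} {γ : M ⟶ Q} {π' : Q ⟶ Q'}
    (hπ : IsCoker g π) (hπ' : IsCoker γ π') (s : Corner g π γ X) : IsCoker s.G (π ≫ π') := by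
  have := hπ.epi
  have := hπ'.epi
  have := s.isSES.isCoker.epi
  refine ⟨epi_comp _ _, ?_, fun x hx => ?_⟩
  · rw [← Category.assoc, ← s.comm, Category.assoc, hπ'.zero, comp_zero]
  · obtain ⟨y, rfl⟩ := hπ.desc x (by rw [← s.i_comp, Category.assoc, hx, comp_zero])
    obtain ⟨z, rfl⟩ := hπ'.desc y (by
      rw [← cancel_epi s.p, ← Category.assoc, s.comm, Category.assoc, hx, comp_zero])
    exact ⟨z, by rw [Category.assoc]⟩

/-- The morphism induced on cokernels by a morphism on the middle term of an extension. -/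
def inducedHom (δ : ∀ {X Y : C} (f : X ⟶ Y), KerCoker f) {N M B X : C} {i : N ⟶ X} {p : X ⟶ M}
    (h : IsSES i p) (G : X ⟶ B) : M ⟶ (δ (i ≫ G)).Q :=
  (h.isCoker.desc (G ≫ (δ (i ≫ G)).π) (by rw [← Category.assoc, (δ _).isCoker.zero])).choose

lemma comp_inducedHom (δ : ∀ {X Y : C} (f : X ⟶ Y), KerCoker f) {N M B X : C} {i : N ⟶ X}
    {p : X ⟶ M} (h : IsSES i p) (G : X ⟶ B) :
    p ≫ inducedHom δ h G = G ≫ (δ (i ≫ G)).π :=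
  (h.isCoker.desc (G ≫ (δ (i ≫ G)).π) (by
    rw [← Category.assoc, (δ _).isCoker.zero])).choose_spec

/-- An extension with a morphism on the middle term is the same as a corner. -/
def cornerEquiv (δ : ∀ {X Y : C} (f : X ⟶ Y), KerCoker f) (N M B X : C) :
    {s : (N ⟶ X) × (X ⟶ M) // IsSES s.1 s.2} × (X ⟶ B) ≃
      Σ g : N ⟶ B, Σ γ : M ⟶ (δ g).Q, Corner g (δ g).π γ X where
  toFun s := ⟨s.1.1.1 ≫ s.2, inducedHom δ s.1.2 s.2, s.1.1.1, s.1.1.2, s.2, s.1.2, rfl,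
    comp_inducedHom δ s.1.2 s.2⟩
  invFun t := ⟨⟨(t.2.2.i, t.2.2.p), t.2.2.isSES⟩, t.2.2.G⟩
  left_inv _ := rfl
  right_inv := by
    rintro ⟨g, γ, ⟨i, p, G, h, rfl, hG⟩⟩
    have hγ : inducedHom δ h G = γ := by
      have := h.isCoker.epi
      rw [← cancel_epi p, hG, comp_inducedHom]
    subst hγ
    rfl

variable {J : Type*} {r : J → C} {ε : C → C → ℝ} [FiniteHom C]

/-- The cokernel of `G` is fixed by `γ`, so the summand depends on the corner only through the class
of the kernel of `G`. That kernel is an extension of `ker γ` by `ker g`, which determines its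
weight. -/
lemma GreenData.sum_corner_weight (G : GreenData C r ε) {N M B Q : C} {g : N ⟶ B} {π : B ⟶ Q}
    {γ : M ⟶ Q} {X : C} (hπ : IsCoker g π) (δ : ∀ {X Y : C} (f : X ⟶ Y), KerCoker f)
    (F : C ⥤ C) (Y : C) {ψ : C → ℝ} {Ψ : C → C → ℝ}
    (hψ : ∀ {H K M' : C} {i : H ⟶ K} {p : K ⟶ M'}, IsSES i p → ψ K = Ψ H M') :
    ∑ᶠ s : Corner g π γ X, ψ (δ s.G).K * ses (F.obj (δ s.G).Q) Y (δ s.G).K =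
      ∑ᶠ k, Nat.card {s : Corner g π γ X // ∃ κ : r k ⟶ X, IsKer κ s.G} *
        (Ψ (δ g).K (δ γ).K * ses (F.obj (δ γ).Q) Y (r k)) := by
  classical
  have h₁ : ∀ k, (Nat.card {s : Corner g π γ X // ∃ κ : r k ⟶ X, IsKer κ s.G} : ℝ) *
        (Ψ (δ g).K (δ γ).K * ses (F.obj (δ γ).Q) Y (r k)) =
      ∑ᶠ s : Corner g π γ X, if ∃ κ : r k ⟶ X, IsKer κ s.G then
        Ψ (δ g).K (δ γ).K * ses (F.obj (δ γ).Q) Y (r k) else 0 := by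
    intro k
    rw [← finsum_const_card, finsum_subtype_eq_finsum_cond
      (p := fun s : Corner g π γ X => ∃ κ : r k ⟶ X, IsKer κ s.G)
      (f := fun _ => Ψ (δ g).K (δ γ).K * ses (F.obj (δ γ).Q) Y (r k))]
    exact finsum_congr fun s => by rw [finsum_eq_if]
  have huniq : ∀ (s : Corner g π γ X) (k k' : J), (∃ κ : r k ⟶ X, IsKer κ s.G) →
      (∃ κ : r k' ⟶ X, IsKer κ s.G) → k = k' := by
    rintro s k k' ⟨κ, hκ⟩ ⟨κ', hκ'⟩
    exact G.eq_of_iso ⟨(hκ.exists_iso hκ').choose⟩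
  simp only [h₁]
  rw [← finsum_finsum_comm_left]
  · refine finsum_congr fun s => ?_
    obtain ⟨k, ⟨a⟩⟩ := G.exists_iso (δ s.G).K
    have hk : ∃ κ : r k ⟶ X, IsKer κ s.G := ⟨_, (δ s.G).isKer.iso_comp a.symm⟩
    rw [finsum_eq_single _ k fun k' hk' => if_neg fun h => hk' (huniq s _ _ h hk), if_pos hk]
    obtain ⟨b, -⟩ := (δ s.G).isCoker.exists_iso (s.isCoker hπ (δ γ).isCoker)
    rw [ses_congr (F.mapIso b) (Iso.refl Y) a]
    obtain ⟨h, k', hk', -, -⟩ := CornerKer.exists_isSES (δ g).isKer hπ (δ γ).isKer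
      ⟨s, (δ s.G).ι, (δ s.G).isKer⟩
    rw [hψ hk']
  · intro s
    obtain ⟨k, ⟨a⟩⟩ := G.exists_iso (δ s.G).K
    have hk : ∃ κ : r k ⟶ X, IsKer κ s.G := ⟨_, (δ s.G).isKer.iso_comp a.symm⟩
    refine (Set.finite_singleton k).subset fun k' hk' => ?_
    by_contra hne
    exact hk' (if_neg fun h => hne (huniq s _ _ h hk))

/-- The sum over all extensions `X` of `M` by `N` and all morphisms `X ⟶ B`. -/
theorem GreenData.sum_hom_from (G : GreenData C r ε)
    (δ : ∀ {X Y : C} (f : X ⟶ Y), KerCoker f) (N M B Y : C) (F : C ⥤ C) {ψ : C → ℝ}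
    {Ψ : C → C → ℝ}
    (hψ : ∀ {H K M' : C} {i : H ⟶ K} {p : K ⟶ M'}, IsSES i p → ψ K = Ψ H M') :
    ∑ᶠ j, (∑ᶠ g : r j ⟶ B, ψ (δ g).K * ses N (r j) M * ses (F.obj (δ g).Q) Y (δ g).K) /
        aut (r j) =
      ∑ᶠ g : N ⟶ B, ∑ᶠ γ : M ⟶ (δ g).Q, Ψ (δ g).K (δ γ).K * ε (δ (δ γ).ι).Q (δ g).K *
        ∑ᶠ k, ses (δ g).K (r k) (δ γ).K * ses (F.obj (δ γ).Q) Y (r k) / aut (r k) := by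
  -- A morphism on the middle term is replaced by its restriction to `N`, the induced map on
  -- cokernels, and a corner connecting the two.
  have h₁ : ∀ j, ∑ᶠ g : r j ⟶ B, ψ (δ g).K * ses N (r j) M * ses (F.obj (δ g).Q) Y (δ g).K =
      ∑ᶠ g : N ⟶ B, ∑ᶠ γ : M ⟶ (δ g).Q, ∑ᶠ s : Corner g (δ g).π γ (r j),
        ψ (δ s.G).K * ses (F.obj (δ s.G).Q) Y (δ s.G).K := by
    intro j
    simp only [← finsum_sigma_real (fun t : (Σ γ : M ⟶ (δ _).Q, Corner _ (δ _).π γ (r j)) =>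
      ψ (δ t.2.G).K * ses (F.obj (δ t.2.G).Q) Y (δ t.2.G).K)]
    rw [← finsum_sigma_real (fun t : (Σ g : N ⟶ B, Σ γ : M ⟶ (δ g).Q,
        Corner g (δ g).π γ (r j)) =>
      ψ (δ t.2.2.G).K * ses (F.obj (δ t.2.2.G).Q) Y (δ t.2.2.G).K),
      ← finsum_comp_equiv (cornerEquiv δ N M B (r j)),
      ← finsum_comp_equiv (Equiv.prodComm _ _),
      finsum_curry (fun t : (r j ⟶ B) × {s : (N ⟶ r j) × (r j ⟶ M) // IsSES s.1 s.2} => _)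
        (Set.toFinite _)]
    refine finsum_congr fun g => ?_
    symm
    change ∑ᶠ _ : {s : (N ⟶ r j) × (r j ⟶ M) // IsSES s.1 s.2},
      ψ (δ g).K * ses (F.obj (δ g).Q) Y (δ g).K = _
    rw [finsum_const_card]
    change ses N (r j) M * _ = _
    ring
  have hfin : ∀ (g : N ⟶ B) (γ : M ⟶ (δ g).Q),
      {p : J × J | (Nat.card {s : Corner g (δ g).π γ (r p.1) //
        ∃ κ : r p.2 ⟶ r p.1, IsKer κ s.G} : ℝ) ≠ 0}.Finite := by
    intro g γ
    refine ((G.finite_ext N M).prod (G.finite_ext (δ g).K (δ γ).K)).subset ?_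
    rintro ⟨j, k⟩ hjk
    have hjk' : Nat.card {s : Corner g (δ g).π γ (r j) // ∃ κ : r k ⟶ r j, IsKer κ s.G} ≠ 0 :=
      fun h => hjk (by dsimp only; rw [h, Nat.cast_zero])
    obtain ⟨⟨s, κ, hκ⟩⟩ := (Nat.card_ne_zero.1 hjk').1
    obtain ⟨h, k', hk', -, -⟩ := CornerKer.exists_isSES (δ g).isKer (δ g).isCoker (δ γ).isKer
      ⟨s, κ, hκ⟩
    exact ⟨ses_ne_zero_of_isSES s.isSES, ses_ne_zero_of_isSES hk'⟩
  have hj : ∀ (g : N ⟶ B) (γ : M ⟶ (δ g).Q), {j | (∑ᶠ s : Corner g (δ g).π γ (r j),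
      ψ (δ s.G).K * ses (F.obj (δ s.G).Q) Y (δ s.G).K) / aut (r j) ≠ 0}.Finite := by
    intro g γ
    refine (G.finite_ext N M).subset fun j hj hs => hj ?_
    have : IsEmpty (Corner g (δ g).π γ (r j)) := ⟨fun s => ses_ne_zero_of_isSES s.isSES hs⟩
    rw [finsum_of_isEmpty, zero_div]
  have h₂ : ∀ j, (∑ᶠ g : N ⟶ B, ∑ᶠ γ : M ⟶ (δ g).Q, ∑ᶠ s : Corner g (δ g).π γ (r j),
      ψ (δ s.G).K * ses (F.obj (δ s.G).Q) Y (δ s.G).K) / aut (r j) =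
      ∑ᶠ g : N ⟶ B, ∑ᶠ γ : M ⟶ (δ g).Q, (∑ᶠ s : Corner g (δ g).π γ (r j),
      ψ (δ s.G).K * ses (F.obj (δ s.G).Q) Y (δ s.G).K) / aut (r j) := by
    intro j
    rw [finsum_div_const]
    exact finsum_congr fun g => finsum_div_const _ _
  simp only [h₁, h₂]
  rw [← finsum_finsum_comm_left]
  · refine finsum_congr fun g => ?_
    rw [← finsum_finsum_comm_left]
    · refine finsum_congr fun γ => ?_
      simp only [G.sum_corner_weight (δ g).isCoker δ F Y hψ]
      simp only [finsum_div_const]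
      rw [finsum_finsum_comm, mul_finsum]
      · refine finsum_congr fun k => ?_
        simp only [mul_div_right_comm]
        -- At this point the middle term disappears: its weighted sum is replaced by `ε` and a count
        -- of extensions of the kernels.
        rw [← finsum_mul, G.sum_corner (δ g).isKer (δ g).isCoker (δ γ).isKer (δ (δ γ).ι).isCoker]
        ring
      · refine (hfin g γ).subset fun p hp h0 => hp ?_
        rw [h0]
        simp
    · intro γ
      exact hj g γ
  · intro g
    refine (Set.finite_iUnion (hj g)).subset fun j hjn => ?_
    by_contra hcon
    rw [Set.mem_iUnion] at hcon
    push Not at hcon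
    refine hjn ?_
    exact finsum_eq_zero_of_forall_eq_zero fun γ => by
      by_contra h
      exact hcon γ h

/-- The sum over all extensions `X` of `R` by `P` and all morphisms `B ⟶ X`. -/
theorem GreenData.sum_hom_to (G : GreenData C r ε)
    (δ : ∀ {X Y : C} (f : X ⟶ Y), KerCoker f) (P R B Y : C) (F : C ⥤ C) {ψ : C → ℝ}
    {Ψ : C → C → ℝ}
    (hψ : ∀ {P' K H : C} {i : P' ⟶ K} {p : K ⟶ H}, IsSES i p → ψ K = Ψ H P') :
    ∑ᶠ j, (∑ᶠ f : B ⟶ r j, ψ (δ f).Q * ses P (r j) R * ses (δ f).Q Y (F.obj (δ f).K)) /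
        aut (r j) =
      ∑ᶠ f : B ⟶ R, ∑ᶠ γ : (δ f).K ⟶ P, Ψ (δ f).Q (δ γ).Q * ε (δ f).Q (δ (δ γ).π).K *
        ∑ᶠ k, ses (δ f).Q (r k) (F.obj (δ γ).K) * ses (δ γ).Q Y (r k) / aut (r k) := by
  -- Morphisms into an extension are morphisms out of an extension in the opposite category.
  have := G.op.sum_hom_from (fun {X Y} f => (δ f.unop).op) (Opposite.op R) (Opposite.op P)
    (Opposite.op B) (Opposite.op Y) F.op (ψ := fun X => ψ X.unop)
    (Ψ := fun X Y => Ψ X.unop Y.unop) (fun h => hψ h.unop)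
  have e₁ : ∀ j, ∑ᶠ f : B ⟶ r j, ψ (δ f).Q * ses P (r j) R * ses (δ f).Q Y (F.obj (δ f).K) =
      ∑ᶠ g : Opposite.op (r j) ⟶ Opposite.op B, ψ (δ g.unop).Q *
        ses (Opposite.op R) (Opposite.op (r j)) (Opposite.op P) *
        ses (Opposite.op (F.obj (δ g.unop).K)) (Opposite.op Y) (Opposite.op (δ g.unop).Q) := by
    intro j
    rw [← finsum_comp_equiv (opEquiv (Opposite.op (r j)) (Opposite.op B))]
    refine finsum_congr fun g => ?_
    rw [ses_op, ses_op]
    rfl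
  simp only [e₁]
  simp only [aut_op] at this
  refine this.trans ?_
  refine (finsum_comp_equiv (opEquiv (Opposite.op R) (Opposite.op B)).symm).symm.trans ?_
  refine finsum_congr fun f => ?_
  refine (finsum_comp_equiv (opEquiv (Opposite.op P) (Opposite.op (δ f).K)).symm).symm.trans ?_
  refine finsum_congr fun γ => ?_
  congr 1
  -- Dualizing yields the filtration of `Y` bracketed the other way; associativity of Hall numbers
  -- converts it.
  rw [G.ses_assoc]
  refine finsum_congr fun k => ?_
  rw [← ses_op _ (r k), ← ses_op (r k)]
  rfl

end CornerSum

/-! ### Exact equivalences -/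

section Equivalence

variable {C : Type u} [Category.{v} C] [Abelian C]

lemma IsKer.map_functor {K X B : C} {k : K ⟶ X} {g : X ⟶ B} (h : IsKer k g) (F : C ⥤ C)
    [F.IsEquivalence] : IsKer (F.map k) (F.map g) := by
  have := h.mono
  refine ⟨inferInstance, by rw [← F.map_comp, h.zero, F.map_zero], fun {Z} x hx => ?_⟩
  let e := F.objObjPreimageIso Z
  obtain ⟨y, hy⟩ := h.lift (F.preimage (e.hom ≫ x)) (F.map_injective (by simp [hx]))
  refine ⟨e.inv ≫ F.map y, ?_⟩
  rw [Category.assoc, ← F.map_comp, hy, F.map_preimage, e.inv_hom_id_assoc]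

lemma IsCoker.map_functor {A X Q : C} {f : A ⟶ X} {q : X ⟶ Q} (h : IsCoker f q) (F : C ⥤ C)
    [F.IsEquivalence] : IsCoker (F.map f) (F.map q) := by
  have := h.epi
  refine ⟨inferInstance, by rw [← F.map_comp, h.zero, F.map_zero], fun {Z} x hx => ?_⟩
  let e := F.objObjPreimageIso Z
  obtain ⟨y, hy⟩ := h.desc (F.preimage (x ≫ e.inv)) (F.map_injective (by simp [reassoc_of% hx]))
  refine ⟨F.map y ≫ e.hom, ?_⟩
  rw [← Category.assoc, ← F.map_comp, hy, F.map_preimage, Category.assoc, e.inv_hom_id,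
    Category.comp_id]

/-- The transposes under an equivalence have the same kernel. -/
lemma nonempty_kernel_iso (e : C ≌ C) {X Y : C} (γ : e.functor.obj X ⟶ Y) :
    Nonempty (e.functor.obj (kernel (e.toAdjunction.homEquiv X Y γ)) ≅ kernel γ) := by
  have h := ((isKer_kernel γ).map_functor e.inverse).iso_mid (e.unitIso.app X).symm
  have h' : (e.unitIso.app X).symm.inv ≫ e.inverse.map γ = e.toAdjunction.homEquiv X Y γ := by
    simp [Adjunction.homEquiv_unit]
  rw [h'] at h
  obtain ⟨a, -⟩ := (isKer_kernel _).exists_iso h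
  exact ⟨e.functor.mapIso a ≪≫ e.counitIso.app _⟩

/-- The transposes under an equivalence have the same cokernel. -/
lemma nonempty_cokernel_iso (e : C ≌ C) {X Y : C} (γ : e.functor.obj X ⟶ Y) :
    Nonempty (e.inverse.obj (cokernel γ) ≅ cokernel (e.toAdjunction.homEquiv X Y γ)) := by
  have h := ((isCoker_cokernel γ).map_functor e.inverse).epi_comp (e.unit.app X)
  have h' : e.unit.app X ≫ e.inverse.map γ = e.toAdjunction.homEquiv X Y γ := by
    simp [Adjunction.homEquiv_unit]
  rw [h'] at h
  obtain ⟨a, -⟩ := h.exists_iso (isCoker_cokernel _)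
  exact ⟨a⟩

end Equivalence

/-! ### Classes in an abelian group -/

section Classes

variable {C : Type u} [Category.{v} C] [Abelian C] {Γ : Type*} [AddCommGroup Γ]

/-- A function on objects is additive if it is additive on short exact sequences. -/
def IsAdditiveOnSES (cls : C → Γ) : Prop :=
  ∀ {N X M : C} {i : N ⟶ X} {p : X ⟶ M}, IsSES i p → cls X = cls N + cls M

variable {cls : C → Γ} (hcls : IsAdditiveOnSES cls)
include hcls

open ZeroObject in
lemma IsAdditiveOnSES.cls_iso {X Y : C} (e : X ≅ Y) : cls X = cls Y := by
  have h : IsSES (0 : (0 : C) ⟶ X) e.hom :=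
    IsKer.isSES ⟨(isZero_zero C).mono _, zero_comp, fun x hx => ⟨0, by
      rw [zero_comp, ← cancel_mono e.hom, hx, zero_comp]⟩⟩ inferInstance
  have h' : IsSES (0 : (0 : C) ⟶ Y) (𝟙 Y) :=
    IsKer.isSES ⟨(isZero_zero C).mono _, zero_comp, fun x hx => ⟨0, by
      rw [zero_comp, ← cancel_mono (𝟙 Y), hx, zero_comp]⟩⟩ inferInstance
  have h1 := hcls h
  have h2 := hcls h'
  have h3 : cls (0 : C) = 0 := by simpa using h2
  rw [h1, h3, zero_add]

/-- Both sides are the class of the image. -/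
lemma IsAdditiveOnSES.cls_kernel_cokernel {X Y : C} (f : X ⟶ Y) :
    cls X - cls (kernel f) = cls Y - cls (cokernel f) := by
  have h₁ : IsSES (kernel.ι f) (Abelian.factorThruImage f) :=
    (IsKer.of_comp_mono (Abelian.image.ι f) (by
      rw [Abelian.image.fac]; exact isKer_kernel f)).isSES inferInstance
  have h₂ : IsSES (Abelian.image.ι f) (cokernel.π f) := (isKer_kernel _).isSES inferInstance
  rw [hcls h₁, hcls h₂]
  abel

lemma IsAdditiveOnSES.cls_mono {X Y : C} (f : X ⟶ Y) [Mono f] :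
    cls Y = cls X + cls (cokernel f) :=
  hcls ((isCoker_cokernel f).isSES inferInstance)

lemma IsAdditiveOnSES.cls_epi {X Y : C} (f : X ⟶ Y) [Epi f] :
    cls X = cls (kernel f) + cls Y :=
  hcls ((isKer_kernel f).isSES inferInstance)

end Classes

/-! ### The abstract multiplication -/

section Product

variable {C : Type u} [Category.{v} C] [Abelian C] {Γ : Type*} [AddCommGroup Γ]

/-- The normalized structure constants: a weighted sum over all morphisms `A₁[-1] ⟶ A₂`, where
`e` is the shift. -/
def coeff (e : C ≌ C) (cls : C → Γ) (w : Γ → Γ → Γ → ℝ) (A₁ A₂ X : C) : ℝ :=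
  (∑ᶠ f : e.inverse.obj A₁ ⟶ A₂, w (cls A₁) (cls A₂) (cls A₂ - cls (cokernel f)) *
    ses (cokernel f) X (e.functor.obj (kernel f))) / aut X

variable {J : Type*} {r : J → C} {ε : C → C → ℝ} {e : C ≌ C} {cls : C → Γ}
  {w : Γ → Γ → Γ → ℝ} {s : Γ ≃+ Γ} {E : Γ → Γ → ℝ}

/-- Transposing `A₁[-1] → A₂` to `A₁ → A₂[1]` shifts kernel, image and cokernel by one. The
transposed form is needed when an extension stands in the first argument, as the source of the
morphism. -/
lemma coeff_eq (hcls : IsAdditiveOnSES cls) (hs : ∀ X, cls (e.functor.obj X) = s (cls X))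
    (A₁ A₂ X : C) :
    coeff e cls w A₁ A₂ X = (∑ᶠ g : A₁ ⟶ e.functor.obj A₂,
      w (cls A₁) (cls A₂) (s.symm (cls A₁ - cls (kernel g))) *
        ses (e.inverse.obj (cokernel g)) X (kernel g)) / aut X := by
  unfold coeff
  congr 1
  refine Eq.trans (finsum_congr fun f => ?_)
    (finsum_comp_equiv (e.symm.toAdjunction.homEquiv A₁ A₂))
  obtain ⟨a⟩ := nonempty_kernel_iso e.symm f
  obtain ⟨b⟩ := nonempty_cokernel_iso e.symm f
  have a' : e.functor.obj (kernel f) ≅ kernel (e.symm.toAdjunction.homEquiv A₁ A₂ f) :=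
    e.functor.mapIso a.symm ≪≫ e.counitIso.app _
  have b' : cokernel f ≅ e.inverse.obj (cokernel (e.symm.toAdjunction.homEquiv A₁ A₂ f)) :=
    e.unitIso.app _ ≪≫ e.inverse.mapIso b
  rw [ses_congr b' (Iso.refl X) a']
  congr 2
  have h := hcls.cls_kernel_cokernel f
  change cls (e.inverse.obj A₁) - _ = _ at h
  rw [← h, ← hcls.cls_iso a', hs, map_sub, AddEquiv.symm_apply_apply]
  congr 1
  rw [AddEquiv.eq_symm_apply, ← hs]
  exact hcls.cls_iso (e.counitIso.app A₁)

lemma finsum_eq_zero_of_forall {α : Type*} {f : α → ℝ} (h : ∀ a, f a = 0) : ∑ᶠ a, f a = 0 :=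
  finsum_eq_zero_of_forall_eq_zero h

variable [FiniteHom C]

/-- There are finitely many `f`, and each admits finitely many middle terms. -/
lemma finite_coeff (G : GreenData C r ε) (A₁ A₂ : C) :
    {j | coeff e cls w A₁ A₂ (r j) ≠ 0}.Finite := by
  refine (Set.finite_iUnion fun f : e.inverse.obj A₁ ⟶ A₂ =>
    G.finite_ext (cokernel f) (e.functor.obj (kernel f))).subset fun j hj => ?_
  by_contra hcon
  rw [Set.mem_iUnion] at hcon
  push Not at hcon
  refine hj ?_
  unfold coeff
  rw [finsum_eq_zero_of_forall, zero_div]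
  intro f
  have : ses (cokernel f) (r j) (e.functor.obj (kernel f)) = 0 := by
    by_contra h
    exact hcon f h
  rw [this, mul_zero]

/-- Here the intermediate object is an extension of `(ker f)[1]` by `coker f` and the source of a
morphism to `A₃[1]`, so `GreenData.sum_hom_from` eliminates it. The weights survive because they
only see classes. -/
lemma coeff_comp_eq_left (G : GreenData C r ε) (hcls : IsAdditiveOnSES cls)
    (hs : ∀ X, cls (e.functor.obj X) = s (cls X)) (A₁ A₂ A₃ Y : C) :
    ∑ᶠ j, coeff e cls w A₁ A₂ (r j) * coeff e cls w (r j) A₃ Y =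
      (∑ᶠ f : e.inverse.obj A₁ ⟶ A₂, ∑ᶠ g : cokernel f ⟶ e.functor.obj A₃,
        ∑ᶠ γ : e.functor.obj (kernel f) ⟶ cokernel g,
          w (cls A₁) (cls A₂) (cls A₂ - cls (cokernel f)) *
          w (cls (cokernel f) + cls (e.functor.obj (kernel f))) (cls A₃)
            (s.symm (cls (cokernel f) + cls (e.functor.obj (kernel f)) -
              (cls (kernel g) + cls (kernel γ)))) *
          ε (cokernel (kernel.ι γ)) (kernel g) *
          ∑ᶠ k, ses (kernel g) (r k) (kernel γ) *
            ses (e.inverse.obj (cokernel γ)) Y (r k) / aut (r k)) / aut Y := by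
  have h₁ : ∀ j, coeff e cls w A₁ A₂ (r j) * coeff e cls w (r j) A₃ Y =
      ∑ᶠ f : e.inverse.obj A₁ ⟶ A₂, w (cls A₁) (cls A₂) (cls A₂ - cls (cokernel f)) *
        ((∑ᶠ g : r j ⟶ e.functor.obj A₃,
          w (cls (cokernel f) + cls (e.functor.obj (kernel f))) (cls A₃)
            (s.symm (cls (cokernel f) + cls (e.functor.obj (kernel f)) - cls (kernel g))) *
          ses (cokernel f) (r j) (e.functor.obj (kernel f)) *
          ses (e.inverse.obj (cokernel g)) Y (kernel g)) / aut (r j)) / aut Y := by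
    intro j
    rw [coeff_eq hcls hs (r j) A₃, coeff, div_mul_div_comm, ← div_div, ← finsum_div_const]
    congr 1
    rw [div_eq_iff (aut_ne_zero _), finsum_mul, finsum_mul]
    refine finsum_congr fun f => ?_
    rw [mul_assoc, mul_assoc, div_mul_cancel₀ _ (aut_ne_zero _)]
    -- Where an extension exists, additivity expresses the class of the intermediate object by the
    -- classes of its ends, so the weight no longer depends on `j`.
    by_cases h0 : ses (cokernel f) (r j) (e.functor.obj (kernel f)) = 0
    · simp [h0]
    obtain ⟨i, p, hip⟩ := exists_isSES_of_ses_ne_zero h0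
    rw [mul_finsum]
    congr 1
    refine finsum_congr fun g => ?_
    rw [hcls hip]
    ring
  simp only [h₁]
  rw [finsum_div_const, ← finsum_finsum_comm_left]
  · refine finsum_congr fun f => ?_
    rw [← finsum_div_const, ← mul_finsum]
    congr 1
    rw [G.sum_hom_from kerCoker _ _ _ _ e.inverse
      (ψ := fun K => w (cls (cokernel f) + cls (e.functor.obj (kernel f))) (cls A₃)
        (s.symm (cls (cokernel f) + cls (e.functor.obj (kernel f)) - cls K)))
      (Ψ := fun H M' => w (cls (cokernel f) + cls (e.functor.obj (kernel f))) (cls A₃)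
        (s.symm (cls (cokernel f) + cls (e.functor.obj (kernel f)) - (cls H + cls M'))))
      (fun h => by rw [hcls h]), mul_finsum]
    refine finsum_congr fun g => ?_
    rw [mul_finsum]
    refine finsum_congr fun γ => ?_
    ring
  · intro f
    refine (G.finite_ext (cokernel f) (e.functor.obj (kernel f))).subset fun j hj h0 => hj ?_
    rw [h0]
    simp

/-- Dually, the intermediate object is an extension of `ker g` by `(coker g)[-1]` and the target of
a morphism from `A₁[-1]`. -/
lemma coeff_comp_eq_right (G : GreenData C r ε) (hcls : IsAdditiveOnSES cls)
    (hs : ∀ X, cls (e.functor.obj X) = s (cls X)) (A₁ A₂ A₃ Y : C) :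
    ∑ᶠ j, coeff e cls w A₂ A₃ (r j) * coeff e cls w A₁ (r j) Y =
      (∑ᶠ g : A₂ ⟶ e.functor.obj A₃, ∑ᶠ f : e.inverse.obj A₁ ⟶ kernel g,
        ∑ᶠ γ : kernel f ⟶ e.inverse.obj (cokernel g),
          w (cls A₂) (cls A₃) (s.symm (cls A₂ - cls (kernel g))) *
          w (cls A₁) (cls (e.inverse.obj (cokernel g)) + cls (kernel g))
            (cls (e.inverse.obj (cokernel g)) + cls (kernel g) -
              (cls (cokernel γ) + cls (cokernel f))) *
          ε (cokernel f) (kernel (cokernel.π γ)) *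
          ∑ᶠ k, ses (cokernel f) (r k) (e.functor.obj (kernel γ)) *
            ses (cokernel γ) Y (r k) / aut (r k)) / aut Y := by
  have h₁ : ∀ j, coeff e cls w A₂ A₃ (r j) * coeff e cls w A₁ (r j) Y =
      ∑ᶠ g : A₂ ⟶ e.functor.obj A₃, w (cls A₂) (cls A₃) (s.symm (cls A₂ - cls (kernel g))) *
        ((∑ᶠ f : e.inverse.obj A₁ ⟶ r j,
          w (cls A₁) (cls (e.inverse.obj (cokernel g)) + cls (kernel g))
            (cls (e.inverse.obj (cokernel g)) + cls (kernel g) - cls (cokernel f)) *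
          ses (e.inverse.obj (cokernel g)) (r j) (kernel g) *
          ses (cokernel f) Y (e.functor.obj (kernel f))) / aut (r j)) / aut Y := by
    intro j
    rw [coeff_eq hcls hs A₂ A₃, coeff, div_mul_div_comm, ← div_div, ← finsum_div_const]
    congr 1
    rw [div_eq_iff (aut_ne_zero _), finsum_mul, finsum_mul]
    refine finsum_congr fun g => ?_
    rw [mul_assoc, mul_assoc, div_mul_cancel₀ _ (aut_ne_zero _)]
    by_cases h0 : ses (e.inverse.obj (cokernel g)) (r j) (kernel g) = 0
    · simp [h0]
    obtain ⟨i, p, hip⟩ := exists_isSES_of_ses_ne_zero h0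
    rw [mul_finsum]
    congr 1
    refine finsum_congr fun f => ?_
    rw [hcls hip]
    ring
  simp only [h₁]
  rw [finsum_div_const, ← finsum_finsum_comm_left]
  · refine finsum_congr fun g => ?_
    rw [← finsum_div_const, ← mul_finsum]
    congr 1
    rw [G.sum_hom_to kerCoker _ _ _ _ e.functor
      (ψ := fun K => w (cls A₁) (cls (e.inverse.obj (cokernel g)) + cls (kernel g))
            (cls (e.inverse.obj (cokernel g)) + cls (kernel g) - cls K))
      (Ψ := fun H P => w (cls A₁) (cls (e.inverse.obj (cokernel g)) + cls (kernel g))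
            (cls (e.inverse.obj (cokernel g)) + cls (kernel g) - (cls P + cls H)))
      (fun h => by rw [hcls h]), mul_finsum]
    refine finsum_congr fun f => ?_
    rw [mul_finsum]
    refine finsum_congr fun γ => ?_
    ring
  · intro g
    refine (G.finite_ext (e.inverse.obj (cokernel g)) (kernel g)).subset fun j hj h0 => hj ?_
    rw [h0]
    simp

/-- Complexes `X ⟶ Y ⟶ Z` in terms of morphisms from the cokernel of the first morphism. -/
def pairEquivCokernel (X Y Z : C) : {p : (X ⟶ Y) × (Y ⟶ Z) // p.1 ≫ p.2 = 0} ≃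
    Σ f : X ⟶ Y, (cokernel f ⟶ Z) where
  toFun p := ⟨p.1.1, cokernel.desc p.1.1 p.1.2 p.2⟩
  invFun p := ⟨(p.1, cokernel.π p.1 ≫ p.2), by simp⟩
  left_inv p := by simp
  right_inv p := by
    obtain ⟨f, g⟩ := p
    dsimp only
    congr 1
    ext
    simp

/-- Complexes `X ⟶ Y ⟶ Z` in terms of morphisms to the kernel of the second morphism. -/
def pairEquivKernel (X Y Z : C) : {p : (X ⟶ Y) × (Y ⟶ Z) // p.1 ≫ p.2 = 0} ≃
    Σ g : Y ⟶ Z, (X ⟶ kernel g) where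
  toFun p := ⟨p.1.2, kernel.lift p.1.2 p.1.1 p.2⟩
  invFun p := ⟨(p.2 ≫ kernel.ι p.1, p.1), by simp⟩
  left_inv p := by simp
  right_inv p := by
    obtain ⟨f, g⟩ := p
    dsimp only
    congr 1
    ext
    simp

omit [FiniteHom C] in
/-- The two descriptions of the homology of a complex `X ⟶ Y ⟶ Z`. -/
lemma nonempty_homology_iso {X Y Z : C} (f : X ⟶ Y) (g : Y ⟶ Z) (h : f ≫ g = 0) :
    Nonempty (kernel (cokernel.desc f g h) ≅ cokernel (kernel.lift g f h)) := by
  let l : kernel g ⟶ kernel (cokernel.desc f g h) :=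
    kernel.lift _ (kernel.ι g ≫ cokernel.π f) (by simp)
  have hl : l ≫ kernel.ι _ = kernel.ι g ≫ cokernel.π f := by simp [l]
  -- The map `ker g → coker f` has as kernel the image of `f`, and hits exactly the kernel of the
  -- map induced by `g`.
  have hc : IsCoker (kernel.lift g f h) l := by
    refine IsCoker.of_refinement ?_ ?_ fun x hx => ?_
    · rw [epi_iff_surjective_up_to_refinements]
      intro T y
      obtain ⟨T', σ, _, x, hx⟩ := surjective_up_to_refinements_of_epi (cokernel.π f)
        (y ≫ kernel.ι _)
      have hxg : x ≫ g = 0 := by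
        rw [← cokernel.π_desc f g h, ← Category.assoc, ← hx, Category.assoc, Category.assoc,
          kernel.condition, comp_zero, comp_zero]
      refine ⟨T', σ, inferInstance, kernel.lift g x hxg, ?_⟩
      rw [← cancel_mono (kernel.ι _), Category.assoc, hx, Category.assoc, hl,
        kernel.lift_ι_assoc]
    · rw [← cancel_mono (kernel.ι _), Category.assoc, hl]
      simp
    · obtain ⟨T', σ, _, y, hy⟩ := (isCoker_cokernel f).exists_refinement (x ≫ kernel.ι g) (by
        rw [Category.assoc, ← hl, ← Category.assoc, hx, zero_comp])
      refine ⟨T', σ, inferInstance, y, ?_⟩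
      rw [← cancel_mono (kernel.ι g), Category.assoc, hy, Category.assoc, kernel.lift_ι]
  obtain ⟨a, -⟩ := hc.exists_iso (isCoker_cokernel _)
  exact ⟨a⟩

omit [FiniteHom C] in
/-- The contributions of a complex `A₁[-1] ⟶ A₂ ⟶ A₃[1]` to the two sides of the associativity
law agree. -/
lemma coeff_assoc_of_comp_eq_zero (hcls : IsAdditiveOnSES cls)
    (hs : ∀ X, cls (e.functor.obj X) = s (cls X)) (hε : ∀ X Y, ε X Y = E (cls X) (cls Y))
    (hw : ∀ x m c a j i : Γ,
      w (m + i + s a) (a + x + j) a *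
        w (x + j + (m + i)) (s.symm (j + i) + c) (s.symm (j + i)) * E i x =
      w (a + x + j) (s.symm (j + i) + c) (s.symm j) *
        w (m + i + s a) (s.symm i + c + (a + x)) (s.symm i + a) * E x (s.symm i))
    (A₁ A₂ A₃ Y : C) (f : e.inverse.obj A₁ ⟶ A₂) (g : A₂ ⟶ e.functor.obj A₃)
    (hfg : f ≫ g = 0) :
    (∑ᶠ γ : e.functor.obj (kernel f) ⟶ cokernel (cokernel.desc f g hfg),
        w (cls A₁) (cls A₂) (cls A₂ - cls (cokernel f)) *
        w (cls (cokernel f) + cls (e.functor.obj (kernel f))) (cls A₃)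
          (s.symm (cls (cokernel f) + cls (e.functor.obj (kernel f)) -
            (cls (kernel (cokernel.desc f g hfg)) + cls (kernel γ)))) *
        ε (cokernel (kernel.ι γ)) (kernel (cokernel.desc f g hfg)) *
        ∑ᶠ k, ses (kernel (cokernel.desc f g hfg)) (r k) (kernel γ) *
          ses (e.inverse.obj (cokernel γ)) Y (r k) / aut (r k)) =
      ∑ᶠ γ : kernel (kernel.lift g f hfg) ⟶ e.inverse.obj (cokernel g),
        w (cls A₂) (cls A₃) (s.symm (cls A₂ - cls (kernel g))) *
        w (cls A₁) (cls (e.inverse.obj (cokernel g)) + cls (kernel g))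
          (cls (e.inverse.obj (cokernel g)) + cls (kernel g) -
            (cls (cokernel γ) + cls (cokernel (kernel.lift g f hfg)))) *
        ε (cokernel (kernel.lift g f hfg)) (kernel (cokernel.π γ)) *
        ∑ᶠ k, ses (cokernel (kernel.lift g f hfg)) (r k) (e.functor.obj (kernel γ)) *
          ses (cokernel γ) Y (r k) / aut (r k) := by
  have hs' : ∀ X, cls (e.inverse.obj X) = s.symm (cls X) := fun X => by
    rw [AddEquiv.eq_symm_apply, ← hs]
    exact hcls.cls_iso (e.counitIso.app X)
  obtain ⟨α, hα⟩ := (isKer_kernel (kernel.lift g f hfg)).exists_iso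
    (IsKer.of_comp_mono (kernel.ι g) (by rw [kernel.lift_ι]; exact isKer_kernel f))
  obtain ⟨β, hβ⟩ := (isCoker_cokernel (cokernel.desc f g hfg)).exists_iso
    (IsCoker.of_epi_comp (cokernel.π f) (by rw [cokernel.π_desc]; exact isCoker_cokernel g))
  obtain ⟨η⟩ := nonempty_homology_iso f g hfg
  -- The two kernels and the two cokernels agree with those of `f` and `g`, so the morphisms `γ` on
  -- the two sides correspond by transposition along the shift.
  rw [← finsum_comp_equiv ((e.toAdjunction.homEquiv (kernel f)
    (cokernel (cokernel.desc f g hfg))).trans (α.symm.homCongr (e.inverse.mapIso β)))]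
  refine finsum_congr fun γ => ?_
  obtain ⟨a⟩ := nonempty_kernel_iso e γ
  obtain ⟨b⟩ := nonempty_cokernel_iso e γ
  set γ₁ := e.toAdjunction.homEquiv (kernel f) (cokernel (cokernel.desc f g hfg)) γ with hγ₁
  have hγ' : ((e.toAdjunction.homEquiv (kernel f) (cokernel (cokernel.desc f g hfg))).trans
      (α.symm.homCongr (e.inverse.mapIso β))) γ = α.hom ≫ γ₁ ≫ (e.inverse.mapIso β).hom := rfl
  rw [hγ']
  set γ' := α.hom ≫ γ₁ ≫ (e.inverse.mapIso β).hom with hγ'_def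
  obtain ⟨a₁, -⟩ := (isKer_kernel γ').exists_iso
    (((isKer_kernel γ₁).iso_mid α.symm).comp_mono (e.inverse.mapIso β).hom |> fun h => by
      simpa [hγ'_def] using h)
  obtain ⟨b₁, -⟩ := (isCoker_cokernel γ').exists_iso
    (((isCoker_cokernel γ₁).iso_mid (e.inverse.mapIso β)).epi_comp α.hom |> fun h => by
      simpa [hγ'_def] using h)
  have ha : kernel γ ≅ e.functor.obj (kernel γ') := a.symm ≪≫ e.functor.mapIso a₁.symm
  have hb : e.inverse.obj (cokernel γ) ≅ cokernel γ' := b ≪≫ b₁.symm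
  have hZ : ∀ k, ses (kernel (cokernel.desc f g hfg)) (r k) (kernel γ) *
      ses (e.inverse.obj (cokernel γ)) Y (r k) / aut (r k) =
      ses (cokernel (kernel.lift g f hfg)) (r k) (e.functor.obj (kernel γ')) *
      ses (cokernel γ') Y (r k) / aut (r k) := fun k => by
    rw [ses_congr η (Iso.refl (r k)) ha, ses_congr hb (Iso.refl Y) (Iso.refl (r k))]
  simp only [hZ]
  congr 1
  have k₁ := hcls.cls_kernel_cokernel f
  have k₂ := hcls.cls_kernel_cokernel (cokernel.desc f g hfg)
  have k₃ := hcls.cls_kernel_cokernel γ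
  have k₄ := hcls.cls_kernel_cokernel g
  have k₅ := hcls.cls_kernel_cokernel γ'
  have k₆ := hcls.cls_mono (kernel.ι γ)
  have k₇ := hcls.cls_epi (cokernel.π γ')
  have i₁ := hcls.cls_iso ha
  have i₂ := hcls.cls_iso hb
  have i₃ := hcls.cls_iso η
  have i₄ := hcls.cls_iso α
  have i₅ := hcls.cls_iso β
  rw [hs'] at k₁ i₂ k₅ k₇
  rw [hs] at k₂ k₃ k₄ k₆ i₁
  rw [hε, hε, hs, hs']
  -- Six independent classes govern everything: `x` is the homology of the complex, `m` and `i` are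
  -- kernel and image of `γ`, `a` and `j` are the images of `f` and `g`, and `c` is the cokernel of
  -- `γ` shifted by `-1`.
  set x := cls (kernel (cokernel.desc f g hfg))
  set m := cls (kernel γ)
  set i := s (cls (kernel f)) - cls (kernel γ) with hi
  set a := cls A₂ - cls (cokernel f) with ha'
  set j := cls (cokernel f) - x with hj
  set c := s.symm (cls (cokernel γ)) with hc
  have q₁ : cls A₁ = m + i + s a := by
    rw [hi, ← k₁, map_sub, AddEquiv.apply_symm_apply]
    abel
  have q₂ : cls A₂ = a + x + j := by
    rw [ha', hj]
    abel
  have q₃ : cls A₃ = s.symm (j + i) + c := by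
    rw [hc, ← map_add, AddEquiv.eq_symm_apply, k₃, k₂]
    abel
  have q₄ : cls (cokernel f) = x + j := by
    rw [hj]
    abel
  have q₅ : s (cls (kernel f)) = m + i := by
    rw [hi]
    abel
  have q₆ : cls (cokernel (kernel.ι γ)) = i := by
    rw [hi, k₆]
    abel
  have q₇ : s.symm (cls (cokernel g)) = s.symm i + c := by
    rw [hc, ← map_add, ← i₅, k₃]
    congr 1
    abel
  have q₈ : cls (kernel g) = a + x := by
    have : cls (kernel g) = cls A₂ - (s (cls A₃) - cls (cokernel g)) := by
      rw [← k₄]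
      abel
    rw [this, ← i₅, ← k₂, ha', hj]
    abel
  have q₉ : cls (kernel (cokernel.π γ')) = s.symm i := by
    have : cls (kernel (cokernel.π γ')) = s.symm (cls (cokernel g)) - cls (cokernel γ') := by
      rw [k₇]
      abel
    rw [this, q₇, ← i₂, hc]
    abel
  rw [q₆, ← i₃, q₉, ← i₂, q₇, q₈, q₅, q₄, q₃, q₁, q₂]
  have e₁ : s.symm (x + j + (m + i) - (x + m)) = s.symm (j + i) := by
    congr 1
    abel
  have e₂ : s.symm (a + x + j - (a + x)) = s.symm j := by
    congr 1
    abel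
  have e₃ : s.symm i + c + (a + x) - (c + x) = s.symm i + a := by abel
  rw [e₁, e₂, e₃]
  exact hw x m c a j i

/-- Associativity of the abstract multiplication. -/
theorem coeff_assoc (G : GreenData C r ε) (hcls : IsAdditiveOnSES cls)
    (hs : ∀ X, cls (e.functor.obj X) = s (cls X)) (hε : ∀ X Y, ε X Y = E (cls X) (cls Y))
    (hw : ∀ x m c a j i : Γ,
      w (m + i + s a) (a + x + j) a *
        w (x + j + (m + i)) (s.symm (j + i) + c) (s.symm (j + i)) * E i x =
      w (a + x + j) (s.symm (j + i) + c) (s.symm j) *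
        w (m + i + s a) (s.symm i + c + (a + x)) (s.symm i + a) * E x (s.symm i))
    (A₁ A₂ A₃ Y : C) :
    ∑ᶠ j, coeff e cls w A₁ A₂ (r j) * coeff e cls w (r j) A₃ Y =
      ∑ᶠ j, coeff e cls w A₂ A₃ (r j) * coeff e cls w A₁ (r j) Y := by
  rw [coeff_comp_eq_left G hcls hs, coeff_comp_eq_right G hcls hs]
  congr 1
  refine (finsum_sigma_real (α := e.inverse.obj A₁ ⟶ A₂)
      (β := fun f => cokernel f ⟶ e.functor.obj A₃)
      (fun p => ∑ᶠ γ : e.functor.obj (kernel p.1) ⟶ cokernel p.2,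
        w (cls A₁) (cls A₂) (cls A₂ - cls (cokernel p.1)) *
        w (cls (cokernel p.1) + cls (e.functor.obj (kernel p.1))) (cls A₃)
          (s.symm (cls (cokernel p.1) + cls (e.functor.obj (kernel p.1)) -
            (cls (kernel p.2) + cls (kernel γ)))) *
        ε (cokernel (kernel.ι γ)) (kernel p.2) *
        ∑ᶠ k, ses (kernel p.2) (r k) (kernel γ) *
          ses (e.inverse.obj (cokernel γ)) Y (r k) / aut (r k))).symm.trans
    (Eq.trans ?_ (finsum_sigma_real (α := A₂ ⟶ e.functor.obj A₃)
      (β := fun g => e.inverse.obj A₁ ⟶ kernel g)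
      (fun p => ∑ᶠ γ : kernel p.2 ⟶ e.inverse.obj (cokernel p.1),
        w (cls A₂) (cls A₃) (s.symm (cls A₂ - cls (kernel p.1))) *
        w (cls A₁) (cls (e.inverse.obj (cokernel p.1)) + cls (kernel p.1))
          (cls (e.inverse.obj (cokernel p.1)) + cls (kernel p.1) -
            (cls (cokernel γ) + cls (cokernel p.2))) *
        ε (cokernel p.2) (kernel (cokernel.π γ)) *
        ∑ᶠ k, ses (cokernel p.2) (r k) (e.functor.obj (kernel γ)) *
          ses (cokernel γ) Y (r k) / aut (r k))))
  -- A map out of `coker f` and a map into `ker g` encode the same datum, a pair with `f ≫ g = 0`,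
  -- so the two outer double sums have a common index set.
  rw [← finsum_comp_equiv (pairEquivCokernel _ _ _), ← finsum_comp_equiv (pairEquivKernel _ _ _)]
  refine finsum_congr fun p => ?_
  exact coeff_assoc_of_comp_eq_zero hcls hs hε hw A₁ A₂ A₃ Y p.1.1 p.1.2 p.2

end Product

/-! ### Short exact sequences and `Ext¹` -/

section ExtOne

open Abelian DerivedCategory Pretriangulated

variable {C : Type u} [Category.{v} C] [Abelian C]

/-- The embedding into the derived category is full and faithful, and the t-structure excludes
nonzero maps from degree 0 to `I[-1]` and from `D[1]` to degree 0. The long exact Hom sequences then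
give the universal properties. -/
lemma isSES_of_distTriang [HasDerivedCategory.{w} C] {D X I : C} {u : D ⟶ X} {π : X ⟶ I}
    {δ : (singleFunctor C 0).obj I ⟶ ((singleFunctor C 0).obj D)⟦(1 : ℤ)⟧}
    (h : Triangle.mk ((singleFunctor C 0).map u) ((singleFunctor C 0).map π) δ ∈
      distTriang (DerivedCategory C)) : IsSES u π := by
  have h0 : u ≫ π = 0 := (singleFunctor C 0).map_injective (by
    rw [Functor.map_comp, Functor.map_zero]
    exact comp_distTriang_mor_zero₁₂ _ h)
  refine ⟨⟨Preadditive.mono_of_cancel_zero _ fun {Z} x hx => ?_, h0, fun {Z} x hx => ?_⟩,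
    ⟨Preadditive.epi_of_cancel_zero _ fun {Z} x hx => ?_, h0, fun {Z} x hx => ?_⟩⟩
  · apply (singleFunctor C 0).map_injective
    have h' := inv_rot_of_distTriang _ h
    obtain ⟨y, hy⟩ := Triangle.coyoneda_exact₂ _ h' ((singleFunctor C 0).map x) (by
      change _ ≫ (singleFunctor C 0).map u = 0
      rw [← Functor.map_comp, hx, Functor.map_zero])
    have : (((singleFunctor C 0).obj I)⟦(-1 : ℤ)⟧).IsGE 1 :=
      TStructure.t.isGE_shift _ 0 (-1) 1
    have hy0 : y = 0 := TStructure.t.zero (Y := ((singleFunctor C 0).obj I)⟦(-1 : ℤ)⟧) y 0 1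
    rw [hy, hy0, Functor.map_zero]
    exact zero_comp
  · obtain ⟨y, hy⟩ := Triangle.coyoneda_exact₂ _ h ((singleFunctor C 0).map x) (by
      change _ ≫ (singleFunctor C 0).map π = 0
      rw [← Functor.map_comp, hx, Functor.map_zero])
    obtain ⟨y, rfl⟩ := (singleFunctor C 0).map_surjective y
    refine ⟨y, (singleFunctor C 0).map_injective ?_⟩
    rw [hy, Functor.map_comp]
    rfl
  · apply (singleFunctor C 0).map_injective
    obtain ⟨y, hy⟩ := Triangle.yoneda_exact₃ _ h ((singleFunctor C 0).map x) (by
      change (singleFunctor C 0).map π ≫ _ = 0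
      rw [← Functor.map_comp, hx, Functor.map_zero])
    have : (((singleFunctor C 0).obj D)⟦(1 : ℤ)⟧).IsLE (-1) :=
      TStructure.t.isLE_shift _ 0 1 (-1)
    have hy0 : y = 0 := TStructure.t.zero (X := ((singleFunctor C 0).obj D)⟦(1 : ℤ)⟧) y (-1) 0
    rw [hy, hy0, Functor.map_zero]
    exact comp_zero
  · obtain ⟨y, hy⟩ := Triangle.yoneda_exact₂ _ h ((singleFunctor C 0).map x) (by
      change (singleFunctor C 0).map u ≫ _ = 0
      rw [← Functor.map_comp, hx, Functor.map_zero])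
    obtain ⟨y, rfl⟩ := (singleFunctor C 0).map_surjective y
    refine ⟨y, (singleFunctor C 0).map_injective ?_⟩
    rw [hy, Functor.map_comp]
    rfl

variable [HasExt.{w} C]

/-- The class in `Ext¹(M, N)` of the short exact sequence `0 ⟶ N ⟶ X ⟶ M ⟶ 0`. -/
def IsSES.extClass {N X M : C} {i : N ⟶ X} {p : X ⟶ M} (h : IsSES i p) : Ext.{w} M N 1 :=
  h.shortExact.extClass

/-- A morphism of the outer terms extends to a morphism of short exact sequences if and only if
it is compatible with the classes. -/
lemma IsSES.exists_map_iff {D X I T F : C} {u : D ⟶ X} {π : X ⟶ I} (h : IsSES u π)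
    {m : T ⟶ F} {q : F ⟶ I} (h' : IsSES m q) (t : D ⟶ T) :
    (∃ v : X ⟶ F, u ≫ v = t ≫ m ∧ v ≫ q = π) ↔
      h.extClass.comp (Ext.mk₀ t) (add_zero 1) = h'.extClass.{w} := by
  constructor
  · rintro ⟨v, hv, hv'⟩
    have := ShortComplex.ShortExact.extClass_naturality.{w} h.shortExact h'.shortExact
      { τ₁ := t, τ₂ := v, τ₃ := 𝟙 I, comm₁₂ := hv.symm, comm₂₃ := by simpa using hv' }
    simpa [IsSES.extClass] using this
  · intro H
    let := HasDerivedCategory.standard C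
    -- Compatibility with the classes is commutation with the connecting maps; the middle component
    -- supplied by the triangulated structure comes from a morphism of objects by fullness.
    obtain ⟨b, hb, hb'⟩ := complete_distinguished_triangle_morphism₂ _ _
      h.shortExact.singleTriangle_distinguished h'.shortExact.singleTriangle_distinguished
      ((singleFunctor C 0).map t) (𝟙 _) (by
        have := congr_arg (fun e => Ext.hom e) H
        have e₁ := h.shortExact.extClass_hom
        have e₂ := h'.shortExact.extClass_hom
        simp only [Ext.comp_hom, Ext.mk₀_hom, IsSES.extClass] at this
        rw [ShiftedHom.comp_mk₀, e₁, e₂] at this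
        exact this.trans (Category.id_comp _).symm)
    obtain ⟨v, rfl⟩ := (singleFunctor C 0).map_surjective b
    refine ⟨v, (singleFunctor C 0).map_injective ?_, (singleFunctor C 0).map_injective ?_⟩
    · rw [Functor.map_comp, Functor.map_comp]
      exact hb
    · rw [Functor.map_comp]
      refine hb'.symm.trans (Category.comp_id _)

omit [HasExt.{w} C] in
lemma IsSES.isIso_of_comm {D X X' I : C} {u : D ⟶ X} {π : X ⟶ I} (h : IsSES u π) {u' : D ⟶ X'}
    {π' : X' ⟶ I} (h' : IsSES u' π') (e : X ⟶ X') (h₁ : u ≫ e = u') (h₂ : e ≫ π' = π) :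
    IsIso e := by
  let f : ShortComplex.mk u π h.isKer.zero ⟶ ShortComplex.mk u' π' h'.isKer.zero :=
    { τ₁ := 𝟙 D, τ₂ := e, τ₃ := 𝟙 I, comm₁₂ := by simpa using h₁.symm
      comm₂₃ := by simpa using h₂ }
  have : IsIso f.τ₁ := by dsimp [f]; infer_instance
  have : IsIso f.τ₃ := by dsimp [f]; infer_instance
  exact ShortComplex.isIso₂_of_shortExact_of_isIso₁₃ f h.shortExact h'.shortExact

/-- Every class in `Ext¹` is the class of a short exact sequence. -/
lemma exists_isSES_extClass_eq {I D : C} (ξ : Ext.{w} I D 1) :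
    ∃ (X : C) (u : D ⟶ X) (π : X ⟶ I) (h : IsSES u π), h.extClass = ξ := by
  let := HasDerivedCategory.standard C
  -- The class, as a morphism `I → D[1]`, is completed to a triangle; its middle object lies between
  -- degree-0 objects, so it is itself an object of `C`.
  obtain ⟨Z, f, g, hT⟩ := distinguished_cocone_triangle₂ (C := DerivedCategory C) ξ.hom
  have : Z.IsGE 0 := TStructure.t.isGE₂ _ hT 0
    (inferInstanceAs (((singleFunctor C 0).obj D).IsGE 0))
    (inferInstanceAs (((singleFunctor C 0).obj I).IsGE 0))
  have : Z.IsLE 0 := TStructure.t.isLE₂ _ hT 0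
    (inferInstanceAs (((singleFunctor C 0).obj D).IsLE 0))
    (inferInstanceAs (((singleFunctor C 0).obj I).IsLE 0))
  obtain ⟨X, ⟨e⟩⟩ := exists_iso_singleFunctor_obj_of_isGE_of_isLE Z 0
  obtain ⟨u, hu⟩ := (singleFunctor C 0).map_surjective (f ≫ e.hom)
  obtain ⟨π, hπ⟩ := (singleFunctor C 0).map_surjective (e.inv ≫ g)
  have hT' : Triangle.mk ((singleFunctor C 0).map u) ((singleFunctor C 0).map π) ξ.hom ∈
      distTriang (DerivedCategory C) := by
    refine isomorphic_distinguished _ hT _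
      (Triangle.isoMk _ _ (Iso.refl _) e.symm (Iso.refl _) ?_ ?_ ?_)
    · change (singleFunctor C 0).map u ≫ e.inv = 𝟙 _ ≫ f
      simp [hu]
    · change (singleFunctor C 0).map π ≫ 𝟙 _ = e.inv ≫ g
      simp [hπ]
    · change ξ.hom ≫ (𝟙 _)⟦(1 : ℤ)⟧' = 𝟙 _ ≫ ξ.hom
      simp
  have h := isSES_of_distTriang hT'
  refine ⟨X, u, π, h, Ext.ext ?_⟩
  -- The constructed triangle and the one of the short exact sequence share two maps. The comparison
  -- map on `I` is the identity because `π` is epi, so the connecting maps agree.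
  obtain ⟨c, hc, hc'⟩ := complete_distinguished_triangle_morphism _ _ hT'
    h.shortExact.singleTriangle_distinguished (𝟙 _) (𝟙 _) (by
      exact (Category.comp_id _).trans (Category.id_comp _).symm)
  obtain ⟨c, rfl⟩ := (singleFunctor C 0).map_surjective c
  have hc1 : c = 𝟙 I := by
    have := h.isCoker.epi
    rw [← cancel_epi π, Category.comp_id]
    apply (singleFunctor C 0).map_injective
    rw [Functor.map_comp]
    exact hc.trans (Category.id_comp _)
  rw [IsSES.extClass, ShortComplex.ShortExact.extClass_hom]
  subst hc1
  have h3 : ξ.hom ≫ (𝟙 ((singleFunctor C 0).obj D))⟦(1 : ℤ)⟧' =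
    (singleFunctor C 0).map (𝟙 I) ≫ h.shortExact.singleδ := hc'
  rw [CategoryTheory.Functor.map_id, CategoryTheory.Functor.map_id] at h3
  exact ((Category.id_comp _).symm.trans h3.symm).trans (Category.comp_id _)

/-- This is `IsSES.exists_map_iff` for the identity of `D`, together with the five lemma. -/
lemma IsSES.extClass_eq_iff {D X X' I : C} {u : D ⟶ X} {π : X ⟶ I} (h : IsSES u π) {u' : D ⟶ X'}
    {π' : X' ⟶ I} (h' : IsSES u' π') :
    h.extClass = h'.extClass.{w} ↔ ∃ e : X ≅ X', u ≫ e.hom = u' ∧ e.hom ≫ π' = π := by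
  have := h.exists_map_iff.{w} h' (𝟙 D)
  rw [Ext.comp_mk₀_id, Category.id_comp] at this
  rw [← this]
  constructor
  · rintro ⟨v, hv, hv'⟩
    have := h.isIso_of_comm h' v hv hv'
    exact ⟨asIso v, hv, hv'⟩
  · rintro ⟨e, he, he'⟩
    exact ⟨e.hom, he, he'⟩

omit [HasExt.{w} C] in
/-- The morphisms of short exact sequences with given outer components form a torsor. -/
lemma card_extension_maps {D X I T F : C} {u : D ⟶ X} {π : X ⟶ I} (h : IsCoker u π)
    {m : T ⟶ F} {Q : C} {q : F ⟶ Q} (h' : IsKer m q) (v₀ : X ⟶ F) :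
    Nat.card {v : X ⟶ F // u ≫ v = u ≫ v₀ ∧ v ≫ q = v₀ ≫ q} = Nat.card (I ⟶ T) := by
  have := h.epi
  have := h'.mono
  have h₁ (f : I ⟶ T) : u ≫ (v₀ + π ≫ f ≫ m) = u ≫ v₀ := by
    rw [Preadditive.comp_add, ← Category.assoc u, h.zero, zero_comp, add_zero]
  have h₂ (f : I ⟶ T) : (v₀ + π ≫ f ≫ m) ≫ q = v₀ ≫ q := by
    rw [Preadditive.add_comp, Category.assoc, Category.assoc, h'.zero, comp_zero, comp_zero,
      add_zero]
  refine (Nat.card_congr (Equiv.ofBijective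
    (fun f : I ⟶ T => ⟨v₀ + π ≫ f ≫ m, h₁ f, h₂ f⟩) ⟨?_, ?_⟩)).symm
  · intro f f' hf
    simpa [cancel_epi, cancel_mono] using congr_arg Subtype.val hf
  · rintro ⟨v, hv, hv'⟩
    obtain ⟨a, ha⟩ := h.desc (v - v₀) (by rw [Preadditive.comp_sub, hv, sub_self])
    obtain ⟨b, hb⟩ := h'.lift a (by
      rw [← cancel_epi π, ← Category.assoc, ha, Preadditive.sub_comp, hv', sub_self, comp_zero])
    exact ⟨b, Subtype.ext (by simp [hb, ha])⟩

end ExtOne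

/-! ### The Euler form -/

section Euler

open Abelian

lemma card_eq_of_exact {G H K : Type*} [AddCommGroup G] [AddCommGroup H] [AddCommGroup K]
    (f : G →+ H) (g : H →+ K) (hfg : ∀ x, g (f x) = 0) (h : ∀ y, g y = 0 → ∃ x, f x = y) :
    Nat.card H = Nat.card f.range * Nat.card g.range := by
  have hk : f.range = g.ker := by
    ext y
    exact ⟨fun ⟨x, hx⟩ => hx ▸ hfg x, fun hy => h y hy⟩
  rw [hk, ← Nat.card_congr (QuotientAddGroup.quotientKerEquivRange g).toEquiv, mul_comm]
  exact AddSubgroup.card_eq_card_quotient_mul_card_addSubgroup _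

lemma card_range_of_injective {G H : Type*} [AddCommGroup G] [AddCommGroup H] (f : G →+ H)
    (h : Function.Injective f) : Nat.card f.range = Nat.card G :=
  (Nat.card_congr (AddMonoidHom.ofInjective h).toEquiv).symm

lemma card_range_of_surjective {G H : Type*} [AddCommGroup G] [AddCommGroup H] (f : G →+ H)
    (h : Function.Surjective f) : Nat.card f.range = Nat.card H := by
  rw [AddMonoidHom.range_eq_top.2 h]
  exact Nat.card_congr AddSubgroup.topEquiv.toEquiv

variable {C : Type u} [Category.{v} C] [Abelian C] [HasExt.{w} C]

/-- The multiplicative Euler form of a pair of objects. -/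
def euler (X Y : C) : ℝ := (Nat.card (X ⟶ Y) : ℝ) / (Nat.card (Ext.{w} X Y 1) : ℝ)

lemma card_ext_zero (X Y : C) : Nat.card (Ext.{w} X Y 0) = Nat.card (X ⟶ Y) :=
  Nat.card_congr Ext.homEquiv₀

section

variable (hfin : IsFinitary.{w} C)
include hfin

lemma IsFinitary.card_ext_pos (X Y : C) : 0 < Nat.card (Ext.{w} X Y 1) :=
  have := hfin.finite_ext X Y
  Nat.card_pos

lemma IsFinitary.card_hom_pos (X Y : C) : 0 < Nat.card (X ⟶ Y) :=
  have := hfin.finite_hom X Y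
  Nat.card_pos

lemma IsFinitary.finiteHom : FiniteHom C := ⟨hfin.finite_hom⟩

lemma IsFinitary.euler_pos (X Y : C) : 0 < euler.{w} X Y :=
  div_pos (Nat.cast_pos.2 (hfin.card_hom_pos X Y)) (Nat.cast_pos.2 (hfin.card_ext_pos X Y))

end

/-- The map `ξ ↦ t_* ξ` on `Ext¹` for an epimorphism `t` in a hereditary category. -/
lemma postcomp_surjective (hher : IsHereditary.{w} C) {H D T : C} {k : H ⟶ D} {t : D ⟶ T}
    (h : IsSES k t) (I : C) :
    Function.Surjective ((Ext.mk₀ t).postcomp I (add_zero 1) : Ext.{w} I D 1 →+ Ext I T 1) := by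
  intro ξ
  have := hher I H 2 le_rfl
  obtain ⟨x, hx⟩ := Ext.covariant_sequence_exact₃ I h.shortExact ξ (n₁ := 2) rfl
    (Subsingleton.elim _ _)
  exact ⟨x, hx⟩

/-- The `rᵢ` are the orders of the successive images in a six-term exact sequence; they cancel in
the alternating product. -/
lemma euler_of_cards {a₁ a₂ a₃ b₁ b₂ b₃ : ℕ} {r₁ r₂ r₃ r₄ r₅ : ℕ} (h₁ : a₁ = r₁)
    (h₂ : a₂ = r₁ * r₂) (h₃ : a₃ = r₂ * r₃) (h₄ : b₁ = r₃ * r₄) (h₅ : b₂ = r₄ * r₅)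
    (h₆ : b₃ = r₅) (p : 0 < b₁) (p' : 0 < b₂) (p'' : 0 < b₃) :
    (a₂ : ℝ) / b₂ = (a₁ / b₁) * (a₃ / b₃) := by
  have q : (b₁ : ℝ) ≠ 0 := (Nat.cast_pos.2 p).ne'
  have q' : (b₂ : ℝ) ≠ 0 := (Nat.cast_pos.2 p').ne'
  have q'' : (b₃ : ℝ) ≠ 0 := (Nat.cast_pos.2 p'').ne'
  rw [div_mul_div_comm, div_eq_div_iff q' (mul_ne_zero q q'')]
  subst h₁ h₂ h₃ h₄ h₅ h₆
  push_cast
  ring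

/-- The long exact sequence ends after `Ext¹(I, M)` because `Ext²` vanishes, and orders multiply
along the six remaining terms. -/
lemma euler_mul_right (hfin : IsFinitary.{w} C) (hher : IsHereditary.{w} C) (I : C) {N X M : C}
    {i : N ⟶ X} {p : X ⟶ M} (h : IsSES i p) :
    euler.{w} I X = euler.{w} I N * euler.{w} I M := by
  have := h.isKer.mono
  have hs := h.shortExact
  unfold euler
  rw [← card_ext_zero.{w} I X, ← card_ext_zero.{w} I N, ← card_ext_zero.{w} I M]
  refine euler_of_cards
    (card_range_of_injective _ (Ext.postcomp_mk₀_injective_of_mono I i)).symm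
    (card_eq_of_exact ((Ext.mk₀ i).postcomp I (add_zero 0)) ((Ext.mk₀ p).postcomp I (add_zero 0))
      (fun x => ?_) fun y hy => Ext.covariant_sequence_exact₂ I hs y hy)
    (card_eq_of_exact _ (hs.extClass.postcomp I (zero_add 1))
      (fun x => ?_) fun y hy => Ext.covariant_sequence_exact₃ I hs y (zero_add 1) hy)
    (card_eq_of_exact _ ((Ext.mk₀ i).postcomp I (add_zero 1))
      (fun x => ?_) fun y hy => Ext.covariant_sequence_exact₁ I hs y hy (zero_add 1))
    (card_eq_of_exact _ ((Ext.mk₀ p).postcomp I (add_zero 1))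
      (fun x => ?_) fun y hy => Ext.covariant_sequence_exact₂ I hs y hy)
    (card_range_of_surjective _ (postcomp_surjective hher h I)).symm
    (hfin.card_ext_pos _ _) (hfin.card_ext_pos _ _) (hfin.card_ext_pos _ _)
  all_goals simp [h.isKer.zero]
  · exact (congr_arg (fun e => x.comp e (zero_add 1)) hs.comp_extClass).trans
      (Ext.comp_zero x _ _ _ _)
  · exact (congr_arg (fun e => x.comp e (zero_add 1)) hs.extClass_comp).trans
      (Ext.comp_zero x _ _ _ _)

lemma euler_mul_left (hfin : IsFinitary.{w} C) (hher : IsHereditary.{w} C) (I : C) {N X M : C}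
    {i : N ⟶ X} {p : X ⟶ M} (h : IsSES i p) :
    euler.{w} X I = euler.{w} M I * euler.{w} N I := by
  have := h.isCoker.epi
  have hs := h.shortExact
  have hsurj : Function.Surjective
      ((Ext.mk₀ i).precomp I (zero_add 1) : Ext.{w} X I 1 →+ Ext N I 1) := by
    intro ξ
    have := hher M I 2 le_rfl
    obtain ⟨x, hx⟩ := Ext.contravariant_sequence_exact₁ hs I ξ (n₁ := 2) rfl
      (Subsingleton.elim _ _)
    exact ⟨x, hx⟩
  unfold euler
  rw [← card_ext_zero.{w} X I, ← card_ext_zero.{w} N I, ← card_ext_zero.{w} M I]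
  refine euler_of_cards
    (card_range_of_injective _ (Ext.precomp_mk₀_injective_of_epi I p)).symm
    (card_eq_of_exact ((Ext.mk₀ p).precomp I (zero_add 0)) ((Ext.mk₀ i).precomp I (zero_add 0))
      (fun x => ?_) fun y hy => Ext.contravariant_sequence_exact₂ hs I y hy)
    (card_eq_of_exact _ (hs.extClass.precomp I (add_zero 1))
      (fun x => ?_) fun y hy => Ext.contravariant_sequence_exact₁ hs I y (add_zero 1) hy)
    (card_eq_of_exact _ ((Ext.mk₀ p).precomp I (zero_add 1))
      (fun x => ?_) fun y hy => Ext.contravariant_sequence_exact₃ hs I y hy (add_zero 1))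
    (card_eq_of_exact _ ((Ext.mk₀ i).precomp I (zero_add 1))
      (fun x => ?_) fun y hy => Ext.contravariant_sequence_exact₂ hs I y hy)
    (card_range_of_surjective _ hsurj).symm
    (hfin.card_ext_pos _ _) (hfin.card_ext_pos _ _) (hfin.card_ext_pos _ _)
  all_goals simp [h.isKer.zero]
  · exact hs.extClass_comp_assoc x
  · exact hs.comp_extClass_assoc x _

/-! ### Counting extensions -/

open Abelian in
/-- The short exact sequences with given outer terms, middle term and class. -/
abbrev SESOfClass {I D : C} (ξ : Ext.{w} I D 1) (X : C) : Type _ :=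
  {s : (D ⟶ X) × (X ⟶ I) // ∃ h : IsSES s.1 s.2, h.extClass = ξ}

/-- Riedtmann's formula. -/
lemma card_sesOfClass (hfin : IsFinitary.{w} C) {I D X : C} {u : D ⟶ X} {π : X ⟶ I}
    (h : IsSES u π) :
    (Nat.card (SESOfClass h.extClass.{w} X) : ℝ) / aut X = 1 / Nat.card (I ⟶ D) := by
  have := hfin.finiteHom
  -- The automorphisms carrying the given sequence to another of the same class are the morphisms of
  -- extensions with identity ends; they form a torsor under `Hom(I, D)`.
  have hF : ∀ s : SESOfClass h.extClass.{w} X,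
      Nat.card {e : X ≅ X // u ≫ e.hom = s.1.1 ∧ e.inv ≫ π = s.1.2} = Nat.card (I ⟶ D) := by
    rintro ⟨⟨u', π'⟩, h', hh⟩
    obtain ⟨e₀, he₀, he₀'⟩ := (h.extClass_eq_iff h').1 hh.symm
    dsimp only at he₀ he₀' ⊢
    rw [← card_extension_maps h.isCoker h'.isKer e₀.hom]
    refine Nat.card_congr (Equiv.ofBijective (fun e => ⟨e.1.hom, ?_, ?_⟩) ⟨?_, ?_⟩)
    · rw [e.2.1, he₀]
    · rw [he₀']
      exact e.1.inv_comp_eq.1 e.2.2 |>.symm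
    · intro e e' hee
      exact Subtype.ext (Iso.ext (congr_arg Subtype.val hee))
    · rintro ⟨v, hv, hv'⟩
      rw [he₀] at hv
      rw [he₀'] at hv'
      have := h.isIso_of_comm h' v hv hv'
      exact ⟨⟨asIso v, hv, by simp [← hv']⟩, rfl⟩
  -- `Aut X` maps to the sequences of this class with all fibres of the same size.
  have hcard : aut X = Nat.card (SESOfClass h.extClass.{w} X) * Nat.card (I ⟶ D) := by
    have hn : ∀ e : X ≅ X, IsSES (u ≫ e.hom) (e.inv ≫ π) := fun e => by
      simpa using h.iso_conj (Iso.refl D) e (Iso.refl I)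
    let φ : (X ≅ X) → SESOfClass h.extClass.{w} X := fun e =>
      ⟨(u ≫ e.hom, e.inv ≫ π), hn e, ((h.extClass_eq_iff (hn e)).2 ⟨e, rfl, by simp⟩).symm⟩
    unfold aut
    rw [← Nat.card_congr (Equiv.sigmaFiberEquiv φ), card_sigma_real]
    have h₁ : ∀ s, (Nat.card {e // φ e = s} : ℝ) = Nat.card (I ⟶ D) := fun s => by
      rw [← hF s]
      congr 1
      refine Nat.card_congr (Equiv.subtypeEquivRight fun e => ?_)
      rw [Subtype.ext_iff, Prod.ext_iff]
    simp only [h₁]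
    rw [finsum_const_card, mul_comm]
  have hI : (Nat.card (I ⟶ D) : ℝ) ≠ 0 := (Nat.cast_pos.2 (hfin.card_hom_pos I D)).ne'
  rw [div_eq_div_iff (aut_ne_zero X) hI, hcard, one_mul]

/-- The fillings of `θ = t ≫ m` are counted by the classes with image the class of `(m, q)`. -/
lemma fill_eq (hfin : IsFinitary.{w} C) {D T F I : C} {t : D ⟶ T} {m : T ⟶ F} {q : F ⟶ I}
    (h : IsSES m q) (X : C) :
    fill (t ≫ m) q X = ∑ᶠ ξ : {ξ : Abelian.Ext.{w} I D 1 //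
      ξ.comp (Abelian.Ext.mk₀ t) (add_zero 1) = h.extClass},
      (Nat.card (SESOfClass ξ.1 X) : ℝ) * Nat.card (I ⟶ T) := by
  have := hfin.finiteHom
  have := hfin.finite_ext I D
  have hF : ∀ (ξ : {ξ : Abelian.Ext.{w} I D 1 //
      ξ.comp (Abelian.Ext.mk₀ t) (add_zero 1) = h.extClass}) (s : SESOfClass ξ.1 X),
      Nat.card {v : X ⟶ F // s.1.1 ≫ v = t ≫ m ∧ v ≫ q = s.1.2} = Nat.card (I ⟶ T) := by
    rintro ⟨ξ, hξ⟩ ⟨⟨u, π⟩, h', hh⟩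
    obtain ⟨v₀, hv₀, hv₀'⟩ := (h'.exists_map_iff h t).2 (by rw [hh]; exact hξ)
    dsimp only
    rw [← card_extension_maps h'.isCoker h.isKer v₀, hv₀, hv₀']
  have hs : ∀ ξ : {ξ : Abelian.Ext.{w} I D 1 //
      ξ.comp (Abelian.Ext.mk₀ t) (add_zero 1) = h.extClass},
      (Nat.card (SESOfClass ξ.1 X) : ℝ) * Nat.card (I ⟶ T) =
      Nat.card (Σ s : SESOfClass ξ.1 X,
        {v : X ⟶ F // s.1.1 ≫ v = t ≫ m ∧ v ≫ q = s.1.2}) := fun ξ => by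
    rw [card_sigma_real]
    simp only [hF ξ]
    rw [finsum_const_card, mul_comm]
  simp only [hs]
  rw [← card_sigma_real]
  unfold fill
  congr 1
  -- A filling `(u, v)` determines the class of `(u, v ≫ q)`, which `t` sends to the class of `(m,
  -- q)` because `v` is a morphism of extensions.
  refine Nat.card_congr
    { toFun := fun s => ⟨⟨s.2.2.extClass, ?_⟩, ⟨(s.1.1, s.1.2 ≫ q), s.2.2, rfl⟩,
        ⟨s.1.2, s.2.1, rfl⟩⟩
      invFun := fun x => ⟨(x.2.1.1.1, x.2.2.1), x.2.2.2.1, ?_⟩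
      left_inv := fun s => rfl
      right_inv := ?_ }
  · exact (s.2.2.exists_map_iff h t).1 ⟨s.1.2, s.2.1, rfl⟩
  · rw [x.2.2.2.2]
    exact x.2.1.2.1
  · rintro ⟨⟨ξ, hξ⟩, ⟨⟨u, π⟩, h', hh⟩, ⟨v, hv, hv'⟩⟩
    dsimp only at hh hv hv'
    subst hh hv'
    rfl

/-- The object representing an isomorphism class. -/
def rep (j : IsoCls C) : C := Quotient.out j

omit [Abelian C] [HasExt.{w} C] in
lemma isoCls_rep (j : IsoCls C) : isoCls (rep j) = j := Quotient.out_eq j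

omit [Abelian C] [HasExt.{w} C] in
lemma nonempty_iso_rep (X : C) : Nonempty (X ≅ rep (isoCls X)) :=
  Quotient.exact (isoCls_rep (isoCls X)).symm

omit [Abelian C] [HasExt.{w} C] in
lemma isoCls_eq_iff {X Y : C} : isoCls X = isoCls Y ↔ Nonempty (X ≅ Y) :=
  ⟨fun h => Quotient.exact h, fun h => Quotient.sound h⟩

/-- The isomorphism class of the middle term of an extension. -/
lemma exists_middle {I D : C} (ξ : Abelian.Ext.{w} I D 1) :
    ∃ j : IsoCls C, Nonempty (SESOfClass ξ (rep j)) ∧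
      ∀ i : IsoCls C, Nonempty (SESOfClass ξ (rep i)) → i = j := by
  obtain ⟨X, u, π, h, hξ⟩ := exists_isSES_extClass_eq ξ
  obtain ⟨e⟩ := nonempty_iso_rep X
  have h' : IsSES (u ≫ e.hom) (e.inv ≫ π) := by
    simpa using h.iso_conj (Iso.refl D) e (Iso.refl I)
  refine ⟨isoCls X, ⟨⟨(u ≫ e.hom, e.inv ≫ π), h', ?_⟩⟩, ?_⟩
  · rw [← hξ]
    exact ((h.extClass_eq_iff h').2 ⟨e, rfl, by simp⟩).symm
  · rintro i ⟨⟨⟨u', π'⟩, h'', hi⟩⟩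
    obtain ⟨e', -⟩ := (h.extClass_eq_iff h'').1 (hξ.trans hi.symm)
    rw [← isoCls_rep i]
    exact isoCls_eq_iff.2 ⟨e'.symm⟩

/-- A class has exactly one middle term up to isomorphism, and Riedtmann's formula evaluates its
contribution. -/
lemma finsum_card_sesOfClass (hfin : IsFinitary.{w} C) {I D : C} (ξ : Abelian.Ext.{w} I D 1) :
    ∑ᶠ j : IsoCls C, (Nat.card (SESOfClass ξ (rep j)) : ℝ) / aut (rep j) =
      1 / Nat.card (I ⟶ D) := by
  obtain ⟨j, ⟨⟨⟨u, π⟩, h, rfl⟩⟩, hj⟩ := exists_middle ξ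
  rw [finsum_eq_single _ j fun i hi => ?_, card_sesOfClass hfin h]
  have : IsEmpty (SESOfClass h.extClass.{w} (rep i)) :=
    not_nonempty_iff.1 fun hne => hi (hj i hne)
  simp

/-- A finitary hereditary category satisfies the axioms for the abstract multiplication. -/
theorem greenData (hfin : IsFinitary.{w} C) (hher : IsHereditary.{w} C) :
    GreenData C rep (fun X Y => (euler.{w} X Y)⁻¹) where
  exists_iso X := ⟨_, nonempty_iso_rep X⟩
  eq_of_iso := by
    rintro i j h
    rw [← isoCls_rep i, ← isoCls_rep j]
    exact isoCls_eq_iff.2 h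
  finite_ext N M := by
    have := hfin.finite_ext M N
    choose f hf hf' using fun ξ : Abelian.Ext.{w} M N 1 => exists_middle ξ
    refine (Set.finite_range f).subset fun j hj => ?_
    obtain ⟨i, p, h⟩ := exists_isSES_of_ses_ne_zero hj
    exact ⟨h.extClass, (hf' h.extClass j ⟨⟨(i, p), h, rfl⟩⟩).symm⟩
  green := by
    intro H D F I k θ q hk hq
    have := hfin.finiteHom
    have := hfin.finite_ext I D
    have := hq.epi
    have := hk.mono
    -- With `T` the image of `θ`, fillings are governed by the classes in `Ext¹(I, D)` lifting the
    -- class of `T → F → I` along `t`.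
    obtain ⟨T, t, m, ht, hm, rfl⟩ : ∃ (T : C) (t : D ⟶ T) (m : T ⟶ F), Epi t ∧ Mono m ∧
        θ = t ≫ m := ⟨_, Abelian.factorThruImage θ, Abelian.image.ι θ, inferInstance, inferInstance,
          (Abelian.image.fac θ).symm⟩
    have h₁ : IsSES k t := (hk.of_comp_mono m).isSES ht
    have h₂ : IsSES m q := (hq.of_epi_comp t).isSES hm
    have hsurj := postcomp_surjective.{w} hher h₁ I
    set φ := ((Abelian.Ext.mk₀ t).postcomp I (add_zero 1) :
      Abelian.Ext.{w} I D 1 →+ Abelian.Ext I T 1) with hφ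
    -- The lifts are a coset of the kernel of the surjection `Ext¹(I, D) → Ext¹(I, T)`. Heredity
    -- gives the surjectivity.
    have hfib : (Nat.card {ξ : Abelian.Ext.{w} I D 1 //
        ξ.comp (Abelian.Ext.mk₀ t) (add_zero 1) = h₂.extClass} : ℝ) *
        Nat.card (Abelian.Ext.{w} I T 1) = Nat.card (Abelian.Ext.{w} I D 1) := by
      rw [← card_range_of_surjective φ hsurj, ← Nat.cast_mul, mul_comm]
      have h₃ := card_eq_of_exact φ.ker.subtype φ (fun x => x.2) fun y hy => ⟨⟨y, hy⟩, rfl⟩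
      rw [h₃, mul_comm, card_range_of_injective φ.ker.subtype Subtype.val_injective]
      congr 2
      obtain ⟨ξ₀, hξ₀⟩ := hsurj h₂.extClass
      refine Nat.card_congr
        { toFun := fun ξ => ⟨ξ.1 - ξ₀, ?_⟩
          invFun := fun ξ => ⟨ξ.1 + ξ₀, ?_⟩
          left_inv := fun ξ => by simp
          right_inv := fun ξ => by simp }
      · rw [AddMonoidHom.mem_ker, map_sub, hξ₀, sub_eq_zero]
        exact ξ.2
      · have h4 : φ (ξ.1 + ξ₀) = h₂.extClass := by
          rw [map_add, hξ₀, (AddMonoidHom.mem_ker).1 ξ.2, zero_add]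
        exact h4
    simp only [fill_eq hfin h₂]
    have hsum : ∀ j : IsoCls C, (∑ᶠ ξ : {ξ : Abelian.Ext.{w} I D 1 //
        ξ.comp (Abelian.Ext.mk₀ t) (add_zero 1) = h₂.extClass},
        (Nat.card (SESOfClass ξ.1 (rep j)) : ℝ) * Nat.card (I ⟶ T)) / aut (rep j) =
        ∑ᶠ ξ : {ξ : Abelian.Ext.{w} I D 1 //
          ξ.comp (Abelian.Ext.mk₀ t) (add_zero 1) = h₂.extClass},
        (Nat.card (SESOfClass ξ.1 (rep j)) : ℝ) / aut (rep j) * Nat.card (I ⟶ T) := fun j => by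
      rw [finsum_div_const]
      exact finsum_congr fun ξ => mul_div_right_comm _ _ _
    simp only [hsum]
    rw [← finsum_finsum_comm_left]
    · simp only [← finsum_mul, finsum_card_sesOfClass hfin]
      rw [finsum_const_card]
      -- The total is `|Ext¹(I,D)| |Hom(I,T)| / (|Ext¹(I,T)| |Hom(I,D)|) = ⟨I,T⟩ / ⟨I,D⟩ = 1 /
      -- ⟨I,H⟩`.
      have e₁ := euler_mul_right hfin hher I h₁
      have p₁ := hfin.euler_pos I T
      have p₂ := hfin.euler_pos I H
      have p₃ : (0 : ℝ) < Nat.card (I ⟶ D) := Nat.cast_pos.2 (hfin.card_hom_pos I D)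
      have p₄ : (0 : ℝ) < Nat.card (Abelian.Ext.{w} I D 1) := Nat.cast_pos.2 (hfin.card_ext_pos I D)
      have p₅ : (0 : ℝ) < Nat.card (Abelian.Ext.{w} I T 1) := Nat.cast_pos.2 (hfin.card_ext_pos I T)
      have e₂ : (euler.{w} I H)⁻¹ = euler.{w} I T / euler.{w} I D := by
        rw [e₁]
        field_simp
      rw [e₂, euler, euler]
      rw [← eq_div_iff p₅.ne'] at hfib
      rw [hfib]
      field_simp
    · intro ξ
      obtain ⟨j, -, hj⟩ := exists_middle ξ.1
      refine (Set.finite_singleton j).subset fun i hi => ?_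
      by_contra hij
      have : IsEmpty (SESOfClass ξ.1 (rep i)) := not_nonempty_iff.1 fun hne => hij (hj i hne)
      exact hi (by simp)

end Euler

/-! ### Products over the index set -/

section Products

/-- Factors with one element can be dropped, so the product formula persists for an infinite index
set, as needed for `ZMod 0`. -/
lemma card_pi_eq_finprod {ι : Type*} {α : ι → Type*} (h : {i | Nat.card (α i) ≠ 1}.Finite) :
    Nat.card (∀ i, α i) = ∏ᶠ i, Nat.card (α i) := by
  classical
  have := h.fintype
  have hu : ∀ i : {i // ¬ i ∈ {i | Nat.card (α i) ≠ 1}}, Nat.card (α i) = 1 :=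
    fun i => not_not.1 i.2
  have hU : ∀ i : {i // ¬ i ∈ {i | Nat.card (α i) ≠ 1}}, Nonempty (Unique (α i)) := fun i => by
    obtain ⟨h₁, h₂⟩ := Nat.card_eq_one_iff_unique.1 (hu i)
    exact ⟨⟨⟨Classical.choice h₂⟩, fun _ => Subsingleton.elim _ _⟩⟩
  have : ∀ i : {i // ¬ i ∈ {i | Nat.card (α i) ≠ 1}}, Unique (α i) :=
    fun i => Classical.choice (hU i)
  rw [Nat.card_congr (Equiv.piEquivPiSubtypeProd (· ∈ {i | Nat.card (α i) ≠ 1}) α),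
    Nat.card_prod, Nat.card_unique (α := ∀ i : {i // ¬ i ∈ {i | Nat.card (α i) ≠ 1}}, α i), mul_one,
    Nat.card_pi, ← finprod_eq_prod_of_fintype]
  exact (finprod_set_coe_eq_finprod_mem _).trans
    (finprod_mem_mulSupport (fun i => Nat.card (α i)))

lemma card_pi_eq_finprod_real {ι : Type*} {α : ι → Type*} (h : {i | Nat.card (α i) ≠ 1}.Finite) :
    (Nat.card (∀ i, α i) : ℝ) = ∏ᶠ i, (Nat.card (α i) : ℝ) := by
  rw [card_pi_eq_finprod h]
  exact MonoidHom.map_finprod (Nat.castRingHom ℝ : ℕ →* ℝ) h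

/-- Sums over finitely supported families of products are products of sums. -/
lemma finsum_finprod_eq {ι α : Type*} [Zero α] (F : ι → α → ℝ)
    (hfin : ∀ i, (Function.support (F i)).Finite)
    (h : {i | ¬ (F i 0 = 1 ∧ ∀ a, a ≠ 0 → F i a = 0)}.Finite) :
    ∑ᶠ f : ι →₀ α, ∏ᶠ i, F i (f i) = ∏ᶠ i, ∑ᶠ a, F i a := by
  classical
  set S : Finset ι := h.toFinset with hS
  have hS' : ∀ i, i ∉ S → F i 0 = 1 ∧ ∀ a, a ≠ 0 → F i a = 0 := fun i hi => by
    simpa [hS, not_not] using hi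
  have hr : ∀ i, i ∉ S → ∑ᶠ a, F i a = 1 := fun i hi => by
    rw [finsum_eq_single _ 0 (hS' i hi).2, (hS' i hi).1]
  rw [finprod_eq_prod_of_mulSupport_subset (s := S) _ fun i hi => by
    by_contra hi'
    exact hi (hr i hi')]
  have hms : ∀ f : ι →₀ α, Function.mulSupport (fun i => F i (f i)) ⊆ ↑(S ∪ f.support) := by
    intro f i hi
    by_contra hi'
    simp only [Finset.coe_union, Set.mem_union, Finset.mem_coe, not_or,
      Finsupp.mem_support_iff, not_not] at hi'
    refine hi ?_
    change F i (f i) = 1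
    rw [hi'.2, (hS' i hi'.1).1]
  have hz : ∀ f : ι →₀ α, (∃ i, F i (f i) = 0) → ∏ᶠ i, F i (f i) = 0 := by
    rintro f ⟨i, hi⟩
    rw [finprod_eq_prod_of_mulSupport_subset _ (hms f)]
    refine Finset.prod_eq_zero (i := i) (hms f ?_) hi
    change F i (f i) ≠ 1
    rw [hi]
    exact zero_ne_one
  have ht : ∀ i, ∑ᶠ a, F i a = ∑ a ∈ (hfin i).toFinset, F i a := fun i =>
    finsum_eq_sum _ (hfin i)
  simp only [ht]
  rw [Finset.prod_sum]
  have hinj : Set.InjOn (fun p : ∀ i ∈ S, α => Finsupp.onFinset S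
      (fun i => if hi : i ∈ S then p i hi else 0) (fun i hi => by
        by_contra hi'
        simp [hi'] at hi)) ↑(S.pi fun i => (hfin i).toFinset) := by
    intro p _ p' _ hpp
    funext i hi
    have := DFunLike.congr_fun hpp i
    simpa [hi] using this
  -- A family with nonzero product must vanish outside the finite exceptional set `S`, so it is an
  -- extension by zero of a family on `S`.
  rw [finsum_eq_sum_of_support_subset (s := (S.pi fun i => (hfin i).toFinset).image
    (fun p : ∀ i ∈ S, α => Finsupp.onFinset S
      (fun i => if hi : i ∈ S then p i hi else 0) (fun i hi => by
        by_contra hi'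
        simp [hi'] at hi))), Finset.sum_image hinj]
  · refine Finset.sum_congr rfl fun p _ => ?_
    rw [finprod_eq_prod_of_mulSupport_subset (s := S)]
    · rw [← Finset.prod_attach]
      refine Finset.prod_congr rfl fun i _ => ?_
      simp [i.2]
    · intro i hi
      by_contra hi'
      refine hi ?_
      have : i ∉ S := hi'
      simp only [Finsupp.onFinset_apply, this, dite_false]
      exact (hS' i this).1
  · intro f hf
    have hne : ∀ i, F i (f i) ≠ 0 := fun i hi => hf (hz f ⟨i, hi⟩)
    have hf0 : ∀ i, i ∉ S → f i = 0 := fun i hi => by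
      by_contra hfi
      exact hne i ((hS' i hi).2 _ hfi)
    rw [Finset.mem_coe, Finset.mem_image]
    refine ⟨fun i _ => f i, ?_, ?_⟩
    · rw [Finset.mem_pi]
      intro i _
      exact (hfin i).mem_toFinset.2 (hne i)
    · ext i
      by_cases hi : i ∈ S
      · simp [hi]
      · simp [hi, hf0 i hi]

end Products

/-! ### The category of graded objects -/

section Graded

variable (A : Type u) [Category.{v} A] [Abelian A] (t : ℕ)

/-- Families of objects indexed by `ZMod t` with finitely many nonzero members. -/
def finiteSupport : ObjectProperty (Discrete (ZMod t) ⥤ A) :=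
  fun F => {i : ZMod t | ¬ IsZero (F.obj ⟨i⟩)}.Finite

variable {A t}

lemma isZero_functor_obj {J : Type*} [Category* J] {F : J ⥤ A} (h : IsZero F) (j : J) :
    IsZero (F.obj j) := (Functor.isZero_iff F).1 h j

instance : (finiteSupport A t).ContainsZero where
  exists_zero := ⟨_, isZero_zero _, by
    refine Set.finite_empty.subset fun i hi => hi ?_
    exact isZero_functor_obj (isZero_zero _) _⟩

instance : (finiteSupport A t).IsClosedUnderSubobjects where
  prop_of_mono f hf hY := by
    refine hY.subset fun i hi hi' => hi ?_
    exact IsZero.of_mono (f.app ⟨i⟩) hi'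

instance : (finiteSupport A t).IsClosedUnderQuotients where
  prop_of_epi f hf hY := by
    refine hY.subset fun i hi hi' => hi ?_
    exact IsZero.of_epi (f.app ⟨i⟩) hi'

instance : (finiteSupport A t).IsClosedUnderFiniteProducts where
  isClosedUnderLimitsOfShape J _ := ⟨by
    rintro X ⟨p⟩
    refine (Set.finite_iUnion fun j => p.prop_diag_obj j).subset fun i hi => ?_
    by_contra hcon
    rw [Set.mem_iUnion] at hcon
    push Not at hcon
    refine hi ?_
    have hl := isLimitOfPreserves ((evaluation (Discrete (ZMod t)) A).obj ⟨i⟩) p.isLimit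
    rw [IsZero.iff_id_eq_zero]
    refine hl.hom_ext fun j => ?_
    exact (not_not.1 (hcon j)).eq_of_tgt _ _⟩

variable (A t) in
/-- The category of finitely supported graded objects. -/
abbrev Gr := (finiteSupport A t).FullSubcategory

namespace Gr

/-- The component of degree `i` of a graded object. -/
abbrev obj (X : Gr A t) (i : ZMod t) : A := X.1.obj ⟨i⟩

/-- The component of degree `i` of a morphism. -/
abbrev map {X Y : Gr A t} (f : X ⟶ Y) (i : ZMod t) : obj X i ⟶ obj Y i := f.hom.app ⟨i⟩

/-- The graded object with given components. -/
def mk (X : ZMod t → A) (h : {i | ¬ IsZero (X i)}.Finite) : Gr A t :=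
  ⟨Discrete.functor X, h⟩

/-- Morphisms of graded objects are families of morphisms. -/
def homEquiv (X Y : Gr A t) : (X ⟶ Y) ≃ ∀ i, obj X i ⟶ obj Y i where
  toFun f := map f
  invFun f := ObjectProperty.homMk (Discrete.natTrans fun ⟨i⟩ => f i)
  left_inv f := by ext; rfl
  right_inv f := rfl

/-- The morphism with given components. -/
def homMk {X Y : Gr A t} (f : ∀ i, obj X i ⟶ obj Y i) : X ⟶ Y := (homEquiv X Y).symm f

lemma hom_ext {X Y : Gr A t} {f g : X ⟶ Y} (h : ∀ i, map f i = map g i) : f = g :=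
  (homEquiv X Y).injective (funext h)

lemma map_comp {X Y Z : Gr A t} (f : X ⟶ Y) (g : Y ⟶ Z) (i : ZMod t) :
    map (f ≫ g) i = map f i ≫ map g i := rfl

lemma map_id (X : Gr A t) (i : ZMod t) : map (𝟙 X) i = 𝟙 _ := rfl

lemma map_zero {X Y : Gr A t} (i : ZMod t) : map (0 : X ⟶ Y) i = 0 := rfl

/-- An isomorphism from isomorphisms of the components. -/
def isoMk {X Y : Gr A t} (e : ∀ i, obj X i ≅ obj Y i) : X ≅ Y where
  hom := homMk fun i => (e i).hom
  inv := homMk fun i => (e i).inv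
  hom_inv_id := hom_ext fun i => (e i).hom_inv_id
  inv_hom_id := hom_ext fun i => (e i).inv_hom_id

/-- The components of an isomorphism. -/
def mapIso {X Y : Gr A t} (e : X ≅ Y) (i : ZMod t) : obj X i ≅ obj Y i where
  hom := map e.hom i
  inv := map e.inv i
  hom_inv_id := by rw [← map_comp, e.hom_inv_id, map_id]
  inv_hom_id := by rw [← map_comp, e.inv_hom_id, map_id]

/-- Isomorphisms of graded objects are families of isomorphisms. -/
def isoEquiv (X Y : Gr A t) : (X ≅ Y) ≃ ∀ i, obj X i ≅ obj Y i where
  toFun := mapIso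
  invFun := isoMk
  left_inv _ := rfl
  right_inv _ := rfl

lemma isKer_of_map {K X B : Gr A t} {k : K ⟶ X} {g : X ⟶ B}
    (h : ∀ i, IsKer (map k i) (map g i)) : IsKer k g where
  mono := ⟨fun a b hab => hom_ext fun i => by
    have := (h i).mono
    rw [← cancel_mono (map k i), ← map_comp, ← map_comp, hab]⟩
  zero := hom_ext fun i => (h i).zero
  lift x hx := by
    choose y hy using fun i => (h i).lift (map x i) (by rw [← map_comp, hx, map_zero])
    exact ⟨homMk y, hom_ext hy⟩

lemma isCoker_of_map {X Y Q : Gr A t} {f : X ⟶ Y} {q : Y ⟶ Q}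
    (h : ∀ i, IsCoker (map f i) (map q i)) : IsCoker f q where
  epi := ⟨fun a b hab => hom_ext fun i => by
    have := (h i).epi
    rw [← cancel_epi (map q i), ← map_comp, ← map_comp, hab]⟩
  zero := hom_ext fun i => (h i).zero
  desc x hx := by
    choose y hy using fun i => (h i).desc (map x i) (by rw [← map_comp, hx, map_zero])
    exact ⟨homMk y, hom_ext hy⟩

/-- The componentwise kernel is a kernel, and kernels are unique up to isomorphism. -/
lemma isKer_iff {K X B : Gr A t} {k : K ⟶ X} {g : X ⟶ B} :
    IsKer k g ↔ ∀ i, IsKer (map k i) (map g i) := by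
  refine ⟨fun h i => ?_, isKer_of_map⟩
  let K' : Gr A t := mk (fun i => kernel (map g i)) (X.2.subset fun i hi hi' => hi
    (IsZero.of_mono (kernel.ι (map g i)) hi'))
  let k' : K' ⟶ X := homMk fun i => kernel.ι (map g i)
  have h' : IsKer k' g := isKer_of_map fun i => isKer_kernel (map g i)
  obtain ⟨e, he⟩ := h.exists_iso h'
  have := (isKer_kernel (map g i)).iso_comp (mapIso e i)
  have he' : (mapIso e i).hom ≫ kernel.ι (map g i) = map k i := by
    rw [← he]
    rfl
  exact he' ▸ this

lemma isCoker_iff {X Y Q : Gr A t} {f : X ⟶ Y} {q : Y ⟶ Q} :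
    IsCoker f q ↔ ∀ i, IsCoker (map f i) (map q i) := by
  refine ⟨fun h i => ?_, isCoker_of_map⟩
  let Q' : Gr A t := mk (fun i => cokernel (map f i)) (Y.2.subset fun i hi hi' => hi
    (IsZero.of_epi (cokernel.π (map f i)) hi'))
  let q' : Y ⟶ Q' := homMk fun i => cokernel.π (map f i)
  have h' : IsCoker f q' := isCoker_of_map fun i => isCoker_cokernel (map f i)
  obtain ⟨e, he⟩ := h'.exists_iso h
  have := (isCoker_cokernel (map f i)).comp_iso (mapIso e i)
  have he' : cokernel.π (map f i) ≫ (mapIso e i).hom = map q i := by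
    rw [← he]
    rfl
  exact he' ▸ this

lemma isSES_iff {N X M : Gr A t} {k : N ⟶ X} {p : X ⟶ M} :
    IsSES k p ↔ ∀ i, IsSES (map k i) (map p i) :=
  ⟨fun h i => ⟨isKer_iff.1 h.isKer i, isCoker_iff.1 h.isCoker i⟩,
    fun h => ⟨isKer_iff.2 fun i => (h i).isKer, isCoker_iff.2 fun i => (h i).isCoker⟩⟩

end Gr

end Graded

/-! ### Finiteness of families, and counts for zero objects -/

section Cards

lemma finite_pi_of_card {ι : Type*} {α : ι → Type*} [∀ i, Finite (α i)]
    (h : {i | Nat.card (α i) ≠ 1}.Finite) : Finite (∀ i, α i) := by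
  classical
  have := h.fintype
  have hU : ∀ i : {i // ¬ i ∈ {i | Nat.card (α i) ≠ 1}}, Subsingleton (α i) := fun i =>
    (Nat.card_eq_one_iff_unique.1 (not_not.1 i.2)).1
  exact Finite.of_equiv _ (Equiv.piEquivPiSubtypeProd (· ∈ {i | Nat.card (α i) ≠ 1}) α).symm

/-- Outside finitely many indices the value 0 is forced, so the family is determined by its
restriction to a finite product of finite sets. -/
lemma finite_finsupp_of_forall_mem {ι α : Type*} [Zero α] {T : ι → Set α} (hT : ∀ i, (T i).Finite)
    (h : {i | ¬ T i ⊆ {0}}.Finite) : {f : ι →₀ α | ∀ i, f i ∈ T i}.Finite := by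
  have := h.to_subtype
  refine Set.Finite.of_finite_image (f := fun f (i : {i | ¬ T i ⊆ {0}}) => f i)
    ((Set.Finite.pi' fun i : {i | ¬ T i ⊆ {0}} => hT i).subset ?_) ?_
  · rintro _ ⟨f, hf, rfl⟩ i
    exact hf i
  · intro f hf g hg hfg
    ext i
    by_cases hi : T i ⊆ {0}
    · have h₁ : f i = 0 := hi (hf i)
      have h₂ : g i = 0 := hi (hg i)
      rw [h₁, h₂]
    · exact congr_fun hfg ⟨i, hi⟩

variable {A : Type u} [Category.{v} A] [Abelian A]

lemma isoCls_eq_zero_iff {X : A} : isoCls X = 0 ↔ IsZero X := by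
  constructor
  · intro h
    obtain ⟨e⟩ := isoCls_eq_iff.1 (h : isoCls X = isoCls _)
    exact (isZero_zero A).of_iso e
  · intro h
    exact isoCls_eq_iff.2 ⟨h.iso (isZero_zero A)⟩

lemma isZero_rep_zero : IsZero (rep (0 : IsoCls A)) :=
  isoCls_eq_zero_iff.1 (isoCls_rep 0)

lemma isZero_rep_iff {a : IsoCls A} : IsZero (rep a) ↔ a = 0 := by
  rw [← isoCls_eq_zero_iff, isoCls_rep]

lemma IsSES.isZero_iff {N X M : A} {i : N ⟶ X} {p : X ⟶ M} (h : IsSES i p) :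
    IsZero X ↔ IsZero N ∧ IsZero M := by
  have := h.isKer.mono
  have := h.isCoker.epi
  refine ⟨fun hX => ⟨IsZero.of_mono i hX, IsZero.of_epi p hX⟩, fun ⟨hN, hM⟩ => ?_⟩
  rw [IsZero.iff_id_eq_zero]
  obtain ⟨y, hy⟩ := h.isKer.lift (𝟙 X) (hM.eq_of_tgt _ _)
  rw [← hy, hN.eq_of_src i 0, comp_zero]

lemma isSES_of_isZero {N X M : A} (hN : IsZero N) (hX : IsZero X) (hM : IsZero M) (i : N ⟶ X)
    (p : X ⟶ M) : IsSES i p :=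
  ⟨⟨hN.mono _, hN.eq_of_src _ _, fun _ _ => ⟨0, hX.eq_of_tgt _ _⟩⟩,
    ⟨hM.epi _, hN.eq_of_src _ _, fun _ _ => ⟨0, hX.eq_of_src _ _⟩⟩⟩

lemma card_aut_of_isZero {X : A} (hX : IsZero X) : Nat.card (X ≅ X) = 1 :=
  Nat.card_eq_one_iff_unique.2 ⟨⟨fun _ _ => Iso.ext (hX.eq_of_src _ _)⟩, ⟨Iso.refl X⟩⟩

lemma card_hom_of_isZero {X : A} (hX : IsZero X) (Y : A) : Nat.card (X ⟶ Y) = 1 :=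
  Nat.card_eq_one_iff_unique.2 ⟨⟨fun _ _ => hX.eq_of_src _ _⟩, ⟨0⟩⟩

lemma card_ses_of_isZero {N X M : A} (hN : IsZero N) (hX : IsZero X) (hM : IsZero M) :
    Nat.card {s : (N ⟶ X) × (X ⟶ M) // IsSES s.1 s.2} = 1 :=
  Nat.card_eq_one_iff_unique.2 ⟨⟨fun _ _ => Subtype.ext (Prod.ext (hX.eq_of_tgt _ _)
    (hX.eq_of_src _ _))⟩, ⟨⟨(0, 0), isSES_of_isZero hN hX hM _ _⟩⟩⟩

lemma card_fill_of_isZero {D F I X : A} (hD : IsZero D) (hI : IsZero I)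
    (hX : IsZero X) (θ : D ⟶ F) (q : F ⟶ I) :
    Nat.card {s : (D ⟶ X) × (X ⟶ F) // s.1 ≫ s.2 = θ ∧ IsSES s.1 (s.2 ≫ q)} = 1 :=
  Nat.card_eq_one_iff_unique.2 ⟨⟨fun _ _ => Subtype.ext (Prod.ext (hX.eq_of_tgt _ _)
    (hX.eq_of_src _ _))⟩, ⟨⟨(0, 0), hD.eq_of_src _ _, isSES_of_isZero hD hX hI _ _⟩⟩⟩

end Cards

/-! ### Componentwise counts for graded objects -/

namespace Gr

variable {A : Type u} [Category.{v} A] [Abelian A] {t : ℕ}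

lemma finite_union (X Y : Gr A t) : {i | ¬ (IsZero (obj X i) ∧ IsZero (obj Y i))}.Finite :=
  (X.2.union Y.2).subset fun i hi => by
    by_contra h
    rw [Set.mem_union, not_or] at h
    exact hi ⟨not_not.1 h.1, not_not.1 h.2⟩

lemma finite_union₃ (X Y Z : Gr A t) :
    {i | ¬ (IsZero (obj X i) ∧ IsZero (obj Y i) ∧ IsZero (obj Z i))}.Finite :=
  (X.2.union (finite_union Y Z)).subset fun i hi => by
    by_contra h
    rw [Set.mem_union, not_or] at h
    exact hi ⟨not_not.1 h.1, not_not.1 h.2⟩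

instance [FiniteHom A] : FiniteHom (Gr A t) where
  finite X Y := by
    have : Finite (∀ i, obj X i ⟶ obj Y i) :=
      finite_pi_of_card (X.2.subset fun i hi hi' => hi (card_hom_of_isZero hi' _))
    exact Finite.of_equiv _ (homEquiv X Y).symm

lemma finite_card_aut (X : Gr A t) : {i | Nat.card (obj X i ≅ obj X i) ≠ 1}.Finite :=
  X.2.subset fun _ hi hi' => hi (card_aut_of_isZero hi')

lemma aut_eq (X : Gr A t) : aut X = ∏ᶠ i, aut (obj X i) := by
  unfold aut
  rw [Nat.card_congr (isoEquiv X X)]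
  exact card_pi_eq_finprod_real (finite_card_aut X)

lemma mulSupport_aut (X : Gr A t) : (Function.mulSupport fun i => aut (obj X i)).Finite :=
  (finite_card_aut X).subset fun i hi h => hi (by simp only [aut, h, Nat.cast_one])

lemma finite_card_ses (N X M : Gr A t) : {i | Nat.card {s : (obj N i ⟶ obj X i) ×
    (obj X i ⟶ obj M i) // IsSES s.1 s.2} ≠ 1}.Finite :=
  (finite_union₃ N X M).subset fun _ hi h => hi (card_ses_of_isZero h.1 h.2.1 h.2.2)

/-- Pairs of morphisms of graded objects as families of pairs. -/
def pairEquiv (X Y Z W : Gr A t) : (X ⟶ Y) × (Z ⟶ W) ≃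
    ∀ i, (obj X i ⟶ obj Y i) × (obj Z i ⟶ obj W i) where
  toFun p i := (map p.1 i, map p.2 i)
  invFun p := (homMk fun i => (p i).1, homMk fun i => (p i).2)
  left_inv _ := rfl
  right_inv _ := rfl

lemma ses_eq (N X M : Gr A t) : ses N X M = ∏ᶠ i, ses (obj N i) (obj X i) (obj M i) := by
  unfold ses
  rw [Nat.card_congr ((Equiv.subtypeEquiv (pairEquiv N X X M) (p := fun s => IsSES s.1 s.2)
    (q := fun s => ∀ i, IsSES (s i).1 (s i).2) fun s => isSES_iff).trans
    (Equiv.subtypePiEquivPi (p := fun i (s : (obj N i ⟶ obj X i) × (obj X i ⟶ obj M i)) =>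
      IsSES s.1 s.2)))]
  exact card_pi_eq_finprod_real (finite_card_ses N X M)

lemma mulSupport_ses (N X M : Gr A t) :
    (Function.mulSupport fun i => ses (obj N i) (obj X i) (obj M i)).Finite :=
  (finite_card_ses N X M).subset fun i hi h => hi (by simp only [ses, h, Nat.cast_one])

lemma finite_card_fill {D F I : Gr A t} (θ : D ⟶ F) (q : F ⟶ I) (X : Gr A t) :
    {i | Nat.card {s : (obj D i ⟶ obj X i) × (obj X i ⟶ obj F i) //
      s.1 ≫ s.2 = map θ i ∧ IsSES s.1 (s.2 ≫ map q i)} ≠ 1}.Finite :=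
  (finite_union₃ D I X).subset fun _ hi h => hi (card_fill_of_isZero h.1 h.2.1 h.2.2 _ _)

lemma fill_eq {D F I : Gr A t} (θ : D ⟶ F) (q : F ⟶ I) (X : Gr A t) :
    fill θ q X = ∏ᶠ i, fill (map θ i) (map q i) (obj X i) := by
  unfold fill
  rw [Nat.card_congr ((Equiv.subtypeEquiv (pairEquiv D X X F)
    (p := fun s => s.1 ≫ s.2 = θ ∧ IsSES s.1 (s.2 ≫ q))
    (q := fun s => ∀ i, (s i).1 ≫ (s i).2 = map θ i ∧ IsSES (s i).1 ((s i).2 ≫ map q i))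
    fun s => ?_).trans
    (Equiv.subtypePiEquivPi (p := fun i (s : (obj D i ⟶ obj X i) × (obj X i ⟶ obj F i)) =>
      s.1 ≫ s.2 = map θ i ∧ IsSES s.1 (s.2 ≫ map q i))))]
  · exact card_pi_eq_finprod_real (finite_card_fill θ q X)
  · rw [forall_and, isSES_iff]
    exact and_congr ⟨fun h i => by rw [← h]; rfl, fun h => hom_ext h⟩ Iff.rfl

lemma mulSupport_fill {D F I : Gr A t} (θ : D ⟶ F) (q : F ⟶ I) (X : Gr A t) :
    (Function.mulSupport fun i => fill (map θ i) (map q i) (obj X i)).Finite :=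
  (finite_card_fill θ q X).subset fun i hi h => hi (by simp only [fill, h, Nat.cast_one])

/-- The family of the isomorphism classes of the components. -/
def classes (X : Gr A t) : ZMod t →₀ IsoCls A :=
  Finsupp.ofSupportFinite (fun i => isoCls (obj X i))
    (X.2.subset fun _ hi hi' => hi (isoCls_eq_zero_iff.2 hi'))

/-- The object with components in given isomorphism classes. -/
def ofClasses (j : ZMod t →₀ IsoCls A) : Gr A t :=
  mk (fun i => rep (j i)) (j.hasFiniteSupport.subset fun _ hi hi' => hi (isZero_rep_iff.2 hi'))

lemma classes_ofClasses (j : ZMod t →₀ IsoCls A) : classes (ofClasses j) = j :=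
  Finsupp.ext fun i => isoCls_rep (j i)

lemma classes_eq_iff {X Y : Gr A t} : classes X = classes Y ↔ Nonempty (X ≅ Y) := by
  constructor
  · intro h
    have h' : ∀ i, Nonempty (obj X i ≅ obj Y i) := fun i =>
      isoCls_eq_iff.1 (DFunLike.congr_fun h i)
    exact ⟨isoMk fun i => (h' i).some⟩
  · rintro ⟨e⟩
    exact Finsupp.ext fun i => isoCls_eq_iff.2 ⟨mapIso e i⟩

variable [HasExt.{w} A]

/-- The multiplicative Euler form of graded objects. -/
def euler (X Y : Gr A t) : ℝ := ∏ᶠ i, HallPeriodic.euler.{w} (obj X i) (obj Y i)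

/-- The axioms for the abstract multiplication hold for graded objects. -/
theorem greenData (hfin : IsFinitary.{w} A) (hher : IsHereditary.{w} A) :
    GreenData (Gr A t) ofClasses (fun X Y => (euler.{w} X Y)⁻¹) where
  exists_iso X := ⟨classes X, classes_eq_iff.1 (classes_ofClasses _).symm⟩
  eq_of_iso h := by
    have := classes_eq_iff.2 h
    rwa [classes_ofClasses, classes_ofClasses] at this
  finite_ext N M := by
    have G := HallPeriodic.greenData hfin hher
    refine (finite_finsupp_of_forall_mem (T := fun i => {a | ses (obj N i) (rep a) (obj M i) ≠ 0})
      (fun i => G.finite_ext _ _) ((finite_union N M).subset fun i hi hi' => hi fun a ha => ?_)).subset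
      fun j hj i => ?_
    · obtain ⟨u, p, h⟩ := exists_isSES_of_ses_ne_zero ha
      exact isZero_rep_iff.1 (h.isZero_iff.2 hi')
    · obtain ⟨u, p, h⟩ := exists_isSES_of_ses_ne_zero hj
      have := hfin.finiteHom
      exact ses_ne_zero_of_isSES (isSES_iff.1 h i)
  green := by
    intro H D F I k θ q hk hq
    have := hfin.finiteHom
    have G := HallPeriodic.greenData hfin hher
    -- Fillings and automorphisms factor over the degrees, so the sum over families becomes the
    -- product of the sums in each degree, where the ungraded axiom applies.
    have h₁ : ∀ j : ZMod t →₀ IsoCls A, fill θ q (ofClasses j) / aut (ofClasses j) =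
        ∏ᶠ i, fill (map θ i) (map q i) (rep (j i)) / aut (rep (j i)) := fun j => by
      rw [fill_eq, aut_eq]
      exact (finprod_div_distrib (mulSupport_fill θ q (ofClasses j))
        (mulSupport_aut (ofClasses j))).symm
    simp only [h₁]
    rw [finsum_finprod_eq (fun i a => fill (map θ i) (map q i) (rep a) / aut (rep a))]
    · simp only [G.green (isKer_iff.1 hk _) (isCoker_iff.1 hq _)]
      exact finprod_inv_distrib _
    · intro i
      refine (G.finite_ext (obj D i) (obj I i)).subset fun a ha => ?_
      refine ses_ne_zero_of_fill_ne_zero (θ := map θ i) (q := map q i) fun h0 => ha ?_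
      change fill (map θ i) (map q i) (rep a) / aut (rep a) = 0
      rw [h0, zero_div]
    · refine (finite_union D I).subset fun i hi hi' => hi ⟨?_, fun a ha => ?_⟩
      · have h₁ := card_fill_of_isZero hi'.1 hi'.2 isZero_rep_zero (map θ i) (map q i)
        have h₂ := card_aut_of_isZero (isZero_rep_zero (A := A))
        simp only [fill, aut, h₁, h₂, Nat.cast_one, div_one]
      · by_contra h0
        have : fill (map θ i) (map q i) (rep a) ≠ 0 := fun h => h0 (by rw [h, zero_div])
        obtain ⟨u, p, h⟩ := exists_isSES_of_ses_ne_zero (ses_ne_zero_of_fill_ne_zero this)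
        exact ha (isZero_rep_iff.1 (h.isZero_iff.2 hi'))

end Gr

/-! ### The weights -/

section Weights

variable {Γ : Type*} [AddCommGroup Γ] (s : Γ ≃+ Γ) (b T : Γ →+ Γ →+ ℝ)

/-- The weight in the multiplication for bounded complexes. -/
def boundedWeight (x y a : Γ) : ℝ :=
  Real.exp (T y x - b (s (y - a)) (x - s a))

/-- The weight in the multiplication for complexes of odd period. -/
def periodicWeight (x y a : Γ) : ℝ :=
  Real.exp (T x y - b x a - b (s a) (y - a))

variable {s b T}

/-- On exponents this is an identity between bilinear expressions. The relation `h` moves every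
shift out of `T`, leaving terms in `T` and `b` that cancel. -/
lemma boundedWeight_cocycle (hb : ∀ x y, b (s x) (s y) = b x y) (hT : ∀ x y, T (s x) (s y) = T x y)
    (h : ∀ x y, T (s x) y + T x y = b (s (s x)) y) (x m c a j i : Γ) :
    boundedWeight s b T (m + i + s a) (a + x + j) a *
      boundedWeight s b T (x + j + (m + i)) (s.symm (j + i) + c) (s.symm (j + i)) *
        Real.exp (-b i x) =
    boundedWeight s b T (a + x + j) (s.symm (j + i) + c) (s.symm j) *
      boundedWeight s b T (m + i + s a) (s.symm i + c + (a + x)) (s.symm i + a) *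
        Real.exp (-b x (s.symm i)) := by
  -- Replacing `j` and `i` by shifted classes removes the inverse shift from the identity.
  obtain ⟨j, rfl⟩ := s.surjective j
  obtain ⟨i, rfl⟩ := s.surjective i
  have h₁ : ∀ x y, T (s x) y = b (s (s x)) y - T x y := fun x y => by rw [← h]; ring
  have h₂ : ∀ x y, T x (s y) = b (s x) y - T x y := fun x y => by
    have := h x (s y)
    rw [hT, hb] at this
    rw [← this]
    ring
  unfold boundedWeight
  rw [← Real.exp_add, ← Real.exp_add, ← Real.exp_add, ← Real.exp_add]
  congr 1
  simp only [map_add, map_sub, AddMonoidHom.add_apply, AddMonoidHom.sub_apply,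
    AddEquiv.symm_apply_apply, hb, h₁, h₂]
  ring

/-- The argument is the one for bounded complexes; the different Euler factors in the weight require
`b (s x) y` in place of `b (s (s x)) y` in the relation for `T`. -/
lemma periodicWeight_cocycle (hb : ∀ x y, b (s x) (s y) = b x y)
    (hT : ∀ x y, T (s x) (s y) = T x y) (h : ∀ x y, T (s x) y + T x y = b (s x) y)
    (x m c a j i : Γ) :
    periodicWeight s b T (m + i + s a) (a + x + j) a *
      periodicWeight s b T (x + j + (m + i)) (s.symm (j + i) + c) (s.symm (j + i)) *
        Real.exp (-b i x) =
    periodicWeight s b T (a + x + j) (s.symm (j + i) + c) (s.symm j) *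
      periodicWeight s b T (m + i + s a) (s.symm i + c + (a + x)) (s.symm i + a) *
        Real.exp (-b x (s.symm i)) := by
  obtain ⟨j, rfl⟩ := s.surjective j
  obtain ⟨i, rfl⟩ := s.surjective i
  have h₁ : ∀ x y, T (s x) y = b (s x) y - T x y := fun x y => by rw [← h]; ring
  have h₂ : ∀ x y, T x (s y) = b x y - T x y := fun x y => by
    have := h x (s y)
    rw [hT, hb] at this
    rw [← this]
    ring
  unfold periodicWeight
  rw [← Real.exp_add, ← Real.exp_add, ← Real.exp_add, ← Real.exp_add]
  congr 1
  simp only [map_add, map_sub, AddMonoidHom.add_apply,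
    AddEquiv.symm_apply_apply, hb, h₁, h₂]
  ring

end Weights

/-! ### The Grothendieck group -/

section GrothendieckGroup

variable (A : Type u) [Category.{v} A] [Abelian A]

/-- The relations in the Grothendieck group. -/
def sesRelations : AddSubgroup (FreeAbelianGroup (IsoCls A)) :=
  AddSubgroup.closure {x | ∃ (N X M : A) (i : N ⟶ X) (p : X ⟶ M), IsSES i p ∧
    x = .of (isoCls X) - (.of (isoCls N) + .of (isoCls M))}

/-- The Grothendieck group. -/
abbrev K₀ := FreeAbelianGroup (IsoCls A) ⧸ sesRelations A

variable {A}

/-- The class in the Grothendieck group. -/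
def k₀ (a : IsoCls A) : K₀ A := QuotientAddGroup.mk (.of a)

lemma k₀_additive : IsAdditiveOnSES fun X : A => k₀ (isoCls X) := by
  intro N X M i p h
  unfold k₀
  rw [← QuotientAddGroup.mk_add, QuotientAddGroup.eq, add_comm, ← sub_eq_add_neg, ← neg_mem_iff,
    neg_sub]
  exact AddSubgroup.subset_closure ⟨N, X, M, i, p, h, rfl⟩

/-- The homomorphism from the Grothendieck group given by an additive function. -/
def k₀Lift {B : Type*} [AddCommGroup B] (f : IsoCls A → B)
    (hf : IsAdditiveOnSES fun X : A => f (isoCls X)) : K₀ A →+ B :=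
  QuotientAddGroup.lift _ (FreeAbelianGroup.lift f) (by
    rw [sesRelations, AddSubgroup.closure_le]
    rintro _ ⟨N, X, M, i, p, h, rfl⟩
    rw [SetLike.mem_coe, AddMonoidHom.mem_ker, map_sub, map_add, FreeAbelianGroup.lift_apply_of,
      FreeAbelianGroup.lift_apply_of, FreeAbelianGroup.lift_apply_of, sub_eq_zero]
    exact hf h)

lemma k₀Lift_k₀ {B : Type*} [AddCommGroup B] (f : IsoCls A → B)
    (hf : IsAdditiveOnSES fun X : A => f (isoCls X)) (a : IsoCls A) :
    k₀Lift f hf (k₀ a) = f a :=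
  FreeAbelianGroup.lift_apply_of f a

lemma k₀_hom_ext {B : Type*} [AddCommGroup B] {f g : K₀ A →+ B} (h : ∀ a, f (k₀ a) = g (k₀ a)) :
    f = g :=
  QuotientAddGroup.addMonoidHom_ext _ (FreeAbelianGroup.lift_ext _ _ h)

variable [HasExt.{w} A] (hfin : IsFinitary.{w} A) (hher : IsHereditary.{w} A)

lemma eulerForm_isoCls (X Y : A) :
    eulerForm.{w} (isoCls X) (isoCls Y) = HallPeriodic.euler.{w} X Y := rfl

include hfin in
lemma IsFinitary.eulerForm_pos (a a' : IsoCls A) : 0 < eulerForm.{w} a a' := by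
  rw [← isoCls_rep a, ← isoCls_rep a']
  exact hfin.euler_pos _ _

include hfin hher in
lemma log_eulerForm_additive_right (a : IsoCls A) :
    IsAdditiveOnSES fun Y : A => Real.log (eulerForm.{w} a (isoCls Y)) := by
  intro N X M i p h
  rw [← isoCls_rep a]
  dsimp only
  rw [eulerForm_isoCls, eulerForm_isoCls, eulerForm_isoCls, euler_mul_right hfin hher _ h,
    Real.log_mul (hfin.euler_pos _ _).ne' (hfin.euler_pos _ _).ne']

include hfin hher in
lemma log_eulerForm_additive_left (a : IsoCls A) :
    IsAdditiveOnSES fun Y : A => Real.log (eulerForm.{w} (isoCls Y) a) := by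
  intro N X M i p h
  rw [← isoCls_rep a]
  dsimp only
  rw [eulerForm_isoCls, eulerForm_isoCls, eulerForm_isoCls, euler_mul_left hfin hher _ h,
    Real.log_mul (hfin.euler_pos _ _).ne' (hfin.euler_pos _ _).ne', add_comm]

/-- The logarithm of the Euler form as a homomorphism in the second argument. -/
def logEulerRight (a : IsoCls A) : K₀ A →+ ℝ :=
  k₀Lift (fun a' => Real.log (eulerForm.{w} a a')) (log_eulerForm_additive_right hfin hher a)

lemma logEulerRight_additive : IsAdditiveOnSES fun X : A =>
    logEulerRight hfin hher (isoCls X) := by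
  intro N X M i p h
  refine k₀_hom_ext fun a => ?_
  simp only [AddMonoidHom.add_apply, logEulerRight, k₀Lift_k₀]
  exact log_eulerForm_additive_left hfin hher a h

/-- The logarithm of the Euler form on the Grothendieck group. -/
def logEuler : K₀ A →+ K₀ A →+ ℝ :=
  k₀Lift (logEulerRight hfin hher) (logEulerRight_additive hfin hher)

lemma logEuler_k₀ (a a' : IsoCls A) :
    logEuler hfin hher (k₀ a) (k₀ a') = Real.log (eulerForm.{w} a a') := by
  rw [logEuler, k₀Lift_k₀, logEulerRight, k₀Lift_k₀]

end GrothendieckGroup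

/-! ### Bilinear forms on graded classes -/

section Forms

variable {K : Type*} [AddCommGroup K] {t : ℕ} (β : K →+ K →+ ℝ)

/-- The shift of graded classes. -/
def shiftClass : (ZMod t →₀ K) ≃+ (ZMod t →₀ K) := Finsupp.domCongr (Equiv.addRight (1 : ZMod t)).symm

lemma shiftClass_single (j : ZMod t) (a : K) :
    shiftClass (Finsupp.single j a) = Finsupp.single (j - 1) a :=
  (Finsupp.equivMapDomain_single (Equiv.addRight (1 : ZMod t)).symm j a).trans (by
    rw [Equiv.addRight_symm, Equiv.coe_addRight, sub_eq_add_neg])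

/-- The bilinear form `∑ c (j - i) β(xʲ, yⁱ)`. -/
def form (c : ZMod t → ℝ) : (ZMod t →₀ K) →+ (ZMod t →₀ K) →+ ℝ :=
  Finsupp.liftAddHom fun j => (Finsupp.liftAddHom fun i => c (j - i) • β.flip).flip

lemma form_single (c : ZMod t → ℝ) (j i : ZMod t) (a a' : K) :
    form β c (Finsupp.single j a) (Finsupp.single i a') = c (j - i) * β a a' := by
  simp [form]

lemma form_apply (c : ZMod t → ℝ) (x y : ZMod t →₀ K) :
    form β c x y = ∑ j ∈ x.support, ∑ i ∈ y.support, c (j - i) * β (x j) (y i) := by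
  conv_lhs => rw [← Finsupp.sum_single x, ← Finsupp.sum_single y]
  simp only [Finsupp.sum, map_sum, AddMonoidHom.finsetSum_apply, form_single]
  rw [Finset.sum_comm]

variable {β}

lemma bihom_ext {f g : (ZMod t →₀ K) →+ (ZMod t →₀ K) →+ ℝ}
    (h : ∀ j a i a', f (Finsupp.single j a) (Finsupp.single i a') =
      g (Finsupp.single j a) (Finsupp.single i a')) : f = g :=
  Finsupp.addHom_ext fun j a => Finsupp.addHom_ext fun i a' => h j a i a'

/-- Shifting one argument only translates the coefficient function, so the relations required of the
twist become functional equations for its coefficients. -/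
lemma form_shift_left (c : ZMod t → ℝ) (x y : ZMod t →₀ K) :
    form β c (shiftClass x) y = form β (fun k => c (k - 1)) x y := by
  have : (form β c).comp shiftClass.toAddMonoidHom = form β (fun k => c (k - 1)) := by
    refine bihom_ext fun j a i a' => ?_
    change form β c (shiftClass (Finsupp.single j a)) (Finsupp.single i a') = _
    rw [shiftClass_single, form_single, form_single, sub_right_comm]
  exact DFunLike.congr_fun (DFunLike.congr_fun this x) y

lemma form_shift_shift (c : ZMod t → ℝ) (x y : ZMod t →₀ K) :
    form β c (shiftClass x) (shiftClass y) = form β c x y := by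
  have : ((form β c).comp shiftClass.toAddMonoidHom).compr₂ (AddMonoidHom.id ℝ) =
      (form β c).compl₂ shiftClass.symm.toAddMonoidHom := by
    refine bihom_ext fun j a i a' => ?_
    change form β c (shiftClass (Finsupp.single j a)) (Finsupp.single i a') =
      form β c (Finsupp.single j a) (shiftClass.symm (Finsupp.single i a'))
    have h : shiftClass.symm (Finsupp.single i a') = Finsupp.single (i + 1) a' := by
      rw [AddEquiv.symm_apply_eq, shiftClass_single, add_sub_cancel_right]
    rw [shiftClass_single, form_single, h, form_single]
    congr 2
    ring
  refine (DFunLike.congr_fun (DFunLike.congr_fun this x) (shiftClass y)).trans ?_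
  change form β c x (shiftClass.symm (shiftClass y)) = _
  rw [AddEquiv.symm_apply_apply]

lemma form_add (c c' : ZMod t → ℝ) (x y : ZMod t →₀ K) :
    form β c x y + form β c' x y = form β (c + c') x y := by
  have : form β c + form β c' = form β (c + c') := by
    refine bihom_ext fun j a i a' => ?_
    simp only [AddMonoidHom.add_apply, form_single, Pi.add_apply]
    ring
  exact DFunLike.congr_fun (DFunLike.congr_fun this x) y

end Forms

/-! ### The coefficients of the twists, and exponentials of the forms -/

section FormProducts

lemma exp_finsum {α : Type*} (f : α → ℝ) (h : (Function.support f).Finite) :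
    Real.exp (∑ᶠ a, f a) = ∏ᶠ a, Real.exp (f a) := by
  rw [finsum_eq_sum _ h, Real.exp_sum, finprod_eq_prod_of_mulSupport_subset]
  intro a ha
  rw [Set.Finite.coe_toFinset]
  intro h0
  refine ha ?_
  change Real.exp (f a) = 1
  rw [h0, Real.exp_zero]

variable {K : Type*} [AddCommGroup K] {t : ℕ} (β : K →+ K →+ ℝ)

lemma form_eq_finsum (c : ZMod t → ℝ) (x y : ZMod t →₀ K) :
    form β c x y = ∑ᶠ i, ∑ᶠ k, c k * β (x (i + k)) (y i) := by
  have h₁ : ∀ i, ∑ᶠ k, c k * β (x (i + k)) (y i) = ∑ j ∈ x.support, c (j - i) * β (x j) (y i) := by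
    intro i
    rw [← finsum_eq_sum_of_support_subset (fun j => c (j - i) * β (x j) (y i))]
    · refine Eq.trans (finsum_congr fun k => ?_) (finsum_comp_equiv (Equiv.addLeft i))
      simp
    · intro j hj
      rw [Finset.mem_coe, Finsupp.mem_support_iff]
      intro h0
      exact hj (by simp [h0])
  simp only [h₁]
  rw [form_apply, Finset.sum_comm, finsum_eq_sum_of_support_subset]
  intro i hi
  rw [Finset.mem_coe, Finsupp.mem_support_iff]
  intro h0
  exact hi (by simp [h0])

lemma finite_support_form (c : ZMod t → ℝ) (x y : ZMod t →₀ K) :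
    (Function.support fun i => ∑ᶠ k, c k * β (x (i + k)) (y i)).Finite := by
  refine y.hasFiniteSupport.subset fun i hi h0 => hi ?_
  simp [h0]

/-- The coefficients of the untwisted form. -/
def deltaCoeff (t : ℕ) (k : ZMod t) : ℝ := if k = 0 then 1 else 0

lemma form_delta (x y : ZMod t →₀ K) : form β (deltaCoeff t) x y = ∑ᶠ i, β (x i) (y i) := by
  rw [form_eq_finsum]
  refine finsum_congr fun i => ?_
  rw [finsum_eq_single _ 0 fun k hk => by simp [deltaCoeff, hk]]
  simp [deltaCoeff]

lemma finite_support_form_delta (x y : ZMod t →₀ K) :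
    (Function.support fun i => β (x i) (y i)).Finite := by
  refine y.hasFiniteSupport.subset fun i hi h0 => hi ?_
  simp [h0]

/-- The coefficients of the twist for bounded complexes, as a function of an integer. -/
def intCoeff (k : ℤ) : ℝ := if 2 ≤ k then (-1) ^ k else 0

/-- The coefficients of the twist for bounded complexes. -/
def boundedCoeff : ZMod 0 → ℝ := intCoeff

/-- Consecutive terms of the alternating sequence cancel, except at `k = 2`, where it starts. -/
lemma boundedCoeff_relation (k : ZMod 0) :
    boundedCoeff (k - 1) + boundedCoeff k = deltaCoeff 0 (k - 1 - 1) := by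
  change ℤ at k
  change (if (2 : ℤ) ≤ k - 1 then (-1 : ℝ) ^ (k - 1 : ℤ) else 0) +
    (if (2 : ℤ) ≤ k then (-1) ^ (k : ℤ) else 0) = if (k - 1 - 1 : ℤ) = 0 then 1 else 0
  have h : (-1 : ℝ) ^ (k - 1 : ℤ) = - (-1) ^ k := by
    rw [zpow_sub₀ (by norm_num), zpow_one]
    ring
  rcases lt_trichotomy k 2 with hk | hk | hk
  · rw [if_neg (by omega), if_neg (by omega), if_neg (by omega), add_zero]
  · subst hk
    norm_num
  · rw [if_pos (by omega), if_pos (by omega), if_neg (by omega), h, neg_add_cancel]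

/-- The coefficients of the twist for complexes of odd period. -/
def periodicCoeff (t : ℕ) (k : ZMod t) : ℝ :=
  if k = 0 then 1 / 2 else (1 / 2) * (-1) ^ (k.val + 1)

/-- Consecutive coefficients cancel except at `k = 1`, where both are `1/2`. Going around the cycle,
the last coefficient `(-1)^t / 2` has to cancel the `1/2` at 0, which uses that `t` is odd. -/
lemma periodicCoeff_relation (ht : Odd t) (k : ZMod t) :
    periodicCoeff t (k - 1) + periodicCoeff t k = deltaCoeff t (k - 1) := by
  have : NeZero t := ⟨by rintro rfl; simp at ht⟩
  unfold periodicCoeff deltaCoeff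
  by_cases h1 : k - 1 = 0
  · rw [if_pos h1, if_pos h1]
    -- For `t = 1` the residues 0 and 1 coincide, and the single coefficient `1/2` is added to
    -- itself.
    by_cases h0 : k = 0
    · rw [if_pos h0]
      norm_num
    · have hk : k = 1 := sub_eq_zero.1 h1
      subst hk
      have : Fact (1 < t) := ⟨by
        by_contra h
        have ht1 : t = 1 := by
          have := NeZero.pos t
          omega
        subst ht1
        exact h0 (Subsingleton.elim _ _)⟩
      rw [if_neg h0, ZMod.val_one]
      norm_num
  · rw [if_neg h1, if_neg h1]
    by_cases h0 : k = 0
    · subst h0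
      -- This is the wrap-around: the residue `-1` is represented by `t - 1`, so its sign is
      -- `(-1)^t`.
      have hv : ((0 : ZMod t) - 1).val + 1 = t := by
        have : (0 : ZMod t) - 1 ≠ 0 := h1
        have h2 : Fact (1 < t) := ⟨by
          by_contra h
          have ht1 : t = 1 := by
            have := NeZero.pos t
            omega
          subst ht1
          exact h1 (Subsingleton.elim _ _)⟩
        rw [zero_sub, ZMod.neg_val, if_neg (by
          intro h; apply h1; rw [zero_sub, h, neg_zero]), ZMod.val_one]
        have := h2.out
        omega
      rw [if_pos rfl, hv, ht.neg_one_pow]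
      norm_num
    · rw [if_neg h0]
      have hv : k.val = (k - 1).val + 1 := by
        have h2 : Fact (1 < t) := ⟨by
          by_contra h
          have ht1 : t = 1 := by
            have := NeZero.pos t
            omega
          subst ht1
          exact h1 (Subsingleton.elim _ _)⟩
        have h3 := ZMod.val_sub (a := k) (b := 1) (by
          rw [ZMod.val_one]
          exact Nat.pos_of_ne_zero fun h => h0 ((ZMod.val_eq_zero k).1 h))
        rw [h3, ZMod.val_one]
        have : 0 < k.val := Nat.pos_of_ne_zero fun h => h0 ((ZMod.val_eq_zero k).1 h)
        omega
      rw [hv]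
      ring

lemma finsum_boundedCoeff (L : ZMod 0 → ℝ) :
    ∑ᶠ k, boundedCoeff k * L k = ∑ᶠ (k : ℕ) (_ : 2 ≤ k), (-1 : ℝ) ^ k * L k := by
  have h₁ : ∑ᶠ k, boundedCoeff k * L k =
      ∑ᶠ k ∈ Set.range (fun n : ℕ => (n : ZMod 0)), boundedCoeff k * L k := by
    rw [← finsum_mem_univ]
    refine finsum_mem_inter_support_eq _ _ _ ?_
    ext k
    refine and_congr_left fun hk => ⟨fun _ => ?_, fun _ => Set.mem_univ _⟩
    have hk2 : (2 : ℤ) ≤ k := by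
      by_contra h
      exact hk (by simp [boundedCoeff, intCoeff, h])
    refine ⟨Int.toNat k, ?_⟩
    exact Int.toNat_of_nonneg (by omega)
  rw [h₁, finsum_mem_range (fun a b h => by exact_mod_cast (h : (a : ℤ) = b))]
  refine finsum_congr fun n => ?_
  by_cases hn : 2 ≤ n
  · have h2 : boundedCoeff (n : ZMod 0) = (-1) ^ n := by
      change (if (2 : ℤ) ≤ (n : ℤ) then (-1 : ℝ) ^ (n : ℤ) else 0) = _
      rw [if_pos (by exact_mod_cast hn), zpow_natCast]
    rw [finsum_eq_if, if_pos hn, h2]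
  · have h2 : boundedCoeff (n : ZMod 0) = 0 := by
      change (if (2 : ℤ) ≤ (n : ℤ) then (-1 : ℝ) ^ (n : ℤ) else 0) = _
      rw [if_neg (by exact_mod_cast hn)]
    rw [finsum_eq_if, if_neg hn, h2, zero_mul]

lemma finsum_periodicCoeff [NeZero t] (L : ZMod t → ℝ) :
    ∑ᶠ k, periodicCoeff t k * L k =
      (1 / 2) * (L 0 + ∑ k ∈ Finset.Icc 1 (t - 1), (-1 : ℝ) ^ (k + 1) * L (k : ZMod t)) := by
  rw [finsum_eq_sum_of_fintype, ← Finset.add_sum_erase _ _ (Finset.mem_univ (0 : ZMod t)), mul_add,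
    Finset.mul_sum]
  congr 1
  · simp [periodicCoeff]
  · refine Finset.sum_nbij' (fun k => k.val) (fun n => (n : ZMod t)) ?_ ?_ ?_ ?_ ?_
    · intro k hk
      have h0 : k ≠ 0 := (Finset.mem_erase.1 hk).1
      have h1 := ZMod.val_lt k
      have h2 : k.val ≠ 0 := fun h => h0 ((ZMod.val_eq_zero k).1 h)
      rw [Finset.mem_Icc]
      omega
    · intro n hn
      rw [Finset.mem_Icc] at hn
      have := NeZero.pos t
      refine Finset.mem_erase.2 ⟨fun h => ?_, Finset.mem_univ _⟩
      have h1 := ZMod.val_cast_of_lt (a := n) (n := t) (by omega)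
      rw [h, ZMod.val_zero] at h1
      omega
    · intro k _
      exact ZMod.natCast_zmod_val k
    · intro n hn
      rw [Finset.mem_Icc] at hn
      have := NeZero.pos t
      exact ZMod.val_cast_of_lt (by omega)
    · intro k hk
      have h0 : k ≠ 0 := (Finset.mem_erase.1 hk).1
      rw [periodicCoeff, if_neg h0, ZMod.natCast_zmod_val]
      ring

end FormProducts

/-! ### Hall numbers in terms of short exact sequences -/

section HallNumbers

variable {A : Type u} [Category.{v} A] [Abelian A]

lemma autCard_isoCls (X : A) : (autCard (isoCls X) : ℝ) = aut X := rfl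

lemma autCard_eq (a : IsoCls A) : (autCard a : ℝ) = aut (rep a) := by
  rw [← autCard_isoCls, isoCls_rep]

lemma isSES_of_subobject {N X M : A} (S : Subobject X) (a : N ≅ (S : A))
    (b : cokernel S.arrow ≅ M) : IsSES (a.hom ≫ S.arrow) (cokernel.π S.arrow ≫ b.hom) :=
  (((isCoker_cokernel S.arrow).isSES inferInstance).isKer.iso_comp a |>.isSES
    inferInstance).isCoker.comp_iso b |>.isSES inferInstance

/-- Short exact sequences in terms of subobjects. -/
def sesEquiv (N X M : A) : {s : (N ⟶ X) × (X ⟶ M) // IsSES s.1 s.2} ≃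
    Σ S : {S : Subobject X // isoCls (S : A) = isoCls N ∧ isoCls (cokernel S.arrow) = isoCls M},
      (N ≅ (S.1 : A)) × (cokernel S.1.arrow ≅ M) := by
  refine (Equiv.ofBijective (fun p : Σ S : {S : Subobject X // isoCls (S : A) = isoCls N ∧
      isoCls (cokernel S.arrow) = isoCls M}, (N ≅ (S.1 : A)) × (cokernel S.1.arrow ≅ M) =>
    (⟨(p.2.1.hom ≫ p.1.1.arrow, cokernel.π p.1.1.arrow ≫ p.2.2.hom),
      isSES_of_subobject p.1.1 p.2.1 p.2.2⟩ : {s : (N ⟶ X) × (X ⟶ M) // IsSES s.1 s.2}))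
      ⟨?_, ?_⟩).symm
  · rintro ⟨⟨S, hS⟩, a, b⟩ ⟨⟨S', hS'⟩, a', b'⟩ h
    have h₁ : a.hom ≫ S.arrow = a'.hom ≫ S'.arrow := congr_arg (fun s => s.1.1) h
    have h₂ : cokernel.π S.arrow ≫ b.hom = cokernel.π S'.arrow ≫ b'.hom :=
      congr_arg (fun s => s.1.2) h
    obtain rfl : S = S' := Subobject.eq_of_comm (a.symm ≪≫ a') (by simp [← h₁])
    obtain rfl : a = a' := Iso.ext ((cancel_mono S.arrow).1 h₁)
    obtain rfl : b = b' := Iso.ext ((cancel_epi (cokernel.π S.arrow)).1 h₂)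
    rfl
  · rintro ⟨⟨i, p⟩, h⟩
    dsimp only at h
    have := h.isKer.mono
    let S := Subobject.mk i
    let a : N ≅ (S : A) := (Subobject.underlyingIso i).symm
    have ha : a.hom ≫ S.arrow = i := Subobject.underlyingIso_arrow i
    have hc : IsCoker S.arrow p := IsCoker.of_epi_comp a.hom (by rw [ha]; exact h.isCoker)
    obtain ⟨b, hb⟩ := (isCoker_cokernel S.arrow).exists_iso hc
    exact ⟨⟨⟨S, isoCls_eq_iff.2 ⟨a.symm⟩, isoCls_eq_iff.2 ⟨b⟩⟩, a, b⟩,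
      Subtype.ext (Prod.ext ha hb)⟩

/-- Each subobject of the right type underlies `|Aut M| · |Aut N|` short exact sequences, one for
each choice of identifications of the subobject with `N` and of the quotient with `M`. -/
lemma hallNumber_mul [FiniteHom A] (N X M : A) :
    (hallNumber (isoCls M) (isoCls N) (isoCls X) : ℝ) * (aut M * aut N) = ses N X M := by
  unfold ses
  have e := sesEquiv N X M
  have hfinite : Finite {S : Subobject X // isoCls (S : A) = isoCls N ∧
      isoCls (cokernel S.arrow) = isoCls M} := by
    refine Finite.of_surjective (fun s : {s : (N ⟶ X) × (X ⟶ M) // IsSES s.1 s.2} => (e s).1)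
      fun S => ?_
    obtain ⟨a⟩ := isoCls_eq_iff.1 S.2.1
    obtain ⟨b⟩ := isoCls_eq_iff.1 S.2.2
    exact ⟨e.symm ⟨S, a.symm, b⟩, by simp⟩
  rw [Nat.card_congr e, card_sigma_real]
  have h : ∀ S : {S : Subobject X // isoCls (S : A) = isoCls N ∧
      isoCls (cokernel S.arrow) = isoCls M},
      (Nat.card ((N ≅ (S.1 : A)) × (cokernel S.1.arrow ≅ M)) : ℝ) = aut M * aut N := fun S => by
    obtain ⟨a⟩ := isoCls_eq_iff.1 S.2.1
    obtain ⟨b⟩ := isoCls_eq_iff.1 S.2.2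
    rw [Nat.card_prod, Nat.cast_mul, card_iso_of_iso a.symm, card_iso_of_iso b, aut_congr b,
      mul_comm]
  simp only [h]
  rw [finsum_const_card]
  rfl

lemma hallNumber_eq [FiniteHom A] (x y l : IsoCls A) :
    (hallNumber x y l : ℝ) = ses (rep y) (rep l) (rep x) / (aut (rep x) * aut (rep y)) := by
  rw [eq_div_iff (mul_ne_zero (aut_ne_zero _) (aut_ne_zero _)), ← hallNumber_mul, isoCls_rep,
    isoCls_rep, isoCls_rep]

end HallNumbers

/-! ### Counting morphisms by kernel, image and cokernel -/

section KernelImageCokernel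

variable {C : Type u} [Category.{v} C] [Abelian C] [FiniteHom C] {J : Type*} {r : J → C}
  {cl : C → J} (hcl : ∀ X Y, cl X = cl Y ↔ Nonempty (X ≅ Y)) (hr : ∀ j, cl (r j) = j)

/-- The classes of the kernel, the image and the cokernel of a morphism. -/
def kernelImageCokernel (cl : C → J) {X Y : C} (f : X ⟶ Y) : J × J × J :=
  (cl (kernel f), cl (Abelian.image f), cl (cokernel f))

/-- The epi-mono factorizations of `f` through `I`. -/
lemma card_factorizations {X Y I : C} (f : X ⟶ Y) (e : I ≅ Abelian.image f) :
    (Nat.card {p : (X ⟶ I) × (I ⟶ Y) // Epi p.1 ∧ Mono p.2 ∧ p.1 ≫ p.2 = f} : ℝ) = aut I := by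
  rw [← card_iso_of_iso e]
  congr 1
  refine (Nat.card_congr (Equiv.ofBijective (fun a => ⟨(Abelian.factorThruImage f ≫ a.inv,
    a.hom ≫ Abelian.image.ι f), inferInstance, inferInstance, by simp⟩) ⟨?_, ?_⟩)).symm
  · intro a a' h
    refine Iso.ext ((cancel_mono (Abelian.image.ι f)).1 ?_)
    exact congr_arg (fun p => p.1.2) h
  · rintro ⟨⟨p, j⟩, hp, hj, h⟩
    dsimp only at hp hj h
    have h₁ : IsSES j (cokernel.π f) := (IsCoker.of_epi_comp p (by
      rw [h]; exact isCoker_cokernel f)).isSES hj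
    obtain ⟨a, ha⟩ := h₁.isKer.exists_iso (isKer_kernel (cokernel.π f))
    refine ⟨a, Subtype.ext (Prod.ext ?_ ha)⟩
    change Abelian.factorThruImage f ≫ a.inv = p
    rw [Iso.comp_inv_eq, ← cancel_mono (Abelian.image.ι f), Category.assoc, Abelian.image.fac]
    exact h.symm.trans (by rw [← ha])

lemma card_isCoker {X Y Q Q' : C} {f : X ⟶ Y} {q : Y ⟶ Q} (h : IsCoker f q) (e : Q ≅ Q') :
    (Nat.card {q' : Y ⟶ Q' // IsCoker f q'} : ℝ) = aut Q' := by
  rw [← aut_op, ← card_isKer h.op e.op]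
  congr 1
  exact Nat.card_congr ((opEquiv (Opposite.op Q') (Opposite.op Y)).symm.subtypeEquiv
    fun q' => ⟨fun h => h.op, fun h => h.unop⟩)

lemma isSES_of_epi_mono_fac {X Y I : C} {f : X ⟶ Y} {p : X ⟶ I} {j : I ⟶ Y} (hp : Epi p)
    (hj : Mono j) (h : p ≫ j = f) {K : C} {k : K ⟶ X} (hk : IsKer k f) : IsSES k p :=
  (IsKer.of_comp_mono j (by rw [h]; exact hk)).isSES hp

lemma isSES_of_epi_mono_fac' {X Y I : C} {f : X ⟶ Y} {p : X ⟶ I} {j : I ⟶ Y} (hp : Epi p)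
    (hj : Mono j) (h : p ≫ j = f) {Q : C} {q : Y ⟶ Q} (hq : IsCoker f q) : IsSES j q :=
  (IsCoker.of_epi_comp p (by rw [h]; exact hq)).isSES hj

lemma IsKer.nonempty_iso_image {X Y I Q : C} {f : X ⟶ Y} {j : I ⟶ Y} {q : Y ⟶ Q}
    (hq : IsCoker f q) (h : IsKer j q) : Nonempty (Abelian.image f ≅ I) := by
  obtain ⟨b, hb⟩ := (isCoker_cokernel f).exists_iso hq
  have h' : IsKer (Abelian.image.ι f) q := by
    rw [← hb]
    exact (isKer_kernel (cokernel.π f)).comp_mono b.hom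
  obtain ⟨e, -⟩ := h'.exists_iso h
  exact ⟨e⟩

/-- Pairs of short exact sequences as morphisms with a kernel, a cokernel, and a factorization. -/
def sesPairEquiv (X Y M I N : C) : {s : (M ⟶ X) × (X ⟶ I) // IsSES s.1 s.2} ×
      {s : (I ⟶ Y) × (Y ⟶ N) // IsSES s.1 s.2} ≃
    Σ f : X ⟶ Y, {k : M ⟶ X // IsKer k f} × {q : Y ⟶ N // IsCoker f q} ×
      {p : (X ⟶ I) × (I ⟶ Y) // Epi p.1 ∧ Mono p.2 ∧ p.1 ≫ p.2 = f} where
  toFun s := ⟨s.1.1.2 ≫ s.2.1.1,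
    ⟨s.1.1.1, by have := s.2.2.isKer.mono; exact s.1.2.isKer.comp_mono _⟩,
    ⟨s.2.1.2, by have := s.1.2.isCoker.epi; exact s.2.2.isCoker.epi_comp _⟩,
    ⟨(s.1.1.2, s.2.1.1), s.1.2.isCoker.epi, s.2.2.isKer.mono, rfl⟩⟩
  invFun s := (⟨(s.2.1.1, s.2.2.2.1.1),
      isSES_of_epi_mono_fac s.2.2.2.2.1 s.2.2.2.2.2.1 s.2.2.2.2.2.2 s.2.1.2⟩,
    ⟨(s.2.2.2.1.2, s.2.2.1.1),
      isSES_of_epi_mono_fac' s.2.2.2.2.1 s.2.2.2.2.2.1 s.2.2.2.2.2.2 s.2.2.1.2⟩)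
  left_inv _ := rfl
  right_inv := by
    rintro ⟨f, k, q, ⟨p, h₁, h₂, rfl⟩⟩
    rfl

-- Kernels, cokernels and epi-mono factorizations with prescribed objects are each empty or a torsor
-- under an automorphism group.
include hcl hr in
lemma card_kernelImageCokernel_fiber {X Y : C} (m i n : J) (f : X ⟶ Y)
    [Decidable (kernelImageCokernel cl f = (m, i, n))] :
    (Nat.card ({k : r m ⟶ X // IsKer k f} × {q : Y ⟶ r n // IsCoker f q} ×
      {p : (X ⟶ r i) × (r i ⟶ Y) // Epi p.1 ∧ Mono p.2 ∧ p.1 ≫ p.2 = f}) : ℝ) =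
    if kernelImageCokernel cl f = (m, i, n) then aut (r m) * aut (r n) * aut (r i) else 0 := by
  have hiso : ∀ {Z : C} {j : J}, cl Z = j ↔ Nonempty (Z ≅ r j) := fun {Z j} => by
    rw [← hcl, hr]
  split_ifs with h
  · simp only [kernelImageCokernel, Prod.mk.injEq, hiso] at h
    obtain ⟨⟨a⟩, ⟨b⟩, ⟨c⟩⟩ := h
    rw [Nat.card_prod, Nat.card_prod, Nat.cast_mul, Nat.cast_mul, card_isKer (isKer_kernel f) a.symm,
      card_isCoker (isCoker_cokernel f) c, card_factorizations f b.symm, mul_assoc]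
  · rw [Nat.cast_eq_zero]
    have : IsEmpty ({k : r m ⟶ X // IsKer k f} × {q : Y ⟶ r n // IsCoker f q} ×
      {p : (X ⟶ r i) × (r i ⟶ Y) // Epi p.1 ∧ Mono p.2 ∧ p.1 ≫ p.2 = f}) := by
      refine ⟨fun s => h ?_⟩
      obtain ⟨⟨k, hk⟩, ⟨q, hq⟩, ⟨p, h₁, h₂, h₃⟩⟩ := s
      simp only [kernelImageCokernel, Prod.mk.injEq, hiso]
      obtain ⟨a, -⟩ := (isKer_kernel f).exists_iso hk
      obtain ⟨c, -⟩ := (isCoker_cokernel f).exists_iso hq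
      exact ⟨⟨a⟩, IsKer.nonempty_iso_image hq (isSES_of_epi_mono_fac' h₁ h₂ h₃ hq).isKer, ⟨c⟩⟩
    exact Nat.card_of_isEmpty

include hcl hr in
/-- The number of morphisms with given kernel, image and cokernel. -/
lemma card_kernelImageCokernel (X Y : C) (m i n : J) :
    (Nat.card {f : X ⟶ Y // kernelImageCokernel cl f = (m, i, n)} : ℝ) =
      ses (r m) X (r i) * ses (r i) Y (r n) / (aut (r m) * aut (r n) * aut (r i)) := by
  classical
  rw [eq_div_iff (mul_ne_zero (mul_ne_zero (aut_ne_zero _) (aut_ne_zero _)) (aut_ne_zero _))]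
  unfold ses
  -- A pair of sequences glued at `r i` is a morphism together with a chosen kernel, cokernel and
  -- factorization, so each morphism of the given type is counted with the three automorphism
  -- groups.
  rw [← Nat.cast_mul (Nat.card {s : (r m ⟶ X) × (X ⟶ r i) // IsSES s.1 s.2}), ← Nat.card_prod,
    Nat.card_congr (sesPairEquiv X Y (r m) (r i) (r n)), card_sigma_real]
  simp only [card_kernelImageCokernel_fiber hcl hr]
  have := Fintype.ofFinite (X ⟶ Y)
  rw [finsum_eq_sum_of_fintype, Finset.sum_ite, Finset.sum_const_zero, add_zero, Finset.sum_const,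
    nsmul_eq_mul, Nat.card_eq_fintype_card, Fintype.card_subtype]

include hcl hr in
/-- Sums over morphisms as sums over the classes of kernels, images and cokernels. -/
lemma finsum_kernelImageCokernel (X Y : C) (ψ : J × J × J → ℝ) :
    ∑ᶠ f : X ⟶ Y, ψ (kernelImageCokernel cl f) = ∑ᶠ p : J × J × J, ψ p *
      (ses (r p.1) X (r p.2.1) * ses (r p.2.1) Y (r p.2.2) /
        (aut (r p.1) * aut (r p.2.2) * aut (r p.2.1))) := by
  rw [← finsum_fiberwise (kernelImageCokernel cl)]
  refine finsum_congr fun p => ?_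
  rw [← card_kernelImageCokernel hcl hr, mul_comm, ← finsum_const_card]
  exact finsum_congr fun f => by rw [f.2]

-- There are finitely many morphisms `X → Y`, hence finitely many triples that occur.
include hcl hr in
lemma finite_kernelImageCokernel (X Y : C) : {p : J × J × J |
    ses (r p.1) X (r p.2.1) * ses (r p.2.1) Y (r p.2.2) ≠ 0}.Finite := by
  refine (Set.finite_range (kernelImageCokernel cl : (X ⟶ Y) → _)).subset fun p hp => ?_
  by_contra h
  have : IsEmpty {f : X ⟶ Y // kernelImageCokernel cl f = (p.1, p.2.1, p.2.2)} :=
    ⟨fun f => h ⟨f.1, f.2⟩⟩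
  have h' := card_kernelImageCokernel hcl hr X Y p.1 p.2.1 p.2.2
  rw [Nat.card_of_isEmpty, Nat.cast_zero, eq_comm, div_eq_zero_iff] at h'
  exact h'.elim hp (mul_ne_zero (mul_ne_zero (aut_ne_zero _) (aut_ne_zero _)) (aut_ne_zero _))

end KernelImageCokernel

/-! ### The shift of graded objects -/

namespace Gr

variable {A : Type u} [Category.{v} A] [Abelian A] {t : ℕ}

/-- The translation functors. -/
def shiftFun (n : ZMod t) : Gr A t ⥤ Gr A t where
  obj X := mk (fun i => obj X (i + n)) (X.2.preimage (add_left_injective n).injOn)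
  map f := homMk fun i => map f (i + n)
  map_id _ := hom_ext fun _ => rfl
  map_comp _ _ := hom_ext fun _ => rfl

lemma eqToHom_map {X Y : Gr A t} (f : X ⟶ Y) {i j : ZMod t} (h : i = j) :
    map f i ≫ eqToHom (congr_arg (obj Y) h) = eqToHom (congr_arg (obj X) h) ≫ map f j := by
  subst h
  simp

/-- The shift. -/
def shiftEquiv : Gr A t ≌ Gr A t :=
  CategoryTheory.Equivalence.mk (shiftFun 1) (shiftFun (-1))
    (NatIso.ofComponents (fun X => isoMk fun i => eqToIso
      (congr_arg (obj X) (neg_add_cancel_right i 1).symm)) fun f => hom_ext fun i =>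
        eqToHom_map f (neg_add_cancel_right i 1).symm)
    (NatIso.ofComponents (fun X => isoMk fun i => eqToIso
      (congr_arg (obj X) (add_neg_cancel_right i 1))) fun f => hom_ext fun i =>
        eqToHom_map f (add_neg_cancel_right i 1))

end Gr

/-! ### Graded classes, and the twists as products of Euler forms -/

section Classes

variable {A : Type u} [Category.{v} A] [Abelian A] {t : ℕ}

/-- The shift of families. -/
def shiftFamily {α : Type*} [Zero α] : (ZMod t →₀ α) ≃ (ZMod t →₀ α) :=
  Finsupp.equivCongrLeft (Equiv.subRight (1 : ZMod t))

lemma shiftFamily_apply {α : Type*} [Zero α] (f : ZMod t →₀ α) (i : ZMod t) :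
    shiftFamily f i = f (i + 1) := rfl

lemma k₀_zero : k₀ (0 : IsoCls A) = 0 := by
  have h : IsSES (0 : rep (0 : IsoCls A) ⟶ rep (0 : IsoCls A)) (0 : _ ⟶ rep (0 : IsoCls A)) :=
    isSES_of_isZero isZero_rep_zero isZero_rep_zero isZero_rep_zero _ _
  have := k₀_additive h
  simp only [isoCls_rep] at this
  exact left_eq_add.1 this

/-- The family of classes in the Grothendieck group. -/
def familyClass (f : ZMod t →₀ IsoCls A) : ZMod t →₀ K₀ A := f.mapRange k₀ k₀_zero

lemma familyClass_apply (f : ZMod t →₀ IsoCls A) (i : ZMod t) :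
    familyClass f i = k₀ (f i) := rfl

lemma familyClass_shift (f : ZMod t →₀ IsoCls A) :
    familyClass (shiftFamily f) = shiftClass (familyClass f) := Finsupp.ext fun _ => rfl

namespace Gr

/-- The class of a graded object in the graded Grothendieck group. -/
def cls (X : Gr A t) : ZMod t →₀ K₀ A := familyClass (classes X)

lemma cls_ofClasses (f : ZMod t →₀ IsoCls A) : cls (ofClasses f) = familyClass f := by
  rw [cls, classes_ofClasses]

lemma cls_additive : IsAdditiveOnSES (cls : Gr A t → _) := fun h =>
  Finsupp.ext fun i => k₀_additive (isSES_iff.1 h i)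

lemma cls_shift (X : Gr A t) : cls (shiftEquiv.functor.obj X) = shiftClass (cls X) :=
  Finsupp.ext fun _ => rfl

lemma ses_shift (N X M : Gr A t) : ses (shiftEquiv.functor.obj N) (shiftEquiv.functor.obj X)
    (shiftEquiv.functor.obj M) = ses N X M := by
  rw [ses_eq, ses_eq]
  exact finprod_comp_equiv (Equiv.addRight (1 : ZMod t))
    (f := fun i => ses (obj N i) (obj X i) (obj M i))

lemma aut_shift (X : Gr A t) : aut (shiftEquiv.functor.obj X) = aut X := by
  rw [aut_eq, aut_eq]
  exact finprod_comp_equiv (Equiv.addRight (1 : ZMod t)) (f := fun i => aut (obj X i))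

variable [HasExt.{w} A] (hfin : IsFinitary.{w} A) (hher : IsHereditary.{w} A)

include hfin in
lemma finprod_eulerForm_eq (x y : ZMod t →₀ IsoCls A) :
    ∏ᶠ i, eulerForm.{w} (x i) (y i) =
      Real.exp (form (logEuler hfin hher) (deltaCoeff t) (familyClass x) (familyClass y)) := by
  rw [form_delta, exp_finsum _ (finite_support_form_delta _ _ _)]
  refine finprod_congr fun i => ?_
  rw [familyClass_apply, familyClass_apply, logEuler_k₀, Real.exp_log (hfin.eulerForm_pos _ _)]

lemma euler_eq_exp (X Y : Gr A t) :
    euler.{w} X Y = Real.exp (form (logEuler hfin hher) (deltaCoeff t) (cls X) (cls Y)) :=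
  finprod_eulerForm_eq hfin hher (classes X) (classes Y)

include hfin hher in
lemma eulerForm_zero_right (a : IsoCls A) : eulerForm.{w} a 0 = 1 := by
  have h := logEuler_k₀ hfin hher a 0
  rw [k₀_zero, _root_.map_zero] at h
  rw [← Real.exp_log (hfin.eulerForm_pos a 0), ← h, Real.exp_zero]

include hfin hher in
lemma eulerForm_zero_left (a : IsoCls A) : eulerForm.{w} 0 a = 1 := by
  have h := logEuler_k₀ hfin hher 0 a
  rw [k₀_zero, _root_.map_zero, AddMonoidHom.zero_apply] at h
  rw [← Real.exp_log (hfin.eulerForm_pos 0 a), ← h, Real.exp_zero]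

/-- The twist for bounded complexes in terms of the Euler form. -/
lemma finprod_boundedCoeff (x y : ZMod 0 →₀ IsoCls A) :
    Real.exp (form (logEuler hfin hher) boundedCoeff (familyClass x) (familyClass y)) =
      ∏ᶠ i, ∏ᶠ (k : ℕ) (_ : 2 ≤ k), eulerForm.{w} (x (i + k)) (y i) ^ ((-1 : ℤ) ^ k) := by
  rw [form_eq_finsum, exp_finsum _ (finite_support_form _ _ _ _)]
  refine finprod_congr fun i => ?_
  rw [finsum_boundedCoeff (fun k => logEuler hfin hher (familyClass x (i + k)) (familyClass y i)),
    exp_finsum]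
  · refine finprod_congr fun k => ?_
    by_cases hk : 2 ≤ k
    · rw [finsum_eq_if, if_pos hk, finprod_eq_if, if_pos hk, familyClass_apply, familyClass_apply,
        logEuler_k₀]
      rcases neg_one_pow_eq_or ℤ k with h | h
      · rw [h, zpow_one]
        have : (-1 : ℝ) ^ k = 1 := by exact_mod_cast congr_arg (Int.cast : ℤ → ℝ) h
        rw [this, one_mul, Real.exp_log (hfin.eulerForm_pos _ _)]
      · rw [h, zpow_neg_one]
        have : (-1 : ℝ) ^ k = -1 := by exact_mod_cast congr_arg (Int.cast : ℤ → ℝ) h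
        rw [this, neg_one_mul, Real.exp_neg, Real.exp_log (hfin.eulerForm_pos _ _)]
    · rw [finsum_eq_if, if_neg hk, finprod_eq_if, if_neg hk, Real.exp_zero]
  · have hinj : Function.Injective fun k : ℕ => i + (k : ZMod 0) := fun a b h => by
      change ℤ at i
      have h' : i + (a : ℤ) = i + (b : ℤ) := h
      omega
    refine ((familyClass x).hasFiniteSupport.preimage hinj.injOn).subset fun k hk h0 => hk ?_
    dsimp only
    rw [show familyClass x (i + k) = 0 from h0]
    simp

/-- The twist for complexes of odd period in terms of the Euler form. -/
lemma finprod_periodicCoeff [NeZero t] (x y : ZMod t →₀ IsoCls A) :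
    Real.exp (form (logEuler hfin hher) (periodicCoeff t) (familyClass x) (familyClass y)) =
      ∏ᶠ i, √(eulerForm.{w} (x i) (y i) * ∏ k ∈ Finset.Icc 1 (t - 1),
          eulerForm.{w} (x (i + k)) (y i) ^ ((-1 : ℤ) ^ (k + 1))) := by
  rw [form_eq_finsum, exp_finsum _ (finite_support_form _ _ _ _)]
  refine finprod_congr fun i => ?_
  -- The common factor `1/2` of the coefficients becomes the square root.
  rw [finsum_periodicCoeff (fun k => logEuler hfin hher (familyClass x (i + k)) (familyClass y i)),
    one_div, mul_comm, ← div_eq_mul_inv, Real.exp_half, Real.exp_add, Real.exp_sum, add_zero]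
  simp only [familyClass_apply, logEuler_k₀]
  rw [Real.exp_log (hfin.eulerForm_pos _ _)]
  congr 2
  refine Finset.prod_congr rfl fun k _ => ?_
  rcases neg_one_pow_eq_or ℤ (k + 1) with h | h
  · rw [h, zpow_one]
    have : (-1 : ℝ) ^ (k + 1) = 1 := by exact_mod_cast congr_arg (Int.cast : ℤ → ℝ) h
    rw [this, one_mul, Real.exp_log (hfin.eulerForm_pos _ _)]
  · rw [h, zpow_neg_one]
    have : (-1 : ℝ) ^ (k + 1) = -1 := by exact_mod_cast congr_arg (Int.cast : ℤ → ℝ) h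
    rw [this, neg_one_mul, Real.exp_neg, Real.exp_log (hfin.eulerForm_pos _ _)]

end Gr

end Classes

variable {A : Type u} [Category.{v} A] [Abelian A] {t : ℕ}

/-! ### The basis as families of isomorphism classes -/

namespace BasisCls

/-- The family of components of a basis element. -/
def family (x : BasisCls A t) : ZMod t →₀ IsoCls A :=
  Finsupp.ofSupportFinite x.comp (by
    induction x using Quotient.inductionOn with | _ M =>
    exact M.finite.subset fun i hi hi' => hi (isoCls_eq_zero_iff.2 hi'))

lemma family_apply (x : BasisCls A t) (i : ZMod t) : x.family i = x.comp i := rfl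

lemma family_injective : Function.Injective (family : BasisCls A t → _) := by
  intro x y h
  induction x using Quotient.inductionOn with | _ M =>
  induction y using Quotient.inductionOn with | _ N =>
  have h' : ∀ i, Nonempty (M.obj i ≅ N.obj i) := fun i =>
    isoCls_eq_iff.1 (DFunLike.congr_fun h i)
  exact Quotient.sound ⟨GradedObj.isoD fun i => (h' i).some⟩

/-- Basis elements correspond to finitely supported families of isomorphism classes. -/
def equivFamily : BasisCls A t ≃ (ZMod t →₀ IsoCls A) :=
  Equiv.ofBijective family ⟨family_injective, fun f =>
    ⟨mk ⟨fun i => rep (f i), f.hasFiniteSupport.subset fun _ hi h =>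
      hi (isZero_rep_iff.2 h)⟩, Finsupp.ext fun i => isoCls_rep (f i)⟩⟩

lemma family_zero : (0 : BasisCls A t).family = 0 := Finsupp.ext fun _ => rfl

end BasisCls

/-! ### The summands of the two products in normalized form -/

namespace Gr

/-- The number of short exact sequences of graded objects in given classes. -/
abbrev sesFamily (f g h : ZMod t →₀ IsoCls A) : ℝ := ses (ofClasses f) (ofClasses g) (ofClasses h)

/-- The order of the automorphism group of a graded object in a given class. -/
abbrev autFamily (f : ZMod t →₀ IsoCls A) : ℝ := aut (ofClasses f)

lemma sesFamily_eq (f g h : ZMod t →₀ IsoCls A) :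
    sesFamily f g h = ∏ᶠ i, ses (rep (f i)) (rep (g i)) (rep (h i)) := ses_eq _ _ _

lemma autFamily_eq (f : ZMod t →₀ IsoCls A) : autFamily f = ∏ᶠ i, (autCard (f i) : ℝ) := by
  rw [autFamily, aut_eq]
  exact finprod_congr fun i => (autCard_eq _).symm

lemma hasFiniteMulSupport_ses (f g h : ZMod t →₀ IsoCls A) :
    (fun i => ses (rep (f i)) (rep (g i)) (rep (h i))).HasFiniteMulSupport :=
  mulSupport_ses (ofClasses f) (ofClasses g) (ofClasses h)

lemma hasFiniteMulSupport_autCard (f : ZMod t →₀ IsoCls A) :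
    (fun i => (autCard (f i) : ℝ)).HasFiniteMulSupport := by
  simp only [autCard_eq]
  exact mulSupport_aut (ofClasses f)

lemma autFamily_shift (f : ZMod t →₀ IsoCls A) : autFamily (shiftFamily f) = autFamily f :=
  aut_shift (ofClasses f)

lemma sesFamily_class {f g h : ZMod t →₀ IsoCls A} (H : sesFamily f g h ≠ 0) :
    familyClass g = familyClass f + familyClass h := by
  obtain ⟨i, p, hs⟩ := exists_isSES_of_ses_ne_zero H
  have := cls_additive hs
  rwa [cls_ofClasses, cls_ofClasses, cls_ofClasses] at this

lemma finprod_quotient {ι : Type*} {s₁ s₂ s₃ m n k c T E : ι → ℝ}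
    (h₁ : s₁.HasFiniteMulSupport) (h₂ : s₂.HasFiniteMulSupport) (h₃ : s₃.HasFiniteMulSupport)
    (hm : m.HasFiniteMulSupport) (hn : n.HasFiniteMulSupport) (hk : k.HasFiniteMulSupport)
    (hc : c.HasFiniteMulSupport) (hT : T.HasFiniteMulSupport) (hE : E.HasFiniteMulSupport) :
    ∏ᶠ i, s₁ i * s₂ i * s₃ i / (m i * n i * k i) / c i * (T i / E i) =
      (∏ᶠ i, s₁ i) * (∏ᶠ i, s₂ i) * (∏ᶠ i, s₃ i) /
        ((∏ᶠ i, m i) * (∏ᶠ i, n i) * (∏ᶠ i, k i)) / (∏ᶠ i, c i) *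
        ((∏ᶠ i, T i) / (∏ᶠ i, E i)) := by
  rw [finprod_mul_distrib (by fun_prop) (by fun_prop),
    finprod_div_distrib (by fun_prop) (by fun_prop), finprod_div_distrib (by fun_prop) (by fun_prop),
    finprod_div_distrib (by fun_prop) (by fun_prop), finprod_mul_distrib (by fun_prop) (by fun_prop),
    finprod_mul_distrib (by fun_prop) (by fun_prop), finprod_mul_distrib (by fun_prop) (by fun_prop),
    finprod_mul_distrib (by fun_prop) (by fun_prop)]

variable [HasExt.{w} A] (hfin : IsFinitary.{w} A) (hher : IsHereditary.{w} A)

include hfin hher in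
lemma hasFiniteMulSupport_eulerForm (x y : ZMod t →₀ IsoCls A) :
    (fun i => eulerForm.{w} (x i) (y i)).HasFiniteMulSupport := by
  refine x.hasFiniteSupport.subset fun i hi h0 => hi ?_
  dsimp only
  rw [h0, eulerForm_zero_left hfin hher]

/-- The triple `p` records kernel, image and cokernel of `f : A₁[-1] → A₂`. The shift on `A₁` is
transferred to its kernel and image, since shifting preserves the number of short exact sequences.
-/
lemma coeff_eq_finsum [FiniteHom A] {w : (ZMod t →₀ K₀ A) → (ZMod t →₀ K₀ A) →
    (ZMod t →₀ K₀ A) → ℝ} (a₁ a₂ x : ZMod t →₀ IsoCls A) :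
    coeff shiftEquiv cls w (ofClasses a₁) (ofClasses a₂) (ofClasses x) =
      ∑ᶠ p : (ZMod t →₀ IsoCls A) × (ZMod t →₀ IsoCls A) × (ZMod t →₀ IsoCls A),
        sesFamily (shiftFamily p.1) a₁ (shiftFamily p.2.1) * sesFamily p.2.1 a₂ p.2.2 *
          sesFamily p.2.2 x (shiftFamily p.1) /
          (autFamily p.1 * autFamily p.2.2 * autFamily p.2.1) / autFamily x *
          w (familyClass a₁) (familyClass a₂) (familyClass p.2.1) := by
  have h := finsum_kernelImageCokernel (C := Gr A t) (cl := classes) (r := ofClasses)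
    (fun X Y => classes_eq_iff) classes_ofClasses (shiftEquiv.inverse.obj (ofClasses a₁))
    (ofClasses a₂) (fun p => w (familyClass a₁) (familyClass a₂) (familyClass p.2.1) *
      sesFamily p.2.2 x (shiftFamily p.1))
  have hiso : ∀ X : Gr A t, Nonempty (X ≅ ofClasses (classes X)) := fun X =>
    classes_eq_iff.1 (classes_ofClasses _).symm
  have hsum : ∀ f : shiftEquiv.inverse.obj (ofClasses a₁) ⟶ ofClasses a₂,
      w (cls (ofClasses a₁)) (cls (ofClasses a₂)) (cls (ofClasses a₂) - cls (cokernel f)) *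
        ses (cokernel f) (ofClasses x) (shiftEquiv.functor.obj (kernel f)) =
      w (familyClass a₁) (familyClass a₂) (familyClass (kernelImageCokernel classes f).2.1) *
        sesFamily (kernelImageCokernel classes f).2.2 x
          (shiftFamily (kernelImageCokernel classes f).1) := fun f => by
    obtain ⟨a⟩ := hiso (kernel f)
    obtain ⟨c⟩ := hiso (cokernel f)
    have hs : IsSES (Abelian.image.ι f) (cokernel.π f) := (isKer_kernel _).isSES inferInstance
    rw [cls_ofClasses, cls_ofClasses,
      ses_congr c (Iso.refl _) (shiftEquiv.functor.mapIso a), ← cls_ofClasses a₂, cls_additive hs,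
      add_sub_cancel_right]
    rfl
  have hses : ∀ p : (ZMod t →₀ IsoCls A) × (ZMod t →₀ IsoCls A) × (ZMod t →₀ IsoCls A),
      ses (ofClasses p.1) (shiftEquiv.inverse.obj (ofClasses a₁)) (ofClasses p.2.1) =
        sesFamily (shiftFamily p.1) a₁ (shiftFamily p.2.1) := fun p => by
    rw [← ses_shift]
    exact ses_congr (Iso.refl _) (shiftEquiv.counitIso.app _) (Iso.refl _)
  unfold coeff
  rw [finsum_congr hsum, h, finsum_div_const]
  refine finsum_congr fun p => ?_
  rw [hses]
  ring

include hfin hher in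
/-- The summand for bounded complexes. -/
lemma boundedTerm_eq [FiniteHom A] (a₁ a₂ x : BasisCls A 0)
    (p : (ZMod 0 →₀ IsoCls A) × (ZMod 0 →₀ IsoCls A) × (ZMod 0 →₀ IsoCls A)) :
    boundedTerm.{w} a₁ a₂ x (shiftFamily p.2.1, shiftFamily p.1, p.2.2) =
      sesFamily (shiftFamily p.1) a₁.family (shiftFamily p.2.1) *
        sesFamily p.2.1 a₂.family p.2.2 * sesFamily p.2.2 x.family (shiftFamily p.1) /
          (autFamily p.1 * autFamily p.2.2 * autFamily p.2.1) / autFamily x.family *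
          boundedWeight shiftClass (form (logEuler hfin hher) (deltaCoeff 0))
            (form (logEuler hfin hher) boundedCoeff) (familyClass a₁.family)
            (familyClass a₂.family) (familyClass p.2.1) *
        (autFamily x.family / (autFamily a₁.family * autFamily a₂.family)) := by
  have h₁ : boundedTerm.{w} a₁ a₂ x (shiftFamily p.2.1, shiftFamily p.1, p.2.2) =
      sesFamily (shiftFamily p.1) a₁.family (shiftFamily p.2.1) *
        sesFamily p.2.1 a₂.family p.2.2 * sesFamily p.2.2 x.family (shiftFamily p.1) /
          (autFamily (shiftFamily p.1) * autFamily p.2.2 * autFamily p.2.1) /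
            (autFamily a₁.family * autFamily a₂.family) *
          (Real.exp (form (logEuler hfin hher) boundedCoeff (familyClass a₂.family)
            (familyClass a₁.family)) / Real.exp (form (logEuler hfin hher) (deltaCoeff 0)
              (familyClass (shiftFamily p.2.2)) (familyClass (shiftFamily p.1)))) := by
    rw [sesFamily_eq, sesFamily_eq, sesFamily_eq, autFamily_eq, autFamily_eq, autFamily_eq,
      autFamily_eq, autFamily_eq, finprod_boundedCoeff, ← finprod_eulerForm_eq,
      ← finprod_mul_distrib (hasFiniteMulSupport_autCard a₁.family)
        (hasFiniteMulSupport_autCard a₂.family)]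
    refine Eq.trans ?_ (finprod_quotient (hasFiniteMulSupport_ses _ _ _) (hasFiniteMulSupport_ses _ _ _)
        (hasFiniteMulSupport_ses _ _ _) (hasFiniteMulSupport_autCard _)
        (hasFiniteMulSupport_autCard _) (hasFiniteMulSupport_autCard _)
        ((hasFiniteMulSupport_autCard _).mul (hasFiniteMulSupport_autCard _)) ?_
        (hasFiniteMulSupport_eulerForm hfin hher _ _))
    · unfold boundedTerm
      refine finprod_congr fun i => ?_
      simp only [hallNumber_eq, autCard_eq, BasisCls.family_apply, shiftFamily_apply,
        sub_add_cancel]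
      congr 1
      have ha : ∀ a : IsoCls A, aut (rep a) ≠ 0 := fun a => aut_ne_zero _
      have := ha (p.1 (i + 1))
      have := ha (p.2.1 (i + 1))
      have := ha (p.2.1 i)
      have := ha (p.2.2 i)
      have := ha (a₁.comp i)
      have := ha (a₂.comp i)
      field_simp
    · refine a₁.family.hasFiniteSupport.subset fun i hi h0 => hi ?_
      dsimp only
      rw [h0]
      simp only [eulerForm_zero_right hfin hher, one_zpow, finprod_one]
  rw [h₁, autFamily_shift]
  -- Where a Hall number vanishes both sides are 0. Elsewhere additivity identifies `x - s a` with
  -- the class of `M` (the shifted kernel) and `y - a` with that of `N` (the cokernel), so the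
  -- weight is the required Euler quotient.
  by_cases H₁ : sesFamily (shiftFamily p.1) a₁.family (shiftFamily p.2.1) = 0
  · simp only [H₁, zero_mul, zero_div]
  by_cases H₂ : sesFamily p.2.1 a₂.family p.2.2 = 0
  · simp only [H₂, zero_mul, mul_zero, zero_div]
  have e₁ := sesFamily_class H₁
  have e₂ := sesFamily_class H₂
  rw [familyClass_shift p.2.1] at e₁
  have hw : boundedWeight shiftClass (form (logEuler hfin hher) (deltaCoeff 0))
            (form (logEuler hfin hher) boundedCoeff) (familyClass a₁.family)
            (familyClass a₂.family) (familyClass p.2.1) =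
      Real.exp (form (logEuler hfin hher) boundedCoeff (familyClass a₂.family)
            (familyClass a₁.family)) / Real.exp (form (logEuler hfin hher) (deltaCoeff 0)
              (familyClass (shiftFamily p.2.2)) (familyClass (shiftFamily p.1))) := by
    unfold boundedWeight
    rw [← Real.exp_sub, familyClass_shift p.2.2, sub_eq_of_eq_add' e₂, sub_eq_of_eq_add e₁]
  rw [hw]
  have hx : autFamily x.family ≠ 0 := aut_ne_zero _
  field_simp

include hfin hher in
/-- The summand for complexes of odd period. -/
lemma periodicTerm_eq [FiniteHom A] [NeZero t] (a₁ a₂ x : BasisCls A t)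
    (p : (ZMod t →₀ IsoCls A) × (ZMod t →₀ IsoCls A) × (ZMod t →₀ IsoCls A)) :
    periodicTerm.{w} a₁ a₂ x (shiftFamily p.1, p.2.2, p.2.1) =
      sesFamily (shiftFamily p.1) a₁.family (shiftFamily p.2.1) *
        sesFamily p.2.1 a₂.family p.2.2 * sesFamily p.2.2 x.family (shiftFamily p.1) /
          (autFamily p.1 * autFamily p.2.2 * autFamily p.2.1) / autFamily x.family *
          periodicWeight shiftClass (form (logEuler hfin hher) (deltaCoeff t))
            (form (logEuler hfin hher) (periodicCoeff t)) (familyClass a₁.family)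
            (familyClass a₂.family) (familyClass p.2.1) := by
  have h₁ : periodicTerm.{w} a₁ a₂ x (shiftFamily p.1, p.2.2, p.2.1) =
      sesFamily (shiftFamily p.1) a₁.family (shiftFamily p.2.1) *
        sesFamily p.2.1 a₂.family p.2.2 * sesFamily p.2.2 x.family (shiftFamily p.1) /
          (autFamily (shiftFamily p.1) * autFamily p.2.2 * autFamily (shiftFamily p.2.1)) /
            autFamily x.family *
          (Real.exp (form (logEuler hfin hher) (periodicCoeff t) (familyClass a₁.family)
            (familyClass a₂.family)) / (Real.exp (form (logEuler hfin hher) (deltaCoeff t)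
              (familyClass a₁.family) (familyClass p.2.1)) *
              Real.exp (form (logEuler hfin hher) (deltaCoeff t)
              (familyClass (shiftFamily p.2.1)) (familyClass p.2.2)))) := by
    rw [sesFamily_eq, sesFamily_eq, sesFamily_eq, autFamily_eq, autFamily_eq, autFamily_eq,
      autFamily_eq, finprod_periodicCoeff, ← finprod_eulerForm_eq, ← finprod_eulerForm_eq,
      ← finprod_mul_distrib (hasFiniteMulSupport_eulerForm hfin hher _ _)
        (hasFiniteMulSupport_eulerForm hfin hher _ _)]
    refine Eq.trans ?_ (finprod_quotient (hasFiniteMulSupport_ses _ _ _) (hasFiniteMulSupport_ses _ _ _)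
        (hasFiniteMulSupport_ses _ _ _) (hasFiniteMulSupport_autCard _)
        (hasFiniteMulSupport_autCard _) (hasFiniteMulSupport_autCard _)
        (hasFiniteMulSupport_autCard _) (Set.toFinite _)
        ((hasFiniteMulSupport_eulerForm hfin hher _ _).mul
          (hasFiniteMulSupport_eulerForm hfin hher _ _)))
    unfold periodicTerm
    refine finprod_congr fun i => ?_
    simp only [hallNumber_eq, autCard_eq, BasisCls.family_apply, shiftFamily_apply]
    have ha : ∀ a : IsoCls A, aut (rep a) ≠ 0 := fun a => aut_ne_zero _
    have := ha (p.1 (i + 1))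
    have := ha (p.2.1 (i + 1))
    have := ha (p.2.1 i)
    have := ha (p.2.2 i)
    have := ha (x.comp i)
    have := (hfin.eulerForm_pos (a₁.comp i) (p.2.1 i)).ne'
    have := (hfin.eulerForm_pos (p.2.1 (i + 1)) (p.2.2 i)).ne'
    field_simp
  rw [h₁, autFamily_shift, autFamily_shift]
  -- Only the sequence for `A₂` is needed here: it identifies `y - a` with the class of `N`, while
  -- `S`, of class `a`, enters the Euler factors directly.
  by_cases H₂ : sesFamily p.2.1 a₂.family p.2.2 = 0
  · simp only [H₂, zero_mul, mul_zero, zero_div]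
  have e₂ := sesFamily_class H₂
  congr 1
  unfold periodicWeight
  rw [← Real.exp_add, ← Real.exp_sub, familyClass_shift p.2.1, sub_eq_of_eq_add' e₂, sub_sub]

end Gr

/-! ### The zero object in the abstract multiplication -/

section Unit

variable {C : Type u} [Category.{v} C] [Abelian C]

lemma isSES_iff_isIso_left {N X M : C} (hM : IsZero M) (i : N ⟶ X) (p : X ⟶ M) :
    IsSES i p ↔ IsIso i := by
  constructor
  · intro h
    have := h.isKer.mono
    obtain ⟨y, hy⟩ := h.isKer.lift (𝟙 X) (hM.eq_of_tgt _ _)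
    exact ⟨y, by rw [← cancel_mono i, Category.assoc, hy, Category.comp_id, Category.id_comp], hy⟩
  · intro h
    exact IsKer.isSES ⟨inferInstance, hM.eq_of_tgt _ _, fun x _ => ⟨x ≫ inv i, by simp⟩⟩ (hM.epi p)

lemma ses_right_zero (N X : C) {M : C} (hM : IsZero M) : ses N X M = Nat.card (N ≅ X) := by
  unfold ses
  congr 1
  refine Nat.card_congr ⟨fun s => @asIso _ _ _ _ s.1.1 ((isSES_iff_isIso_left hM _ _).1 s.2),
    fun e => ⟨(e.hom, 0), (isSES_iff_isIso_left hM _ _).2 inferInstance⟩, fun s => ?_, fun e => ?_⟩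
  · exact Subtype.ext (Prod.ext rfl (hM.eq_of_tgt _ _))
  · exact Iso.ext rfl

lemma ses_left_zero {N : C} (hN : IsZero N) (X M : C) : ses N X M = Nat.card (X ≅ M) := by
  rw [← ses_op, ses_right_zero _ _ hN.op]
  congr 1
  exact Nat.card_congr (isoOpEquiv _ _)

variable [FiniteHom C] {J : Type*} {r : J → C} {cl : C → J} {Γ : Type*} [AddCommGroup Γ]
  {e : C ≌ C} {cls : C → Γ} {w : Γ → Γ → Γ → ℝ}

-- Only `f = 0` exists, with cokernel `A` and zero kernel, so the short exact sequences reduce to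
-- isomorphisms `A ≅ X`.
open Classical in
lemma coeff_zero_left (hcls : IsAdditiveOnSES cls) (hw : ∀ y, w 0 y 0 = 1) {Z : C} (hZ : IsZero Z)
    (A X : C) : coeff e cls w Z A X = if Nonempty (A ≅ X) then 1 else 0 := by
  have hZ' : IsZero (e.inverse.obj Z) := e.inverse.map_isZero hZ
  have hcZ : cls Z = 0 := left_eq_add.1 (hcls (isSES_of_isZero hZ hZ hZ (𝟙 Z) (𝟙 Z)))
  unfold coeff
  rw [finsum_eq_single _ 0 fun f hf => (hf (hZ'.eq_of_src _ _)).elim]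
  have hk : IsZero (kernel (0 : e.inverse.obj Z ⟶ A)) := IsZero.of_mono (kernel.ι _) hZ'
  have hc := cokernelZeroIsoTarget (X := e.inverse.obj Z) (Y := A)
  rw [hcZ, ← hcls.cls_iso hc.symm, sub_self, hw, one_mul,
    ses_right_zero _ _ (e.functor.map_isZero hk), Nat.card_congr (hc.isoCongr (Iso.refl X))]
  split_ifs with h
  · rw [card_iso_of_iso h.some, aut_congr h.some, div_self (aut_ne_zero _)]
  · rw [not_nonempty_iff] at h
    rw [Nat.card_of_isEmpty, Nat.cast_zero, zero_div]

open Classical in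
lemma coeff_zero_right (hcls : IsAdditiveOnSES cls) (hw : ∀ x, w x 0 0 = 1) {Z : C} (hZ : IsZero Z)
    (A X : C) : coeff e cls w A Z X = if Nonempty (A ≅ X) then 1 else 0 := by
  have hcZ : ∀ {Z}, IsZero Z → cls Z = 0 := fun {Z} hZ =>
    left_eq_add.1 (hcls (isSES_of_isZero hZ hZ hZ (𝟙 Z) (𝟙 Z)))
  unfold coeff
  rw [finsum_eq_single _ 0 fun f hf => (hf (hZ.eq_of_tgt _ _)).elim]
  have hc : IsZero (cokernel (0 : e.inverse.obj A ⟶ Z)) := IsZero.of_epi (cokernel.π _) hZ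
  have hk : e.functor.obj (kernel (0 : e.inverse.obj A ⟶ Z)) ≅ A :=
    e.functor.mapIso kernelZeroIsoSource ≪≫ e.counitIso.app A
  rw [hcZ hZ, hcZ hc, sub_zero, hw, one_mul, ses_left_zero hc, Nat.card_congr
    ((Iso.refl X).isoCongr hk)]
  split_ifs with h
  · rw [card_iso_of_iso h.some.symm, div_self (aut_ne_zero _)]
  · have : IsEmpty (X ≅ A) := ⟨fun a => h ⟨a.symm⟩⟩
    rw [Nat.card_of_isEmpty, Nat.cast_zero, zero_div]

end Unit

/-! ### From structure constants to the bilinear multiplication -/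

section HallAlgebra

variable {A : Type u} [Category.{v} A] [Abelian A] [HasExt.{w} A] {t : ℕ}

/-- Finite support is what makes the `finsum` in `hallMul` the intended linear combination rather
than 0. -/
lemma hallMul_basisVec_apply (hs : ∀ a b : BasisCls A t, {x | structConst.{w} a b x ≠ 0}.Finite)
    (a b x : BasisCls A t) :
    hallMul.{w} A t (basisVec a) (basisVec b) x = structConst.{w} a b x := by
  classical
  have h : hallMul.{w} A t (basisVec a) (basisVec b) =
      ∑ᶠ x : BasisCls A t, ((structConst.{w} a b x : ℝ) : ℂ) • basisVec x := by
    simp [hallMul, basisVec]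
  have hsupp : (Function.support fun x : BasisCls A t =>
      ((structConst.{w} a b x : ℝ) : ℂ) • basisVec x) ⊆ (hs a b).toFinset := fun y hy => by
    rw [Set.Finite.coe_toFinset]
    intro h0
    refine hy ?_
    dsimp only
    rw [h0, Complex.ofReal_zero, zero_smul]
  rw [h, finsum_eq_sum_of_support_subset _ hsupp, Finsupp.finsetSum_apply]
  simp only [Finsupp.smul_apply, basisVec, Finsupp.single_apply, smul_eq_mul, mul_ite, mul_one,
    mul_zero, Finset.sum_ite_eq', Set.Finite.mem_toFinset, Set.mem_ofPred_eq]
  split_ifs with h0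
  · rfl
  · rw [not_not.1 h0, Complex.ofReal_zero]

lemma eq_sum_basisVec (f : HallSpace A t) : f = f.sum fun a c => c • basisVec a := by
  conv_lhs => rw [← Finsupp.sum_single f]
  refine Finsupp.sum_congr fun a _ => ?_
  rw [basisVec, Finsupp.smul_single, smul_eq_mul, mul_one]

@[elab_as_elim]
lemma hallSpace_induction {P : HallSpace A t → Prop} (x : HallSpace A t) (zero : P 0)
    (add : ∀ x y, P x → P y → P (x + y)) (smul : ∀ (c : ℂ) a, P (c • basisVec a)) : P x := by
  induction x using Finsupp.induction_linear with
  | zero => exact zero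
  | add x y hx hy => exact add x y hx hy
  | single a c =>
    have := smul c a
    rwa [basisVec, Finsupp.smul_single, smul_eq_mul, mul_one] at this

/-- The multiplication is associative if the structure constants are. -/
lemma hallMul_assoc (hs : ∀ a b : BasisCls A t, {x | structConst.{w} a b x ≠ 0}.Finite)
    (h : ∀ a b c y : BasisCls A t,
      ∑ᶠ x, structConst.{w} a b x * structConst.{w} x c y =
        ∑ᶠ x, structConst.{w} b c x * structConst.{w} a x y) (x y z : HallSpace A t) :
    hallMul.{w} A t (hallMul.{w} A t x y) z = hallMul.{w} A t x (hallMul.{w} A t y z) := by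
  -- Taking `L` to be right multiplication by `c`, or left multiplication by `a`, gives the
  -- coefficients of the two triple products.
  have key : ∀ a b (L : HallSpace A t →ₗ[ℂ] HallSpace A t) (F : BasisCls A t → ℝ) y,
      (∀ x, L (basisVec x) y = (F x : ℂ)) →
      L (hallMul.{w} A t (basisVec a) (basisVec b)) y =
        ((∑ᶠ x, structConst.{w} a b x * F x : ℝ) : ℂ) := by
    intro a b L F y hF
    conv_lhs => rw [eq_sum_basisVec (hallMul.{w} A t (basisVec a) (basisVec b))]
    rw [Finsupp.sum, map_sum, Finsupp.finsetSum_apply, finsum_eq_sum_of_support_subset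
      (s := (hallMul.{w} A t (basisVec a) (basisVec b)).support), Complex.ofReal_sum]
    · refine Finset.sum_congr rfl fun x _ => ?_
      rw [map_smul, Finsupp.smul_apply, hF, hallMul_basisVec_apply hs, smul_eq_mul,
        Complex.ofReal_mul]
    · intro x hx
      rw [Finset.mem_coe, Finsupp.mem_support_iff, hallMul_basisVec_apply hs]
      intro h0
      refine hx ?_
      dsimp only
      rw [Complex.ofReal_eq_zero.1 h0, zero_mul]
  induction x using hallSpace_induction with
  | zero => simp
  | add x x' hx hx' => simp [hx, hx']
  | smul c₁ a => ?_
  induction y using hallSpace_induction with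
  | zero => simp
  | add x x' hx hx' => simp only [map_add, LinearMap.add_apply, hx, hx']
  | smul c₂ b => ?_
  induction z using hallSpace_induction with
  | zero => simp
  | add x x' hx hx' => simp only [map_add, hx, hx']
  | smul c₃ c => ?_
  simp only [map_smul, LinearMap.smul_apply]
  congr 3
  ext y
  have h₁ := key a b ((hallMul.{w} A t).flip (basisVec c)) (fun x => structConst.{w} x c y) y
    fun x => hallMul_basisVec_apply hs x c y
  have h₂ := key b c (hallMul.{w} A t (basisVec a)) (fun x => structConst.{w} a x y) y
    fun x => hallMul_basisVec_apply hs a x y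
  exact h₁.trans ((congr_arg _ (h a b c y)).trans h₂.symm)

open Classical in
/-- A basis vector is a two-sided unit if it is one for the structure constants. -/
lemma hallMul_unit (hs : ∀ a b : BasisCls A t, {x | structConst.{w} a b x ≠ 0}.Finite)
    {o : BasisCls A t} (h₁ : ∀ a x, structConst.{w} o a x = if a = x then 1 else 0)
    (h₂ : ∀ a x, structConst.{w} a o x = if a = x then 1 else 0) (x : HallSpace A t) :
    hallMul.{w} A t (basisVec o) x = x ∧ hallMul.{w} A t x (basisVec o) = x := by
  induction x using hallSpace_induction with
  | zero => simp
  | add x y hx hy => simp only [map_add, LinearMap.add_apply, hx, hy, and_self]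
  | smul c a =>
    simp only [map_smul, LinearMap.smul_apply]
    constructor
    · congr 1
      ext x
      rw [hallMul_basisVec_apply hs, h₁, basisVec, Finsupp.single_apply]
      split_ifs <;> simp
    · congr 1
      ext x
      rw [hallMul_basisVec_apply hs, h₂, basisVec, Finsupp.single_apply]
      split_ifs <;> simp

end HallAlgebra

/-! ### The structure constants as rescaled normalized constants -/

section StructureConstants

variable {A : Type u} [Category.{v} A] [Abelian A] [HasExt.{w} A] {t : ℕ}
  (hfin : IsFinitary.{w} A) (hher : IsHereditary.{w} A)

/-- The weight in the multiplication. -/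
def weight (t : ℕ) : (ZMod t →₀ K₀ A) → (ZMod t →₀ K₀ A) → (ZMod t →₀ K₀ A) → ℝ :=
  match t with
  | 0 => boundedWeight shiftClass (form (logEuler hfin hher) (deltaCoeff 0))
      (form (logEuler hfin hher) boundedCoeff)
  | t + 1 => periodicWeight shiftClass (form (logEuler hfin hher) (deltaCoeff (t + 1)))
      (form (logEuler hfin hher) (periodicCoeff (t + 1)))

lemma weight_zero_left (y : ZMod t →₀ K₀ A) : weight hfin hher t 0 y 0 = 1 := by
  cases t <;> simp [weight, boundedWeight, periodicWeight]

lemma weight_zero_right (x : ZMod t →₀ K₀ A) : weight hfin hher t x 0 0 = 1 := by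
  cases t <;> simp [weight, boundedWeight, periodicWeight]

/-- The required relation for `T` is read off from its coefficients; oddness of the period enters
here, through `periodicCoeff_relation`. -/
lemma weight_cocycle (ht : t = 0 ∨ Odd t) (x m c a j i : ZMod t →₀ K₀ A) :
    weight hfin hher t (m + i + shiftClass a) (a + x + j) a *
      weight hfin hher t (x + j + (m + i)) (shiftClass.symm (j + i) + c) (shiftClass.symm (j + i)) *
        Real.exp (-form (logEuler hfin hher) (deltaCoeff t) i x) =
    weight hfin hher t (a + x + j) (shiftClass.symm (j + i) + c) (shiftClass.symm j) *
      weight hfin hher t (m + i + shiftClass a) (shiftClass.symm i + c + (a + x))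
        (shiftClass.symm i + a) *
        Real.exp (-form (logEuler hfin hher) (deltaCoeff t) x (shiftClass.symm i)) := by
  cases t with
  | zero =>
    refine boundedWeight_cocycle (form_shift_shift _) (form_shift_shift _) (fun x y => ?_)
      x m c a j i
    rw [form_shift_left, form_shift_left, form_shift_left, form_add]
    exact congr_arg (fun c => form (logEuler hfin hher) c x y) (funext boundedCoeff_relation)
  | succ t =>
    refine periodicWeight_cocycle (form_shift_shift _) (form_shift_shift _) (fun x y => ?_)
      x m c a j i
    rw [form_shift_left, form_shift_left, form_add]
    exact congr_arg (fun c => form (logEuler hfin hher) c x y)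
      (funext (periodicCoeff_relation (ht.resolve_left (Nat.succ_ne_zero t))))

/-- The normalized structure constants of the algebra. -/
def normConst (a b x : BasisCls A t) : ℝ :=
  coeff Gr.shiftEquiv Gr.cls (weight hfin hher t) (Gr.ofClasses a.family) (Gr.ofClasses b.family)
    (Gr.ofClasses x.family)

lemma finite_normConst (a b : BasisCls A t) : {x | normConst hfin hher a b x ≠ 0}.Finite := by
  have := hfin.finiteHom
  exact (finite_coeff (Gr.greenData hfin hher) _ _).preimage BasisCls.family_injective.injOn

lemma normConst_assoc (ht : t = 0 ∨ Odd t) (a b c y : BasisCls A t) :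
    ∑ᶠ x, normConst hfin hher a b x * normConst hfin hher x c y =
      ∑ᶠ x, normConst hfin hher b c x * normConst hfin hher a x y := by
  have := hfin.finiteHom
  have h := coeff_assoc (e := Gr.shiftEquiv) (w := weight hfin hher t)
    (E := fun x y => Real.exp (-form (logEuler hfin hher) (deltaCoeff t) x y))
    (Gr.greenData hfin hher) Gr.cls_additive Gr.cls_shift
    (fun X Y => by rw [Gr.euler_eq_exp hfin hher, Real.exp_neg]) (weight_cocycle hfin hher ht)
    (Gr.ofClasses a.family) (Gr.ofClasses b.family) (Gr.ofClasses c.family)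
    (Gr.ofClasses y.family)
  rw [← finsum_comp_equiv BasisCls.equivFamily, ← finsum_comp_equiv BasisCls.equivFamily] at h
  exact h

lemma nonempty_iso_ofClasses {f g : ZMod t →₀ IsoCls A} :
    Nonempty (Gr.ofClasses f ≅ Gr.ofClasses g) ↔ f = g := by
  rw [← Gr.classes_eq_iff, Gr.classes_ofClasses, Gr.classes_ofClasses]

lemma isZero_ofClasses_zero : IsZero (Gr.ofClasses (0 : ZMod t →₀ IsoCls A)) := by
  rw [IsZero.iff_id_eq_zero]
  exact Gr.hom_ext fun i => isZero_rep_zero.eq_of_src _ _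

open Classical in
lemma normConst_zero_left (a x : BasisCls A t) :
    normConst hfin hher 0 a x = if a = x then 1 else 0 := by
  have := hfin.finiteHom
  have h : IsZero (Gr.ofClasses (0 : BasisCls A t).family) := by
    rw [BasisCls.family_zero]
    exact isZero_ofClasses_zero
  rw [normConst, coeff_zero_left Gr.cls_additive (weight_zero_left hfin hher) h]
  simp only [nonempty_iso_ofClasses, BasisCls.family_injective.eq_iff]

open Classical in
lemma normConst_zero_right (a x : BasisCls A t) :
    normConst hfin hher a 0 x = if a = x then 1 else 0 := by
  have := hfin.finiteHom
  have h : IsZero (Gr.ofClasses (0 : BasisCls A t).family) := by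
    rw [BasisCls.family_zero]
    exact isZero_ofClasses_zero
  rw [normConst, coeff_zero_right Gr.cls_additive (weight_zero_right hfin hher) h]
  simp only [nonempty_iso_ofClasses, BasisCls.family_injective.eq_iff]

/-- The index sets of the sums for bounded complexes. -/
def boundedIndexEquiv (α : Type*) [Zero α] :
    (ZMod t →₀ α) × (ZMod t →₀ α) × (ZMod t →₀ α) ≃
      (ZMod t →₀ α) × (ZMod t →₀ α) × (ZMod t →₀ α) where
  toFun p := (shiftFamily p.2.1, shiftFamily p.1, p.2.2)
  invFun p := (shiftFamily.symm p.2.1, shiftFamily.symm p.1, p.2.2)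
  left_inv p := by simp
  right_inv p := by simp

/-- The index sets of the sums for complexes of odd period. -/
def periodicIndexEquiv [NeZero t] (α : Type*) [Zero α] :
    (ZMod t →₀ α) × (ZMod t →₀ α) × (ZMod t →₀ α) ≃
      (ZMod t → α) × (ZMod t → α) × (ZMod t → α) where
  toFun p := (shiftFamily p.1, p.2.2, p.2.1)
  invFun p := (shiftFamily.symm (Finsupp.equivFunOnFinite.symm p.1),
    Finsupp.equivFunOnFinite.symm p.2.2, Finsupp.equivFunOnFinite.symm p.2.1)
  left_inv p := by
    have h : ∀ f : ZMod t →₀ α, Finsupp.equivFunOnFinite.symm ⇑f = f :=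
      fun f => Finsupp.ext fun _ => rfl
    simp [h]
  right_inv p := by simp

-- A nonzero term requires a morphism `A₁[-1] → A₂` with the given kernel, image and cokernel.
include hfin in
lemma finite_index (a₁ a₂ : ZMod t →₀ IsoCls A) :
    {p : (ZMod t →₀ IsoCls A) × (ZMod t →₀ IsoCls A) × (ZMod t →₀ IsoCls A) |
      Gr.sesFamily (shiftFamily p.1) a₁ (shiftFamily p.2.1) * Gr.sesFamily p.2.1 a₂ p.2.2 ≠
        0}.Finite := by
  have := hfin.finiteHom
  refine (finite_kernelImageCokernel (C := Gr A t) (cl := Gr.classes) (r := Gr.ofClasses)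
    (fun X Y => Gr.classes_eq_iff) Gr.classes_ofClasses
    (Gr.shiftEquiv.inverse.obj (Gr.ofClasses a₁)) (Gr.ofClasses a₂)).subset fun p hp => ?_
  have h : ses (Gr.ofClasses p.1) (Gr.shiftEquiv.inverse.obj (Gr.ofClasses a₁))
      (Gr.ofClasses p.2.1) = Gr.sesFamily (shiftFamily p.1) a₁ (shiftFamily p.2.1) := by
    rw [← Gr.ses_shift]
    exact ses_congr (Iso.refl _) (Gr.shiftEquiv.counitIso.app _) (Iso.refl _)
  change ses (Gr.ofClasses p.1) (Gr.shiftEquiv.inverse.obj (Gr.ofClasses a₁))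
      (Gr.ofClasses p.2.1) * _ ≠ 0
  rw [h]
  exact hp

include hfin hher in
lemma finite_support_boundedTerm (a₁ a₂ x : BasisCls A 0) :
    (Function.support (boundedTerm.{w} a₁ a₂ x)).Finite := by
  have := hfin.finiteHom
  refine ((finite_index hfin a₁.family a₂.family).image (boundedIndexEquiv _)).subset fun q hq => ?_
  obtain ⟨p, rfl⟩ := (boundedIndexEquiv _).surjective q
  refine ⟨p, fun h0 => hq ?_, rfl⟩
  refine (Gr.boundedTerm_eq hfin hher a₁ a₂ x p).trans ?_
  rw [h0]
  simp only [zero_mul, zero_div]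

include hfin hher in
lemma finite_support_periodicTerm [NeZero t] (a₁ a₂ x : BasisCls A t) :
    (Function.support (periodicTerm.{w} a₁ a₂ x)).Finite := by
  have := hfin.finiteHom
  refine ((finite_index hfin a₁.family a₂.family).image (periodicIndexEquiv _)).subset fun q hq => ?_
  obtain ⟨p, rfl⟩ := (periodicIndexEquiv _).surjective q
  refine ⟨p, fun h0 => hq ?_, rfl⟩
  refine (Gr.periodicTerm_eq hfin hher a₁ a₂ x p).trans ?_
  rw [h0]
  simp only [zero_mul, zero_div]

/-- The normalized constants divide by `|Aut X|`, the stated ones by `|Aut A₁| |Aut A₂|`; the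
discrepancy is a rescaling of the basis. -/
lemma structConst_zero (a₁ a₂ x : BasisCls A 0) : structConst.{w} a₁ a₂ x =
    normConst hfin hher a₁ a₂ x * (Gr.autFamily x.family /
      (Gr.autFamily a₁.family * Gr.autFamily a₂.family)) := by
  have := hfin.finiteHom
  rw [structConst, if_pos rfl, ← finsum_comp_equiv (boundedIndexEquiv _), normConst,
    Gr.coeff_eq_finsum, finsum_mul]
  exact finsum_congr fun p => Gr.boundedTerm_eq hfin hher a₁ a₂ x p

lemma structConst_of_ne_zero (ht : t ≠ 0) (a₁ a₂ x : BasisCls A t) : structConst.{w} a₁ a₂ x =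
    normConst hfin hher a₁ a₂ x * (x.modAut / (a₁.modAut * a₂.modAut)) := by
  have := hfin.finiteHom
  have : NeZero t := ⟨ht⟩
  rw [structConst, if_neg ht, ← finsum_comp_equiv (periodicIndexEquiv _), normConst,
    Gr.coeff_eq_finsum]
  congr 1
  refine finsum_congr fun p => (Gr.periodicTerm_eq hfin hher a₁ a₂ x p).trans ?_
  cases t with
  | zero => exact (ht rfl).elim
  | succ t => rfl

end StructureConstants

/-! ### Transfer along a rescaling of the basis -/

section Theorem

variable {A : Type u} [Category.{v} A] [Abelian A] [HasExt.{w} A] {t : ℕ}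
  (hfin : IsFinitary.{w} A) (hher : IsHereditary.{w} A)

/-- The algebra structure, given a normalization of the basis. -/
lemma hallAlgebra_of_normalization (ht : t = 0 ∨ Odd t) (μ : BasisCls A t → ℝ)
    (hμ : ∀ a, μ a ≠ 0) (hμ₀ : μ 0 = 1) (h : ∀ a₁ a₂ x : BasisCls A t, structConst.{w} a₁ a₂ x =
      normConst hfin hher a₁ a₂ x * (μ x / (μ a₁ * μ a₂))) :
    (∀ a₁ a₂ : BasisCls A t, {x | structConst.{w} a₁ a₂ x ≠ 0}.Finite) ∧
    (∀ x y z : HallSpace A t,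
      hallMul.{w} A t (hallMul.{w} A t x y) z = hallMul.{w} A t x (hallMul.{w} A t y z)) ∧
    (∀ x : HallSpace A t,
      hallMul.{w} A t (basisVec 0) x = x ∧ hallMul.{w} A t x (basisVec 0) = x) := by
  classical
  have hs : ∀ a₁ a₂ : BasisCls A t, {x | structConst.{w} a₁ a₂ x ≠ 0}.Finite := fun a₁ a₂ =>
    (finite_normConst hfin hher a₁ a₂).subset fun x hx h0 => hx (by rw [h, h0, zero_mul])
  refine ⟨hs, hallMul_assoc hs fun a b c y => ?_, hallMul_unit hs (fun a x => ?_) fun a x => ?_⟩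
  -- The factor `μ x` of the intermediate object cancels, and both bracketings acquire the same
  -- factor `μ y / (μ a * μ b * μ c)`.
  · have e₁ : ∀ x, structConst.{w} a b x * structConst.{w} x c y =
        normConst hfin hher a b x * normConst hfin hher x c y * (μ y / (μ a * μ b * μ c)) :=
      fun x => by
        have h₁ := hμ x
        rw [h, h]
        field_simp
    have e₂ : ∀ x, structConst.{w} b c x * structConst.{w} a x y =
        normConst hfin hher b c x * normConst hfin hher a x y * (μ y / (μ a * μ b * μ c)) :=
      fun x => by
        have h₁ := hμ x
        rw [h, h]
        field_simp
    simp only [e₁, e₂]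
    rw [← finsum_mul, ← finsum_mul, normConst_assoc hfin hher ht]
  · rw [h, normConst_zero_left, hμ₀, one_mul]
    split_ifs with hax
    · rw [hax, div_self (hμ x), one_mul]
    · rw [zero_mul]
  · rw [h, normConst_zero_right, hμ₀, mul_one]
    split_ifs with hax
    · rw [hax, div_self (hμ x), one_mul]
    · rw [zero_mul]

end Theorem

/-! ### Quasi-isomorphisms of periodic complexes and completion of cospans -/

section Complexes

variable {A : Type u} [Category.{v} A] [Abelian A] {t : ℕ}

/-- An epimorphism of complexes with acyclic kernel is a quasi-isomorphism. -/
lemma quasiIso_of_isKer_of_acyclic {K X Y : Cx A t} {k : K ⟶ X} {p : X ⟶ Y} (h : IsKer k p)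
    [Epi p] (hK : K.Acyclic) : QuasiIso p := by
  have hS := (h.isSES inferInstance).shortExact
  rw [quasiIso_iff]
  intro i
  rw [quasiIsoAt_iff_isIso_homologyMap]
  have h₁ := (hK i).isZero_homology
  have h₂ := (hK (i + 1)).isZero_homology
  have : Mono (HomologicalComplex.homologyMap p i) :=
    (hS.homology_exact₂ i).mono_g (h₁.eq_of_src _ _)
  have : Epi (HomologicalComplex.homologyMap p i) :=
    (hS.homology_exact₃ i (i + 1) rfl).epi_f (h₂.eq_of_tgt _ _)
  exact isIso_of_mono_of_epi _

lemma acyclic_of_isKer_of_quasiIso {K X Y : Cx A t} {k : K ⟶ X} {p : X ⟶ Y} (h : IsKer k p)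
    [Epi p] (hp : QuasiIso p) : K.Acyclic :=
  (h.isSES inferInstance).shortExact.acyclic_X₁ hp

lemma exists_isKer_pullback_fst {C : Type*} [Category* C] [Abelian C] {X Y Z : C} (g : Z ⟶ Y)
    (p : X ⟶ Y) : ∃ k : kernel p ⟶ pullback g p, IsKer k (pullback.fst g p) := by
  have h : (0 : kernel p ⟶ Z) ≫ g = kernel.ι p ≫ p := by simp
  refine ⟨pullback.lift 0 (kernel.ι p) h, ⟨⟨fun a b h => ?_⟩, pullback.lift_fst _ _ _, fun x hx => ?_⟩⟩
  · rw [← cancel_mono (kernel.ι p)]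
    simpa [pullback.lift_snd] using congr_arg (· ≫ pullback.snd g p) h
  · refine ⟨kernel.lift p (x ≫ pullback.snd g p) (by
      rw [Category.assoc, ← pullback.condition, ← Category.assoc, hx, zero_comp]), ?_⟩
    apply pullback.hom_ext
    · simp [hx, pullback.lift_fst]
    · simp [pullback.lift_snd]

/-- Epimorphic quasi-isomorphisms are stable under base change. -/
lemma quasiIso_pullback_fst {X Y Z : Cx A t} (g : Z ⟶ Y) (p : X ⟶ Y) [Epi p] (hp : QuasiIso p) :
    QuasiIso (pullback.fst g p) := by
  obtain ⟨k, hk⟩ := exists_isKer_pullback_fst g p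
  exact quasiIso_of_isKer_of_acyclic hk (acyclic_of_isKer_of_quasiIso (isKer_kernel p) hp)

/-- The contractible complex that covers a given complex. -/
abbrev disk (Y : Cx A t) : Cx A t :=
  CochainComplex.of (fun i => Y.X i ⊞ Y.X (i - 1))
    (fun i => biprod.fst ≫ eqToHom (congr_arg Y.X (add_sub_cancel_right i 1).symm) ≫ biprod.inr)
    (fun i => by simp)

lemma disk_d (Y : Cx A t) (i : ZMod t) : (disk Y).d i (i + 1) =
    (biprod.fst ≫ eqToHom (congr_arg Y.X (add_sub_cancel_right i 1).symm) ≫ biprod.inr :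
      Y.X i ⊞ Y.X (i - 1) ⟶ Y.X (i + 1) ⊞ Y.X (i + 1 - 1)) :=
  CochainComplex.of_d (fun i => Y.X i ⊞ Y.X (i - 1)) (fun i => biprod.fst ≫
    eqToHom (congr_arg Y.X (add_sub_cancel_right i 1).symm) ≫ biprod.inr) i

/-- The epimorphism from the contractible complex. -/
def diskπ (Y : Cx A t) : disk Y ⟶ Y :=
  CochainComplex.ofHom (fun i => (biprod.desc (𝟙 (Y.X i)) (Y.d (i - 1) i) :
    Y.X i ⊞ Y.X (i - 1) ⟶ Y.X i)) fun i => by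
    rw [disk_d]
    refine biprod.hom_ext' _ _ ?_ ?_
    · rw [biprod.inl_desc_assoc, Category.id_comp, Category.assoc, Category.assoc,
        biprod.inl_fst_assoc, biprod.inr_desc]
      exact (Y.eqToHom_comp_d (i' := i + 1 - 1) (i := i) (j := i + 1) rfl (by simp)).symm
    · simp

instance (Y : Cx A t) : Epi (diskπ Y) := by
  have : ∀ i, Epi ((diskπ Y).f i) := fun i => by
    have : biprod.inl ≫ (diskπ Y).f i = 𝟙 (Y.X i) := biprod.inl_desc _ _
    have h : Epi (biprod.inl ≫ (diskπ Y).f i) := by rw [this]; infer_instance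
    exact epi_of_epi biprod.inl _
  exact HomologicalComplex.epi_of_epi_f _ this

/-- The contraction. -/
def diskContraction (Y : Cx A t) : Homotopy (𝟙 (disk Y)) 0 := by
  let h : ∀ i j, (ComplexShape.up (ZMod t)).Rel j i → ((disk Y).X i ⟶ (disk Y).X j) :=
    fun i j (h : j + 1 = i) =>
      (biprod.snd ≫ eqToHom (congr_arg Y.X (by rw [← h, add_sub_cancel_right])) ≫ biprod.inl :
        Y.X i ⊞ Y.X (i - 1) ⟶ Y.X j ⊞ Y.X (j - 1))
  refine (Homotopy.ofEq ?_).trans (Homotopy.nullHomotopy' h)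
  refine HomologicalComplex.hom_ext _ _ fun i => ?_
  obtain ⟨i, rfl⟩ : ∃ j, i = j + 1 := ⟨i - 1, by simp⟩
  rw [Homotopy.nullHomotopicMap'_f (k₂ := i) (k₀ := i + 1 + 1) rfl rfl, disk_d, disk_d]
  change 𝟙 (Y.X (i + 1) ⊞ Y.X (i + 1 - 1)) = _
  refine biprod.hom_ext' (X := Y.X (i + 1)) (Y := Y.X (i + 1 - 1)) _ _ ?_ ?_
  · simp [h]
  · simp [h]

/-- The square completing a cospan with a quasi-isomorphism, up to homotopy. -/
lemma exists_quasiIso_homotopy {X Y Z : Cx A t} (g : Z ⟶ Y) (q : X ⟶ Y) (hq : QuasiIso q) :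
    ∃ (Z' : Cx A t) (s : Z' ⟶ Z) (g' : Z' ⟶ X), QuasiIso s ∧
      Nonempty (Homotopy (s ≫ g) (g' ≫ q)) := by
  -- Adding the contractible cover of `Y` makes `q` an epimorphism without changing it up to
  -- homotopy, so the ordinary pullback can complete the cospan.
  let p : X ⊞ disk Y ⟶ Y := biprod.desc q (diskπ Y)
  have hepi : Epi p := by
    have h : biprod.inr ≫ p = diskπ Y := biprod.inr_desc _ _
    have : Epi (biprod.inr ≫ p) := by rw [h]; infer_instance
    exact epi_of_epi biprod.inr _
  have hsnd : Homotopy (biprod.snd : X ⊞ disk Y ⟶ disk Y) 0 :=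
    (Homotopy.ofEq (Category.comp_id _).symm).trans
      (((diskContraction Y).compLeft biprod.snd).trans (Homotopy.ofEq comp_zero))
  let e : HomotopyEquiv X (X ⊞ disk Y) :=
    { hom := biprod.inl
      inv := biprod.fst
      homotopyHomInvId := Homotopy.ofEq biprod.inl_fst
      homotopyInvHomId := by
        have h : Homotopy (biprod.snd ≫ biprod.inr : X ⊞ disk Y ⟶ X ⊞ disk Y) 0 :=
          (hsnd.compRight biprod.inr).trans (Homotopy.ofEq zero_comp)
        exact (Homotopy.ofEq (add_zero _).symm).trans
          (((Homotopy.refl (biprod.fst ≫ biprod.inl)).add h.symm).trans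
            (Homotopy.ofEq biprod.total)) }
  have hp : QuasiIso p := by
    have h₁ : QuasiIso e.hom := e.quasiIso_hom
    have h₂ : QuasiIso (e.hom ≫ p) := by
      change QuasiIso (biprod.inl ≫ p)
      rwa [biprod.inl_desc]
    exact quasiIso_of_comp_left e.hom p
  refine ⟨pullback g p, pullback.fst g p, pullback.snd g p ≫ biprod.fst,
    quasiIso_pullback_fst g p hp, ⟨?_⟩⟩
  have h₁ : p = biprod.fst ≫ q + biprod.snd ≫ diskπ Y := biprod.desc_eq
  have h₂ : Homotopy p (biprod.fst ≫ q) :=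
    (Homotopy.ofEq h₁).trans (((Homotopy.refl _).add
      ((hsnd.compRight (diskπ Y)).trans (Homotopy.ofEq zero_comp))).trans
        (Homotopy.ofEq (add_zero _)))
  exact (Homotopy.ofEq pullback.condition).trans ((h₂.compLeft _).trans
    (Homotopy.ofEq (Category.assoc _ _ _).symm))

end Complexes

/-! ### Morphisms of the relative derived category as roofs -/

section Roofs

variable {A : Type u} [Category.{v} A] [Abelian A] {t : ℕ} [NeZero t]

variable (A t) in
/-- The functor from complexes to the relative homotopy category. -/
def relQuotient : Cx A t ⥤ RelHomotopyCat A t :=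
  (isBounded A t).lift (HomotopyCategory.quotient A _) fun _ => Set.toFinite _

variable (A t) in
/-- The localization functor from complexes to the relative derived category. -/
abbrev relLoc : Cx A t ⥤ RelDerivedCat A t := relQuotient A t ⋙ (relQuasiIso A t).Q

lemma relQuotient_map_surjective {X Y : Cx A t}
    (f : (relQuotient A t).obj X ⟶ (relQuotient A t).obj Y) :
    ∃ g : X ⟶ Y, (relQuotient A t).map g = f := by
  obtain ⟨g, hg⟩ := (HomotopyCategory.quotient A (ComplexShape.up (ZMod t))).map_surjective f.hom
  exact ⟨g, ObjectProperty.hom_ext _ hg⟩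

lemma relQuasiIso_map_iff {X Y : Cx A t} (f : X ⟶ Y) :
    relQuasiIso A t ((relQuotient A t).map f) ↔ QuasiIso f :=
  HomotopyCategory.quotient_map_mem_quasiIso_iff f

lemma isIso_relLoc_map {X Y : Cx A t} (f : X ⟶ Y) (hf : QuasiIso f) : IsIso ((relLoc A t).map f) :=
  (relQuasiIso A t).Q_inverts _ ((relQuasiIso_map_iff f).2 hf)

lemma relLoc_map_eq_of_homotopy {X Y : Cx A t} {f g : X ⟶ Y} (h : Homotopy f g) :
    (relLoc A t).map f = (relLoc A t).map g := by
  have : (relQuotient A t).map f = (relQuotient A t).map g :=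
    ObjectProperty.hom_ext _ (HomotopyCategory.eq_of_homotopy _ _ h)
  exact congr_arg (relQuasiIso A t).Q.map this

lemma exists_relQuotient_obj (X : RelHomotopyCat A t) : ∃ Y, (relQuotient A t).obj Y = X :=
  ⟨X.1.as, rfl⟩

/-- The morphism is represented by a roof. -/
def IsRoof {M : Cx A t} {X : RelDerivedCat A t} (ψ : (relLoc A t).obj M ⟶ X) : Prop :=
  ∃ (N Z : Cx A t) (s : Z ⟶ M) (f : Z ⟶ N) (e : (relLoc A t).obj N = X), QuasiIso s ∧
    (relLoc A t).map s ≫ ψ = (relLoc A t).map f ≫ eqToHom e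

lemma relLoc_obj_injective {M : Cx A t} {X : RelHomotopyCat A t}
    (h : (relLoc A t).obj M = (relQuasiIso A t).Q.obj X) : (relQuotient A t).obj M = X :=
  (Localization.Construction.objEquiv (relQuasiIso A t)).injective h

/-- The morphisms that preserve roofs. -/
def preservesRoofs : MorphismProperty (RelDerivedCat A t) := fun _ _ φ =>
  ∀ ⦃M : Cx A t⦄ (ψ : (relLoc A t).obj M ⟶ _), IsRoof ψ → IsRoof (ψ ≫ φ)

instance : (preservesRoofs (A := A) (t := t)).IsStableUnderComposition where
  comp_mem φ φ' h h' M ψ hψ := by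
    rw [← Category.assoc]
    exact h' _ (h _ hψ)

/-- The localization is generated under composition by images of morphisms and formal inverses of
quasi-isomorphisms, so it suffices that these two kinds preserve roofs. -/
lemma preservesRoofs_eq_top : preservesRoofs (A := A) (t := t) = ⊤ := by
  refine Localization.Construction.morphismProperty_eq_top _ ?_ ?_
  · rintro X Y f M ψ ⟨N, Z, s, g, e, hs, h⟩
    obtain rfl := relLoc_obj_injective e
    obtain ⟨Y, rfl⟩ := exists_relQuotient_obj Y
    obtain ⟨f, rfl⟩ := relQuotient_map_surjective f
    refine ⟨Y, Z, s, g ≫ f, rfl, hs, ?_⟩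
    rw [← Category.assoc, h, eqToHom_refl, Category.comp_id, eqToHom_refl, Category.comp_id,
      Functor.map_comp]
    rfl
  -- The inverse of `q` is moved to the other side of the roof by completing the cospan formed by
  -- `g` and `q`, up to homotopy.
  · rintro X Y q hq M ψ ⟨N, Z, s, g, e, hs, h⟩
    obtain rfl := relLoc_obj_injective e
    obtain ⟨X, rfl⟩ := exists_relQuotient_obj X
    obtain ⟨q, rfl⟩ := relQuotient_map_surjective q
    obtain ⟨Z', s', g', hs', ⟨H⟩⟩ := exists_quasiIso_homotopy g q ((relQuasiIso_map_iff q).1 hq)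
    refine ⟨X, Z', s' ≫ s, g', rfl, inferInstance, ?_⟩
    have h₁ := relLoc_map_eq_of_homotopy H
    rw [Functor.map_comp, Functor.map_comp] at h₁
    rw [eqToHom_refl, Category.comp_id] at h
    rw [Functor.map_comp, Category.assoc, ← Category.assoc ((relLoc A t).map s), h,
      ← Category.assoc, h₁, eqToHom_refl, Category.comp_id, Category.assoc]
    have := (Localization.Construction.wIso _ hq).hom_inv_id
    exact (congr_arg _ this).trans (Category.comp_id _)

/-- Every morphism in the relative derived category is represented by a roof. -/
lemma exists_roof {M N : Cx A t} (φ : (relLoc A t).obj M ⟶ (relLoc A t).obj N) :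
    ∃ (Z : Cx A t) (s : Z ⟶ M) (f : Z ⟶ N), QuasiIso s ∧
      (relLoc A t).map s ≫ φ = (relLoc A t).map f := by
  have h : preservesRoofs φ := by
    rw [preservesRoofs_eq_top]
    trivial
  obtain ⟨N', Z, s, f, e, hs, h⟩ := h (𝟙 _) ⟨M, M, 𝟙 M, 𝟙 M, rfl, inferInstance, by simp⟩
  obtain ⟨e', he'⟩ : ∃ e' : (relQuotient A t).obj N' ⟶ (relQuotient A t).obj N,
      (relQuasiIso A t).Q.map e' = eqToHom e :=
    ⟨eqToHom (relLoc_obj_injective e), eqToHom_map _ _⟩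
  obtain ⟨e'', rfl⟩ := relQuotient_map_surjective e'
  refine ⟨Z, s, f ≫ e'', hs, ?_⟩
  rw [Category.id_comp] at h
  rw [h, Functor.map_comp, ← he']
  rfl

end Roofs

/-! ### Quasi-isomorphisms to complexes with zero differential -/

section ZeroDifferential

variable {A : Type u} [Category.{v} A] [Abelian A] {t : ℕ}

lemma isCoker_homologyπ (K : Cx A t) {i j : ZMod t} (h : i + 1 = j) :
    IsCoker (K.toCycles i j) (K.homologyπ j) where
  epi := inferInstance
  zero := K.toCycles_comp_homologyπ i j
  desc x hx := by
    have hc := K.homologyIsCokernel i j ((ComplexShape.up (ZMod t)).prev_eq' h)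
    exact ⟨hc.desc (CokernelCofork.ofπ x hx), hc.fac _ WalkingParallelPair.one⟩

lemma homologyπ_comp_homologyMap_comp_homologyIso {K : Cx A t} {T : GradedObj A t}
    (s : K ⟶ T.toCx) (j : ZMod t) :
    K.homologyπ j ≫ HomologicalComplex.homologyMap s j ≫ (T.homologyIso j).hom =
      K.iCycles j ≫ s.f j := by
  rw [HomologicalComplex.homologyπ_naturality_assoc, ← HomologicalComplex.cyclesMap_i]
  congr 1
  exact (T.toCx.isoHomologyπ _ j rfl rfl).hom_inv_id_assoc (T.toCx.iCycles j)

/-- Quasi-isomorphisms to complexes with zero differential. -/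
lemma quasiIsoAt_iff_isCoker {K : Cx A t} {T : GradedObj A t} (s : K ⟶ T.toCx) {i j : ZMod t}
    (h : i + 1 = j) : QuasiIsoAt s j ↔ IsCoker (K.toCycles i j) (K.iCycles j ≫ s.f j) := by
  rw [quasiIsoAt_iff_isIso_homologyMap, ← homologyπ_comp_homologyMap_comp_homologyIso]
  have hπ := isCoker_homologyπ K h
  constructor
  · intro hs
    exact hπ.comp_iso (asIso (HomologicalComplex.homologyMap s j) ≪≫ T.homologyIso j)
  · intro hc
    obtain ⟨e, he⟩ := hπ.exists_iso hc
    have h₁ := (cancel_epi (K.homologyπ j)).1 he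
    have h₂ : IsIso (HomologicalComplex.homologyMap s j ≫ (T.homologyIso j).hom) := by
      rw [← h₁]
      exact e.isIso_hom
    exact IsIso.of_isIso_comp_right _ (T.homologyIso j).hom

lemma isKer_iCycles (K : Cx A t) {j k : ZMod t} (h : j + 1 = k) :
    IsKer (K.iCycles j) (K.d j k) where
  mono := inferInstance
  zero := K.iCycles_d j k
  lift x hx := ⟨K.liftCycles x k ((ComplexShape.up (ZMod t)).next_eq' h) hx,
    K.liftCycles_i _ _ _ _⟩

/-- This allows an explicit model `Z` of the cycles in place of the abstract one. -/
lemma quasiIsoAt_of_isKer {K : Cx A t} {T : GradedObj A t} (s : K ⟶ T.toCx) {i j k : ZMod t}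
    (h : i + 1 = j) (h' : j + 1 = k) {Z : A} {z : Z ⟶ K.X j} (hz : IsKer z (K.d j k))
    {f : K.X i ⟶ Z} (hf : f ≫ z = K.d i j) (hc : IsCoker f (z ≫ s.f j)) : QuasiIsoAt s j := by
  rw [quasiIsoAt_iff_isCoker s h]
  obtain ⟨e, he⟩ := hz.exists_iso (isKer_iCycles K h')
  have hf' : f ≫ e.hom = K.toCycles i j := by
    rw [← cancel_mono (K.iCycles j), Category.assoc, he, hf, K.toCycles_i]
  rw [← hf']
  have := hc.iso_mid e
  rwa [← he, Category.assoc, Iso.inv_hom_id_assoc] at this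

end ZeroDifferential

/-! ### Complexes built from families of extensions -/

section Extensions

variable {A : Type u} [Category.{v} A] [Abelian A] {t : ℕ}

/-- A family of extensions of the `Mⁱ⁺¹` by the `Gⁱ`. -/
structure ExtFamily (M : GradedObj A t) (G : ZMod t → A) where
  E : ZMod t → A
  ι : ∀ i, G i ⟶ E (i + 1)
  π : ∀ i, E i ⟶ M.obj i
  isSES : ∀ i, IsSES (ι i) (π (i + 1))

namespace ExtFamily

variable {M : GradedObj A t} {G : ZMod t → A} (W : ExtFamily M G)

/-- The complex attached to a family of extensions. -/
abbrev cx : Cx A t :=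
  CochainComplex.of (fun i => W.E i ⊞ G i) (fun i => biprod.snd ≫ W.ι i ≫ biprod.inl)
    (fun i => by simp)

lemma cx_d (i : ZMod t) : W.cx.d i (i + 1) =
    (biprod.snd ≫ W.ι i ≫ biprod.inl : W.E i ⊞ G i ⟶ W.E (i + 1) ⊞ G (i + 1)) :=
  CochainComplex.of_d (fun i => W.E i ⊞ G i) (fun i => biprod.snd ≫ W.ι i ≫ biprod.inl) i

/-- Morphisms to a complex. -/
def desc {K : Cx A t} (a : ∀ i, W.E i ⟶ K.X i) (b : ∀ i, G i ⟶ K.X i)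
    (ha : ∀ i, a i ≫ K.d i (i + 1) = 0) (hb : ∀ i, b i ≫ K.d i (i + 1) = W.ι i ≫ a (i + 1)) :
    W.cx ⟶ K :=
  CochainComplex.ofHom (fun i => (biprod.desc (a i) (b i) : W.E i ⊞ G i ⟶ K.X i)) fun i => by
    rw [cx_d]
    refine biprod.hom_ext' _ _ ?_ ?_
    · rw [biprod.inl_desc_assoc, ha]
      simp
    · rw [biprod.inr_desc_assoc, hb]
      simp

/-- Morphisms to a complex with zero differential. -/
def descGraded {T : GradedObj A t} (a : ∀ i, M.obj i ⟶ T.obj i) (b : ∀ i, G i ⟶ T.obj i) :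
    W.cx ⟶ T.toCx :=
  W.desc (K := T.toCx) (fun i => W.π i ≫ a i) b (fun _ => comp_zero) fun i => by
    have h : W.ι i ≫ W.π (i + 1) ≫ a (i + 1) = 0 := by
      rw [← Category.assoc, (W.isSES i).isKer.zero, zero_comp]
    exact comp_zero.trans h.symm

/-- The differential is injective on `G`, so the cycles in degree `i + 1` are `E (i + 1)` and the
boundaries are `G i`; the homology is `M`. Cycles do not see `G`, hence `b` is arbitrary. -/
lemma quasiIso_descGraded (b : ∀ i, G i ⟶ M.obj i) :
    QuasiIso (W.descGraded (fun i => 𝟙 (M.obj i)) b) := by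
  rw [quasiIso_iff]
  intro j
  obtain ⟨i, rfl⟩ : ∃ i, j = i + 1 := ⟨j - 1, by simp⟩
  have hz : IsKer (biprod.inl : W.E (i + 1) ⟶ W.E (i + 1) ⊞ G (i + 1))
      (W.cx.d (i + 1) (i + 1 + 1)) := by
    rw [cx_d]
    have hm : Mono (W.ι (i + 1) ≫ (biprod.inl : _ ⟶ W.E (i + 1 + 1) ⊞ G (i + 1 + 1))) := by
      have := (W.isSES (i + 1)).isKer.mono
      infer_instance
    refine IsKer.comp_mono (g := biprod.snd) ⟨inferInstance, biprod.inl_snd, fun x hx =>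
      ⟨x ≫ biprod.fst, ?_⟩⟩ _
    rw [Category.assoc]
    apply biprod.hom_ext
    · simp
    · simp [hx]
  refine quasiIsoAt_of_isKer _ (i := i) (f := (biprod.snd ≫ W.ι i : W.E i ⊞ G i ⟶ _)) rfl rfl hz
    ?_ ?_
  · rw [cx_d, Category.assoc]
  · have h : (biprod.inl : W.E (i + 1) ⟶ W.E (i + 1) ⊞ G (i + 1)) ≫
        (W.descGraded (fun i => 𝟙 (M.obj i)) b).f (i + 1) = W.π (i + 1) := by
      refine (biprod.inl_desc _ _).trans (Category.comp_id _)
    rw [h]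
    exact (W.isSES i).isCoker.epi_comp _

end ExtFamily

/-- Data is built in degree `i + 1` from degree `i`; since `i ↦ i + 1` is a bijection, such choices
assemble into a family over all degrees. -/
lemma exists_forall_succ {α : ZMod t → Type*} {P : ∀ i, α (i + 1) → Prop}
    (h : ∀ i, ∃ x, P i x) : ∃ x : ∀ j, α j, ∀ i, P i (x (i + 1)) := by
  have h' : ∀ j, ∃ x : α j, ∀ (i : ZMod t) (hij : i + 1 = j), P i (hij ▸ x) := by
    intro j
    obtain ⟨i, rfl⟩ : ∃ i, j = i + 1 := ⟨j - 1, by simp⟩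
    obtain ⟨x, hx⟩ := h i
    refine ⟨x, fun i' hij => ?_⟩
    obtain rfl := add_right_cancel hij
    exact hx
  choose x hx using h'
  exact ⟨x, fun i => hx _ i rfl⟩

lemma forall_of_forall_succ {P : ZMod t → Prop} (h : ∀ i, P (i + 1)) (j : ZMod t) : P j := by
  obtain ⟨i, rfl⟩ : ∃ i, j = i + 1 := ⟨j - 1, by simp⟩
  exact h i

variable [HasExt.{w} A]

/-- A family of extensions with given classes. -/
lemma exists_extFamily (M : GradedObj A t) (G : ZMod t → A)
    (ξ : ∀ i, Abelian.Ext.{w} (M.obj (i + 1)) (G i) 1) :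
    ∃ W : ExtFamily M G, ∀ i, (W.isSES i).extClass = ξ i := by
  obtain ⟨x, hx⟩ := exists_forall_succ (α := fun j => Σ X : A, X ⟶ M.obj j)
    (P := fun i x => ∃ (ι : G i ⟶ x.1) (h : IsSES ι x.2), h.extClass = ξ i) fun i => by
      obtain ⟨X, ι, π, h, hξ⟩ := exists_isSES_extClass_eq (ξ i)
      exact ⟨⟨X, π⟩, ι, h, hξ⟩
  choose ι h hξ using hx
  exact ⟨⟨fun j => (x j).1, ι, fun j => (x j).2, h⟩, hξ⟩

/-- Lifting a right exact sequence to an extension in a hereditary category. -/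
lemma IsCoker.exists_lift (hher : IsHereditary.{w} A) {D C M : A} {f : D ⟶ C} {p : C ⟶ M}
    (h : IsCoker f p) : ∃ (ξ : Abelian.Ext.{w} M D 1), ∀ {E : A} {ι : D ⟶ E} {π : E ⟶ M}
      (hE : IsSES ι π), hE.extClass = ξ → ∃ c : E ⟶ C, ι ≫ c = f ∧ c ≫ p = π := by
  let t := Abelian.factorThruImage f
  let m := Abelian.image.ι f
  have htm : t ≫ m = f := Abelian.image.fac f
  have h₁ : IsSES m p := (IsCoker.of_epi_comp t (by rwa [htm])).isSES inferInstance
  have h₂ : IsSES (kernel.ι t) t := (isKer_kernel t).isSES inferInstance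
  obtain ⟨ξ, hξ⟩ := postcomp_surjective hher h₂ M h₁.extClass
  refine ⟨ξ, fun hE hE' => ?_⟩
  obtain ⟨c, hc, hc'⟩ := (hE.exists_map_iff h₁ t).2 (by rw [hE']; exact hξ)
  exact ⟨c, hc.trans htm, hc'⟩

end Extensions

/-! ### Finiteness of the morphism sets in the relative derived category -/

section Finiteness

variable {A : Type u} [Category.{v} A] [Abelian A] [HasExt.{w} A] {t : ℕ} [NeZero t]
  (hfin : IsFinitary.{w} A) (hher : IsHereditary.{w} A)

lemma biprod_desc_comp_eq_desc_comp {E D C B T : A} {a : E ⟶ C} {b : D ⟶ C} {c : E ⟶ B}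
    {d : D ⟶ B} {g : C ⟶ T} {h : B ⟶ T} (h₁ : a ≫ g = c ≫ h) (h₂ : b ≫ g = d ≫ h) :
    biprod.desc a b ≫ g = biprod.desc c d ≫ h := by
  apply biprod.hom_ext' <;> simpa

lemma biprod_desc_comp_eq_desc {E D C T : A} {a : E ⟶ C} {b : D ⟶ C} {c : E ⟶ T}
    {d : D ⟶ T} {g : C ⟶ T} (h₁ : a ≫ g = c) (h₂ : b ≫ g = d) :
    biprod.desc a b ≫ g = biprod.desc c d := by
  apply biprod.hom_ext' <;> simpa

/-- Two roofs dominated by a common object `V` represent the same morphism. -/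
lemma inv_comp_eq_of_roof_eq {C D : Type*} [Category C] [Category D] (F : C ⥤ D)
    {V Z W X Y : C} {p : V ⟶ Z} {q : V ⟶ W} {s : Z ⟶ X} {f : Z ⟶ Y} {s' : W ⟶ X} {f' : W ⟶ Y}
    {φ : F.obj X ⟶ F.obj Y} (h : F.map s ≫ φ = F.map f) (h₁ : p ≫ s = q ≫ s')
    (h₂ : p ≫ f = q ≫ f') (hps : IsIso (F.map (p ≫ s))) (hs' : IsIso (F.map s')) :
    inv (F.map s') ≫ F.map f' = φ := by
  have hq : IsIso (F.map q) := by
    rw [h₁, F.map_comp] at hps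
    exact IsIso.of_isIso_comp_right _ (F.map s')
  rw [IsIso.inv_comp_eq, ← cancel_epi (F.map q), ← F.map_comp, ← h₂, F.map_comp, ← h,
    ← F.map_comp_assoc, h₁, F.map_comp, Category.assoc]

/-- The classes of the extensions and the homomorphisms that represent all morphisms. -/
def roofFamily {M N : GradedObj A t} (ξ : (∀ i, Abelian.Ext.{w} (M.obj (i + 1))
    (M.obj i ⊞ N.obj i) 1) × (∀ i, M.obj i ⟶ N.obj i)) :
    (relLoc A t).obj M.toCx ⟶ (relLoc A t).obj N.toCx :=
  let W := (exists_extFamily M (fun i => M.obj i ⊞ N.obj i) ξ.1).choose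
  have := isIso_relLoc_map _ (W.quasiIso_descGraded fun _ => biprod.fst)
  inv ((relLoc A t).map (W.descGraded (fun i => 𝟙 (M.obj i)) fun _ => biprod.fst)) ≫
    (relLoc A t).map (W.descGraded ξ.2 fun _ => biprod.snd)

-- A roof `M ← Z → N` has an arbitrary apex. It is first dominated by the complex of a family `V` of
-- extensions of `M (i + 1)` by `Z.X i`; pushing `V` out along `Z.X i → M i ⊞ N i` gives a family
-- `W` whose complex depends only on data bounded in terms of `M` and `N`.
include hher in
lemma roofFamily_surjective (M N : GradedObj A t) :
    Function.Surjective (roofFamily.{w} (M := M) (N := N)) := by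
  intro φ
  obtain ⟨Z, s, f, hs, hφ⟩ := exists_roof φ
  -- As `s` is a quasi-isomorphism, `M (i + 1)` is the cokernel of `Z.X i` mapping to the cycles;
  -- heredity lifts this right exact sequence to a genuine extension.
  have hc : ∀ i, IsCoker (Z.toCycles i (i + 1)) (Z.iCycles (i + 1) ≫ s.f (i + 1)) := fun i =>
    (quasiIsoAt_iff_isCoker s rfl).1 inferInstance
  choose ξ hξ using fun i => (hc i).exists_lift hher
  obtain ⟨V, hV⟩ := exists_extFamily M Z.X ξ
  obtain ⟨a, ha⟩ := exists_forall_succ (α := fun j => V.E j ⟶ Z.X j) (P := fun i a =>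
      V.ι i ≫ a = Z.d i (i + 1) ∧ a ≫ Z.d (i + 1) (i + 1 + 1) = 0 ∧
        a ≫ s.f (i + 1) = V.π (i + 1)) fun i => by
    obtain ⟨c, hc₁, hc₂⟩ := hξ i (V.isSES i) (hV i)
    refine ⟨c ≫ Z.iCycles (i + 1), ?_, ?_, ?_⟩
    · rw [← Category.assoc, hc₁, Z.toCycles_i]
    · rw [Category.assoc, Z.iCycles_d, comp_zero]
    · rw [Category.assoc]
      exact hc₂
  have ha₂ := forall_of_forall_succ (P := fun j => a j ≫ Z.d j (j + 1) = 0) fun i => (ha i).2.1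
  have ha₃ := forall_of_forall_succ (P := fun j => a j ≫ s.f j = V.π j) fun i => (ha i).2.2
  obtain ⟨α, hα⟩ := exists_forall_succ (α := fun j => M.obj j ⟶ N.obj j) (P := fun i α =>
      V.π (i + 1) ≫ α = a (i + 1) ≫ f.f (i + 1)) fun i =>
    (V.isSES i).isCoker.desc (a (i + 1) ≫ f.f (i + 1)) (by
      rw [← Category.assoc, (ha i).1]
      exact (f.comm i (i + 1)).symm.trans comp_zero)
  have hα' := forall_of_forall_succ (P := fun j => V.π j ≫ α j = a j ≫ f.f j) hα
  let s₀ : ∀ i, Z.X i ⟶ M.obj i := s.f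
  let f₀ : ∀ i, Z.X i ⟶ N.obj i := f.f
  -- The two legs of the roof are recorded together, so that both factor through the pushed-out
  -- extension.
  let l : ∀ i, Z.X i ⟶ M.obj i ⊞ N.obj i := fun i => biprod.lift (s₀ i) (f₀ i)
  let ξ' : ∀ i, Abelian.Ext.{w} (M.obj (i + 1)) (M.obj i ⊞ N.obj i) 1 := fun i =>
    (V.isSES i).extClass.comp (Abelian.Ext.mk₀ (l i)) (add_zero 1)
  refine ⟨(ξ', α), ?_⟩
  let W := (exists_extFamily M (fun i => M.obj i ⊞ N.obj i) ξ').choose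
  have hW : ∀ i, (W.isSES i).extClass = ξ' i :=
    (exists_extFamily M (fun i => M.obj i ⊞ N.obj i) ξ').choose_spec
  obtain ⟨b, hb⟩ := exists_forall_succ (α := fun j => V.E j ⟶ W.E j) (P := fun i b =>
      V.ι i ≫ b = l i ≫ W.ι i ∧ b ≫ W.π (i + 1) = V.π (i + 1)) fun i =>
    ((V.isSES i).exists_map_iff (W.isSES i) (l i)).2 (hW i).symm
  have hb₂ := forall_of_forall_succ (P := fun j => b j ≫ W.π j = V.π j) fun i => (hb i).2
  let p : V.cx ⟶ Z := V.desc a (fun i => 𝟙 (Z.X i)) ha₂ fun i => by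
    rw [(ha i).1, Category.id_comp]
  let q : V.cx ⟶ W.cx := V.desc (fun i => b i ≫ biprod.inl) (fun i => l i ≫ biprod.inr)
    (fun i => by rw [W.cx_d]; simp) fun i => by
      rw [W.cx_d, ← Category.assoc (V.ι i), (hb i).1]
      simp
  have h₁ : p ≫ s = q ≫ W.descGraded (fun i => 𝟙 (M.obj i)) fun _ => biprod.fst := by
    refine HomologicalComplex.hom_ext _ _ fun i => ?_
    refine biprod_desc_comp_eq_desc_comp (g := s₀ i)
      (h := biprod.desc (W.π i ≫ 𝟙 (M.obj i)) (biprod.fst : M.obj i ⊞ N.obj i ⟶ _))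
      ((ha₃ i).trans (Eq.trans (b := b i ≫ W.π i) (hb₂ i).symm ?_)) (by simp [l])
    simp
  have h₂ : p ≫ f = q ≫ W.descGraded α fun _ => biprod.snd := by
    refine HomologicalComplex.hom_ext _ _ fun i => ?_
    refine biprod_desc_comp_eq_desc_comp (g := f₀ i)
      (h := biprod.desc (W.π i ≫ α i) (biprod.snd : M.obj i ⊞ N.obj i ⟶ _))
      ((hα' i).symm.trans ?_) (by simp [l])
    rw [Category.assoc, biprod.inl_desc, ← Category.assoc, hb₂]
  have h₃ : p ≫ s = V.descGraded (fun i => 𝟙 (M.obj i)) s.f := by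
    refine HomologicalComplex.hom_ext _ _ fun i => ?_
    exact biprod_desc_comp_eq_desc (g := s₀ i) ((ha₃ i).trans (Category.comp_id _).symm)
      (Category.id_comp _)
  exact inv_comp_eq_of_roof_eq (relLoc A t) hφ h₁ h₂
    (isIso_relLoc_map _ (h₃ ▸ V.quasiIso_descGraded s.f))
    (isIso_relLoc_map _ (W.quasiIso_descGraded fun _ => biprod.fst))

-- The parametrizing set is a finite product of finite `Ext¹` and `Hom` groups, as the period is
-- nonzero.
include hfin hher in
lemma finite_hom_toD (M N : GradedObj A t) : Finite (M.toD ⟶ N.toD) := by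
  have := hfin.finite_hom
  have := hfin.finite_ext
  exact Finite.of_surjective _ (roofFamily_surjective.{w} hher M N)

end Finiteness

/-! ### The normalization `a'` is nonzero and trivial at the zero object -/

section ModifiedAut

variable {A : Type u} [Category.{v} A] [Abelian A] {t : ℕ} [NeZero t]

lemma nonempty_hom_toD (M N : GradedObj A t) : Nonempty (M.toD ⟶ N.toD) :=
  ⟨(relLoc A t).map (0 : M.toCx ⟶ N.toCx)⟩

lemma subsingleton_hom_toD (M : GradedObj A t) {N : GradedObj A t} (hN : IsZero N.toCx) :
    Subsingleton (M.toD ⟶ N.toD) := by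
  suffices h : ∀ φ : (relLoc A t).obj M.toCx ⟶ (relLoc A t).obj N.toCx,
      φ = (relLoc A t).map 0 from ⟨fun φ ψ => (h φ).trans (h ψ).symm⟩
  intro φ
  obtain ⟨Z, s, f, hs, h⟩ := exists_roof φ
  have := isIso_relLoc_map s hs
  rw [← cancel_epi ((relLoc A t).map s), h, ← Functor.map_comp]
  exact congr_arg _ (hN.eq_of_tgt _ _)

lemma isZero_toCx {M : GradedObj A t} (h : ∀ i, IsZero (M.obj i)) : IsZero M.toCx := by
  rw [IsZero.iff_id_eq_zero]
  exact HomologicalComplex.hom_ext _ _ fun i => (h i).eq_of_src _ _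

variable [HasExt.{w} A]

namespace BasisCls

/-- `Nat.card` of an infinite type is 0, so this is where finiteness of the morphism sets is
indispensable. -/
lemma modAut_ne_zero (hfin : IsFinitary.{w} A) (hher : IsHereditary.{w} A) (a : BasisCls A t) :
    a.modAut ≠ 0 := by
  induction a using Quotient.inductionOn with | _ M =>
  have hc : ∀ N : GradedObj A t, (0 : ℝ) < Nat.card (N.toD ⟶ M.toD) := fun N => by
    have := finite_hom_toD hfin hher N M
    have := nonempty_hom_toD N M
    exact_mod_cast Nat.card_pos
  have ha : (0 : ℝ) < Nat.card (Aut M.toD) := by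
    have := finite_hom_toD hfin hher M M
    have : Finite (Aut M.toD) := Finite.of_injective (fun e : Aut M.toD => e.hom)
      fun _ _ h => Iso.ext h
    exact_mod_cast Nat.card_pos
  exact (mul_pos ha (Real.sqrt_pos.2 (Finset.prod_pos fun i _ => zpow_pos (hc _) _))).ne'

lemma modAut_zero : (0 : BasisCls A t).modAut = 1 := by
  have h₀ : ∀ i, IsZero ((0 : GradedObj A t).obj i) := fun _ => isZero_zero A
  have hc : ∀ n, Nat.card (((0 : GradedObj A t).shift n).toD ⟶ (0 : GradedObj A t).toD) = 1 := by
    intro n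
    rw [Nat.card_eq_one_iff_unique]
    exact ⟨subsingleton_hom_toD _ (isZero_toCx h₀),
      nonempty_hom_toD _ _⟩
  have ha : Nat.card (Aut (0 : GradedObj A t).toD) = 1 := by
    have := subsingleton_hom_toD (0 : GradedObj A t) (isZero_toCx h₀)
    rw [Nat.card_eq_one_iff_unique]
    exact ⟨⟨fun e e' => Iso.ext (Subsingleton.elim _ _)⟩, inferInstance⟩
  change (Nat.card (Aut (0 : GradedObj A t).toD) : ℝ) * √(∏ i ∈ Finset.Icc 1 t,
    (Nat.card (((0 : GradedObj A t).shift i).toD ⟶ (0 : GradedObj A t).toD) : ℝ) ^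
      ((-1 : ℤ) ^ i)) = 1
  simp [hc, ha]

end BasisCls

end ModifiedAut

lemma Gr.autFamily_zero {A : Type u} [Category.{v} A] [Abelian A] [HasExt.{w} A] {t : ℕ} :
    Gr.autFamily (0 : ZMod t →₀ IsoCls A) = 1 := by
  have := (isZero_ofClasses_zero.{w} (A := A) (t := t))
  rw [Gr.autFamily, aut, Nat.cast_eq_one, Nat.card_eq_one_iff_unique]
  exact ⟨⟨fun e e' => Iso.ext (this.eq_of_src _ _)⟩, ⟨Iso.refl _⟩⟩

end

end HallPeriodic

open HallPeriodic in
theorem theorem3p1 {A : Type u} [Category.{v} A] [Abelian A] [HasExt.{w} A]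
    (hfin : IsFinitary.{w} A) (hher : IsHereditary.{w} A) (t : ℕ) (ht : t = 0 ∨ Odd t) :
    -- all sums in the definition of the multiplication are finite
    (t = 0 → ∀ a₁ a₂ x : BasisCls A t, (Function.support (boundedTerm.{w} a₁ a₂ x)).Finite) ∧
    (Odd t → ∀ a₁ a₂ x : BasisCls A t, (Function.support (periodicTerm.{w} a₁ a₂ x)).Finite) ∧
    (∀ a₁ a₂ : BasisCls A t, {x | structConst.{w} a₁ a₂ x ≠ 0}.Finite) ∧
    -- the multiplication is associative
    (∀ x y z : HallSpace A t,
      hallMul.{w} A t (hallMul.{w} A t x y) z = hallMul.{w} A t x (hallMul.{w} A t y z)) ∧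
    -- `[0]` is a two-sided unit
    (∀ x : HallSpace A t,
      hallMul.{w} A t (basisVec 0) x = x ∧ hallMul.{w} A t x (basisVec 0) = x) := by
  have := hfin.finiteHom
  refine ⟨?_, fun h => ?_, ?_⟩
  · rintro rfl
    exact finite_support_boundedTerm hfin hher
  · have : NeZero t := ⟨h.pos.ne'⟩
    exact finite_support_periodicTerm hfin hher
  · rcases ht with rfl | h
    -- For `t = 0` the rescaling is by the order of the automorphism group in `Gr`, a product over
    -- the degrees.
    · exact hallAlgebra_of_normalization hfin hher (.inl rfl) (fun a => Gr.autFamily a.family)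
        (fun a => aut_ne_zero _) (by rw [BasisCls.family_zero, Gr.autFamily_zero.{w}])
        (structConst_zero hfin hher)
    · have : NeZero t := ⟨h.pos.ne'⟩
      exact hallAlgebra_of_normalization hfin hher (.inr h) BasisCls.modAut
        (BasisCls.modAut_ne_zero hfin hher) BasisCls.modAut_zero
        (structConst_of_ne_zero hfin hher (NeZero.ne t))
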